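/- Let $\Bbbk$ be an algebraically closed field of characteristic $0$, $N=\mathbb Z^3$ and $M=\operatorname{Hom}(N,\mathbb Z)$. For a list $[n_1,\dots,n_r]$ of elements of $N$ and $b\in\mathbb Z^r$ put $M_b=\{m\in M\mid \langle m,n_i\rangle\ge -b_i \text{ for } 1\le i\le r\}$, $\mathsf M_b=\Bbbk M_b\subset \Bbbk[M]$; this is a module over the semigroup ring $\mathsf M_0=\Bbbk M_0$. If $n_1,\dots,n_r\in\mathbb Z^2\times\{1\}$ and $Q\subset\mathbb R^2\times\{1\}$ is their convex hull, write $R_Q=\mathsf M_0$, the coordinate ring of the affine toric variety of the cone over $Q$. (A finitely generated module over a noetherian commutative ring is Cohen–Macaulay if its localization at every maximal ideal of its support has depth equal to its dimension.) Let $P\subset\mathbb R^2\times\{1\}$ be a convex lattice polygon with vertices $n_1,\dots,n_k$ ($k\ge 3$), listed counter-clockwise. Let $n_{k+1}$ and $n_{k+2}$ be lattice points, different from $n_k$, on the edges $[n_{k-1},n_k]$ and $[n_k,n_1]$ respectively (they may or may not be vertices of $P$), and let $P'$ be the polygon obtained from $P$ by removing the triangle with vertices $n_k,n_{k+1},n_{k+2}$,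 i.e. the convex hull of $n_1,\dots,n_{k-1},n_{k+1},n_{k+2}$, which is assumed to be two-dimensional. Write $$n_{k+1}=\sum_{j\le k}t^{(k+1)}_j n_j,\qquad n_{k+2}=\sum_{j\le k+1}t^{(k+2)}_j n_j$$ as convex combinations (coefficients in $[0,1]$ with sum $1$) with $t^{(k+1)}_j=0$ for $j\ne k-1,k$ and $t^{(k+2)}_j=0$ for $j\neq 1,k$. For a sign sequence $\mathfrak s\in\{+,-\}^2$ and $b\in\mathbb Z^k$ let $b_{\mathfrak s}\in\mathbb Z^{k+2}$ be the vector convexly induced from $b$: $(b_{\mathfrak s})_i=b_i$ for $i\le k$, and for $i=k+1,k+2$ successively $(b_{\mathfrak s})_i$ is $\sum_{j<i}t^{(i)}_j(b_{\mathfrak s})_j$ rounded up if the corresponding sign is $+$ and rounded down if it is $-$. Let $\overline{b_{\mathfrak s}}\in\mathbb Z^{k+1}$ be obtained from $b_{\mathfrak s}$ by omitting the $k$-th component. Modules $\mathsf M_b$ over $R_P$ are formed with respect to $[n_1,\dots,n_k]$, and modules $\mathsf M_{\overline{b_{\mathfrak s}}}$ over $R_{P'}$ with respect to $[n_1,\dots,n_{k-1},n_{k+1},n_{k+2}]$.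 Then for every $\mathfrak s\in\{+,-\}^2$: 1. For every $b\in\mathbb Z^k$: if $\mathsf M_b$ is a Cohen–Macaulay $R_P$-module, then $\mathsf M_{\overline{b_{\mathfrak s}}}$ is a Cohen–Macaulay $R_{P'}$-module. 2. For every finite set $S\subset\mathbb Z^k$: if $\operatorname{End}_{R_P}\bigl(\bigoplus_{b\in S}\mathsf M_b\bigr)$ is a Cohen–Macaulay $R_P$-module, then $\operatorname{End}_{R_{P'}}\bigl(\bigoplus_{b\in S}\mathsf M_{\overline{b_{\mathfrak s}}}\bigr)$ is a Cohen–Macaulay $R_{P'}$-module. -/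

import Mathlib

open scoped DirectSum

namespace ToricCM

/-! ### Cohen–Macaulay modules -/

/-- The depth of a module over a local ring: the supremum of the lengths of the regular sequences
on `M` whose members lie in the maximal ideal. -/
noncomputable def depth (A M : Type*) [CommRing A] [IsLocalRing A] [AddCommGroup M] [Module A M] :
    ℕ∞ :=
  ⨆ (rs : List A) (_ : ∀ r ∈ rs, r ∈ IsLocalRing.maximalIdeal A)
    (_ : RingTheory.Sequence.IsRegular M rs), (rs.length : ℕ∞)

/-- A finitely generated module over a (noetherian) commutative ring is Cohen–Macaulay if at every
maximal ideal of its support its localization has depth equal to its dimension. -/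
def IsCohenMacaulay (A M : Type*) [CommRing A] [AddCommGroup M] [Module A M] : Prop :=
  Module.Finite A M ∧
    ∀ (p : Ideal A) [p.IsMaximal], Nontrivial (LocalizedModule p.primeCompl M) →
      ((depth (Localization.AtPrime p) (LocalizedModule p.primeCompl M) : ℕ∞) : WithBot ℕ∞) =
        Module.supportDim (Localization.AtPrime p) (LocalizedModule p.primeCompl M)

/-! ### Affine toric rings and their modules attached to integer vectors

`N` is a lattice, `Module.Dual ℤ N = Hom(N, ℤ)`, and a family `n : ι → N` presents the cone
`σ = [n]` that it generates. -/

section Toric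

variable (𝕜 : Type*) [Field 𝕜] {N ι : Type*} [AddCommGroup N]

/-- The lattice points `σ^∨ ∩ Hom(N, ℤ)` of the dual cone. -/
def dualMonoid (n : ι → N) : AddSubmonoid (Module.Dual ℤ N) where
  carrier := {m | ∀ i, 0 ≤ m (n i)}
  zero_mem' := by intro i; simp
  add_mem' := by
    intro a b ha hb i
    have h1 := ha i
    have h2 := hb i
    simp only [LinearMap.add_apply]
    omega

/-- The set `M_b` of all `m` with `⟨m, n_i⟩ ≥ -b_i` for all `i`. -/
def weightSet (n : ι → N) (b : ι → ℤ) : Set (Module.Dual ℤ N) :=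
  {m | ∀ i, -b i ≤ m (n i)}

/-- The semigroup algebra `𝕜[σ^∨ ∩ Hom(N, ℤ)]` inside the group algebra of `Hom(N, ℤ)`. -/
def toricSubalgebra (n : ι → N) : Subalgebra 𝕜 (AddMonoidAlgebra 𝕜 (Module.Dual ℤ N)) where
  carrier := {f | ∀ m ∈ f.coeff.support, m ∈ dualMonoid n}
  mul_mem' := by
    classical
    intro f g hf hg m hm
    obtain ⟨a, ha, b, hb, rfl⟩ :=
      Finset.mem_add.1 (AddMonoidAlgebra.support_coeff_mul_subset f g hm)
    exact add_mem (hf a ha) (hg b hb)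
  add_mem' := by
    classical
    intro f g hf hg m hm
    rcases Finset.mem_union.1 (Finsupp.support_add hm) with h | h
    · exact hf m h
    · exact hg m h
  algebraMap_mem' := by
    intro r m hm
    have h : m = 0 := by
      by_contra hne
      exact (Finsupp.mem_support_iff.1 hm)
        (by simp [AddMonoidAlgebra.coe_algebraMap, Ne.symm hne])
    rw [h]
    exact zero_mem _

/-- The ring `R_σ = 𝕜[σ^∨ ∩ Hom(N, ℤ)]`. -/
def ToricRing (n : ι → N) : Type _ := toricSubalgebra 𝕜 n

noncomputable instance (n : ι → N) : CommRing (ToricRing 𝕜 n) :=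
  inferInstanceAs (CommRing (toricSubalgebra 𝕜 n))

noncomputable instance (n : ι → N) : Algebra 𝕜 (ToricRing 𝕜 n) :=
  inferInstanceAs (Algebra 𝕜 (toricSubalgebra 𝕜 n))

/-- The span `𝕜 M_b` of `M_b` in the group algebra of `Hom(N, ℤ)`, closed under multiplication by
elements of `R_σ`. -/
def toricSubmodule (n : ι → N) (b : ι → ℤ) :
    Submodule (toricSubalgebra 𝕜 n) (AddMonoidAlgebra 𝕜 (Module.Dual ℤ N)) where
  carrier := {f | ∀ m ∈ f.coeff.support, m ∈ weightSet n b}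
  zero_mem' := by intro m hm; simp at hm
  add_mem' := by
    classical
    intro f g hf hg m hm
    have hm' : m ∈ (f.coeff + g.coeff).support := by
      rw [← AddMonoidAlgebra.coeff_add]
      exact hm
    rcases Finset.mem_union.1 (Finsupp.support_add hm') with h | h
    · exact hf m h
    · exact hg m h
  smul_mem' := by
    classical
    intro r f hf m hm
    rw [Algebra.smul_def] at hm
    obtain ⟨a, ha, c, hc, rfl⟩ :=
      Finset.mem_add.1 (AddMonoidAlgebra.support_coeff_mul_subset _ f hm)
    intro i
    have h1 : 0 ≤ a (n i) := r.2 a ha i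
    have h2 : -b i ≤ c (n i) := hf c hc i
    simp only [LinearMap.add_apply]
    omega

/-- The `R_σ`-module `𝕜 M_b`. -/
def ToricModule (n : ι → N) (b : ι → ℤ) : Type _ := toricSubmodule 𝕜 n b

noncomputable instance (n : ι → N) (b : ι → ℤ) : AddCommGroup (ToricModule 𝕜 n b) :=
  inferInstanceAs (AddCommGroup (toricSubmodule 𝕜 n b))

noncomputable instance (n : ι → N) (b : ι → ℤ) : Module (ToricRing 𝕜 n) (ToricModule 𝕜 n b) :=
  inferInstanceAs (Module (toricSubalgebra 𝕜 n) (toricSubmodule 𝕜 n b))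

end Toric

/-! ### Convex induction -/

/-- The two signs that prescribe rounding down (`minus`) or up (`plus`). -/
inductive PM
  | plus
  | minus

/-- Rounding as prescribed by a sign. -/
noncomputable def PM.round : PM → ℝ → ℤ
  | .plus, x => ⌈x⌉
  | .minus, x => ⌊x⌋

/-- The coefficient vectors of `l` successive induction steps that start with `k` entries; the
`i`-th step (counted from `0`) has `k + i` coefficients. -/
abbrev Weights (k l : ℕ) := (i : Fin l) → Fin (k + i) → ℝ

/-- An induction datum: the coefficients of each step lie in `[0, 1]` and sum to `1`. -/
def IsInductionDatum {k l : ℕ} (t : Weights k l) : Prop :=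
  ∀ i, (∀ j, 0 ≤ t i j ∧ t i j ≤ 1) ∧ ∑ j, t i j = 1

/-- The family `n'` of lattice points extends `n`, each new point being the convex combination of
all the preceding ones that the datum `t` prescribes. -/
def IsConvexlyInduced {k l d : ℕ} (n : Fin k → Fin d → ℤ) (t : Weights k l)
    (n' : Fin (k + l) → Fin d → ℤ) : Prop :=
  (∀ i, n' (Fin.castAdd l i) = n i) ∧
    ∀ (i : Fin l) (c : Fin d), (n' (Fin.natAdd k i) c : ℝ) =
      ∑ j : Fin (k + i), t i j * (n' (Fin.castLE (by omega) j) c : ℝ)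

/-- The integer vector convexly induced from `b` with sign sequence `s` and datum `t`: each new
entry is the prescribed convex combination of all the preceding entries, rounded as `s` says. -/
noncomputable def convexInduce {k : ℕ} :
    {l : ℕ} → Weights k l → (Fin l → PM) → (Fin k → ℤ) → Fin (k + l) → ℤ
  | 0, _, _, b => b
  | l + 1, t, s, b =>
    let b' : Fin (k + l) → ℤ :=
      convexInduce (fun i : Fin l => t i.castSucc) (fun i => s i.castSucc) b
    Fin.snoc (α := fun _ => ℤ) b'
      ((s (Fin.last l)).round (∑ j : Fin (k + l), t (Fin.last l) j * (b' j : ℝ)))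

/-! ### Lattice polygons and corner cuts -/

/-- `n_1, …, n_k` are lattice points of the plane `ℝ² × {1}`, and they are the vertices of a convex
polygon, listed counter-clockwise: every directed edge from a vertex to the cyclically next one has
all the other vertices strictly on its left. (The determinant is twice the signed area of the
triangle with the three given corners.) -/
def IsPolygon {k : ℕ} (n : Fin k → Fin 3 → ℤ) : Prop :=
  3 ≤ k ∧ (∀ i, n i 2 = 1) ∧
    ∀ i j, j ≠ i → j ≠ finRotate k i → 0 < (Matrix.of ![n i, n (finRotate k i), n j]).det

/-- Omit the `k`-th entry (the one with index `k - 1`, counted from `0`) of `k + 2` entries. -/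
def omitCorner {k : ℕ} {α : Type*} (x : Fin (k + 2) → α) : Fin (k + 1) → α :=
  fun j => x (Fin.succAbove (⟨k - 1, by omega⟩ : Fin (k + 2)) j)

/-- The list `n' = (n_1, …, n_k, n_{k+1}, n_{k+2})` describes the removal, from the polygon `P` with
the vertices `n`, of a triangle with the corners `n_k`, `n_{k+1}`, `n_{k+2}`: with the
induction datum `t`, the lattice point `n_{k+1}` is induced from the end points of the edge
`[n_{k-1}, n_k]` and the lattice point `n_{k+2}` from those of the edge `[n_k, n_1]`, both are
different from `n_k`, and the part `P'` of `P` that is left over, the convex hull of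
`n_1, …, n_{k-1}, n_{k+1}, n_{k+2}`, is still two-dimensional. -/
structure IsCornerCut {k : ℕ} (n : Fin k → Fin 3 → ℤ) (t : Weights k 2)
    (n' : Fin (k + 2) → Fin 3 → ℤ) : Prop where
  datum : IsInductionDatum t
  induced : IsConvexlyInduced n t n'
  edge₁ : ∀ j, t 0 j ≠ 0 → (j : ℕ) + 2 = k ∨ (j : ℕ) + 1 = k
  edge₂ : ∀ j, t 1 j ≠ 0 → (j : ℕ) = 0 ∨ (j : ℕ) + 1 = k
  ne₁ : n' ⟨k, by omega⟩ ≠ n' ⟨k - 1, by omega⟩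
  ne₂ : n' ⟨k + 1, by omega⟩ ≠ n' ⟨k - 1, by omega⟩
  nondegenerate :
    Submodule.span ℝ (Set.range fun (j : Fin (k + 1)) (c : Fin 3) => (omitCorner n' j c : ℝ)) = ⊤

end ToricCM

/-! ### Regular sequences of length three and Koszul vanishing -/

namespace ToricCM

open RingTheory.Sequence

/-! Everything rests on a sign criterion. Call the vertex n_j violated by m ∈ M if ⟨m, n_j⟩ < -b_j.
Then 𝕜M_b is Cohen–Macaulay if and only if, for every m, the violated vertices form a cyclic
interval (`NoAlternation`). Cohomologically, depth two is automatic because 𝕜M_b is cut out by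
conditions along the rays, and the degree-m part of the second local cohomology at the torus-fixed
point is the reduced H⁰ of the violated part of the boundary circle.

Necessity (`not_isCohenMacaulay_of_arc`): if two violated vertices are separated by two satisfied
ones, χ^m is a section over the intersection of two open sets that cover the punctured spectrum.
Depth three would write a multiple of it, by a function not vanishing at the fixed point, as a sum
of sections over the two sets (`IsRegTriple.exists_add`, `IsCohenMacaulay.exists_split`). Neither
summand can contain χ^m.

Sufficiency (`IsConvexList.isRegIn`): explicit homogeneous parameters x, y, z of equal degree are
shown to be regular on 𝕜M_b. Subtracting scalars preserves regularity (`IsRegIn.sub_algebraMap`),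
and by the Nullstellensatz every maximal ideal contains suitable translates, so the depth is at
least three everywhere, while the ring has dimension at most three.

Since Hom(𝕜M_b, 𝕜M_b') = 𝕜M_{b'-b}, the endomorphism ring is, as a module, a finite product of such
modules (`IsFrame.endEquiv`). Both claims thus concern sign patterns of differences b' - b, the
first one with b = 0 as the vector that is subtracted.

For the corner cut, rounding is monotone and commutes with integer shifts, so the sign of a
difference of induced vectors at a new point is the sign at one of the two ends of its edge
(`PM.round_sub_round_sign`). The new cyclic sign sequence therefore comes from the old one by
omitting or repeating entries in place, which creates no alternation (`IsCorner.noAlternation`). A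
new point may coincide with n_{k-1} or n_1; `IsFrame` discards such repetitions. -/

/-- The elementwise form of weak regularity for sequences of length three. -/
structure IsRegTriple (A V : Type*) [CommRing A] [AddCommGroup V] [Module A V] (x y z : A) :
    Prop where
  fst : ∀ u : V, x • u = 0 → u = 0
  snd : ∀ u v : V, y • u = x • v → ∃ w, u = x • w
  trd : ∀ u v w : V, z • u = x • v + y • w → ∃ v' w', u = x • v' + y • w'

section RegTriple

variable {A V V' : Type*} [CommRing A] [AddCommGroup V] [Module A V] [AddCommGroup V'] [Module A V']
  {x y z : A}

theorem quotSMulTop_mk_eq_zero_iff (u : V) :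
    (Submodule.Quotient.mk u : QuotSMulTop x V) = 0 ↔ ∃ w, u = x • w := by
  rw [Submodule.Quotient.mk_eq_zero, Submodule.mem_smul_pointwise_iff_exists]
  constructor
  · rintro ⟨w, -, h⟩; exact ⟨w, h.symm⟩
  · rintro ⟨w, h⟩; exact ⟨w, trivial, h.symm⟩

theorem quotSMulTop_quotSMulTop_mk_eq_zero_iff (u : V) :
    (Submodule.Quotient.mk (Submodule.Quotient.mk u : QuotSMulTop x V) :
      QuotSMulTop y (QuotSMulTop x V)) = 0 ↔ ∃ v w, u = x • v + y • w := by
  rw [quotSMulTop_mk_eq_zero_iff]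
  constructor
  · rintro ⟨w, h⟩
    obtain ⟨w, rfl⟩ := Submodule.Quotient.mk_surjective _ w
    rw [← Submodule.Quotient.mk_smul, ← sub_eq_zero, ← Submodule.Quotient.mk_sub,
      quotSMulTop_mk_eq_zero_iff] at h
    obtain ⟨v, hv⟩ := h
    exact ⟨v, w, by rw [← hv]; abel⟩
  · rintro ⟨v, w, rfl⟩
    refine ⟨Submodule.Quotient.mk w, ?_⟩
    rw [← Submodule.Quotient.mk_smul, ← sub_eq_zero, ← Submodule.Quotient.mk_sub,
      quotSMulTop_mk_eq_zero_iff]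
    exact ⟨v, by abel⟩

theorem isWeaklyRegular_triple_iff : IsWeaklyRegular V [x, y, z] ↔ IsRegTriple A V x y z := by
  simp only [isWeaklyRegular_cons_iff, isSMulRegular_iff_right_eq_zero_of_smul]
  constructor
  · rintro ⟨h1, h2, h3, -⟩
    refine ⟨h1, fun u v h => ?_, fun u v w h => ?_⟩
    · rw [← quotSMulTop_mk_eq_zero_iff]
      apply h2
      rw [← Submodule.Quotient.mk_smul, quotSMulTop_mk_eq_zero_iff]
      exact ⟨v, h⟩
    · rw [← quotSMulTop_quotSMulTop_mk_eq_zero_iff]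
      apply h3
      rw [← Submodule.Quotient.mk_smul, ← Submodule.Quotient.mk_smul,
        quotSMulTop_quotSMulTop_mk_eq_zero_iff]
      exact ⟨v, w, h⟩
  · rintro ⟨h1, h2, h3⟩
    refine ⟨h1, fun u h => ?_, fun u h => ?_, IsWeaklyRegular.nil _ _⟩
    · obtain ⟨u, rfl⟩ := Submodule.Quotient.mk_surjective _ u
      rw [← Submodule.Quotient.mk_smul, quotSMulTop_mk_eq_zero_iff] at h
      rw [quotSMulTop_mk_eq_zero_iff]
      obtain ⟨v, hv⟩ := h
      exact h2 u v hv
    · obtain ⟨u, rfl⟩ := Submodule.Quotient.mk_surjective _ u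
      obtain ⟨u, rfl⟩ := Submodule.Quotient.mk_surjective _ u
      rw [← Submodule.Quotient.mk_smul, ← Submodule.Quotient.mk_smul,
        quotSMulTop_quotSMulTop_mk_eq_zero_iff] at h
      rw [quotSMulTop_quotSMulTop_mk_eq_zero_iff]
      obtain ⟨v, w, h⟩ := h
      exact h3 u v w h

/-- Witnesses found in the larger module are pushed back along `p`. This is how regularity passes
from an endomorphism module to a single matrix entry. -/
theorem IsRegTriple.of_retract (h : IsRegTriple A V' x y z) (i : V →ₗ[A] V') (p : V' →ₗ[A] V)
    (hip : ∀ v, p (i v) = v) : IsRegTriple A V x y z := by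
  refine ⟨fun u hu => ?_, fun u v huv => ?_, fun u v w huvw => ?_⟩
  · rw [← hip u, h.fst (i u) (by rw [← map_smul, hu, map_zero]), map_zero]
  · obtain ⟨w, hw⟩ := h.snd (i u) (i v) (by rw [← map_smul, huv, map_smul])
    exact ⟨p w, by rw [← map_smul, ← hw, hip]⟩
  · obtain ⟨v', w', h'⟩ := h.trd (i u) (i v) (i w) (by
      rw [← map_smul, huvw, map_add, map_smul, map_smul])
    exact ⟨p v', p w', by rw [← map_smul, ← map_smul, ← map_add, ← h', hip]⟩

theorem IsRegTriple.pi {ι : Type*} {W : ι → Type*} [∀ i, AddCommGroup (W i)] [∀ i, Module A (W i)]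
    (h : ∀ i, IsRegTriple A (W i) x y z) : IsRegTriple A (∀ i, W i) x y z := by
  refine ⟨fun u hu => ?_, fun u v huv => ?_, fun u v w huvw => ?_⟩
  · ext i
    exact (h i).fst (u i) (congrFun hu i)
  · choose w hw using fun i => (h i).snd (u i) (v i) (congrFun huv i)
    exact ⟨w, funext hw⟩
  · choose v' w' hw using fun i => (h i).trd (u i) (v i) (w i) (congrFun huvw i)
    exact ⟨v', w', funext hw⟩

/-- The last member enters only through its injectivity on V/(xV + yV), which its powers share. -/
theorem IsRegTriple.pow_right (h : IsRegTriple A V x y z) (n : ℕ) :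
    IsRegTriple A V x y (z ^ n) := by
  refine ⟨h.fst, h.snd, ?_⟩
  induction n with
  | zero => intro u v w huvw; exact ⟨v, w, by simpa using huvw⟩
  | succ n ih =>
    intro u v w huvw
    rw [pow_succ', mul_smul] at huvw
    obtain ⟨v', w', h'⟩ := h.trd _ _ _ huvw
    exact ih u v' w' h'

theorem IsRegTriple.rotate [IsLocalRing A] [IsNoetherian A V] (h : IsRegTriple A V x y z)
    (hx : x ∈ IsLocalRing.maximalIdeal A) (hy : y ∈ IsLocalRing.maximalIdeal A)
    (hz : z ∈ IsLocalRing.maximalIdeal A) : IsRegTriple A V y z x := by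
  rw [← isWeaklyRegular_triple_iff] at h ⊢
  refine IsLocalRing.isWeaklyRegular_of_perm_of_subset_maximalIdeal h ?_
    (by simpa using ⟨hx, hy, hz⟩)
  exact (List.perm_append_comm (l₁ := [x]) (l₂ := [y, z]))

/-- Over a local ring a regular sequence may be permuted, so each member is raised to its power
while it stands last. Powers are needed later because only they are known to lie in a given ideal
primary to the maximal ideal. -/
theorem IsRegTriple.pow [IsLocalRing A] [IsNoetherian A V] (h : IsRegTriple A V x y z)
    (hx : x ∈ IsLocalRing.maximalIdeal A) (hy : y ∈ IsLocalRing.maximalIdeal A)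
    (hz : z ∈ IsLocalRing.maximalIdeal A) {n : ℕ} (hn : n ≠ 0) :
    IsRegTriple A V (x ^ n) (y ^ n) (z ^ n) := by
  have hx' := Ideal.pow_mem_of_mem _ hx n (Nat.pos_of_ne_zero hn)
  have hy' := Ideal.pow_mem_of_mem _ hy n (Nat.pos_of_ne_zero hn)
  have hz' := Ideal.pow_mem_of_mem _ hz n (Nat.pos_of_ne_zero hn)
  have h1 := ((h.pow_right n).rotate hx hy hz').pow_right n
  have h2 := (h1.rotate hy hz' hx').pow_right n
  exact h2.rotate hz' hx' hy'

/-- The vanishing of the second Koszul cohomology module of a regular sequence of length three. -/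
theorem IsRegTriple.koszul (h : IsRegTriple A V x y z) {p q r : V}
    (hpqr : z • p + x • r = y • q) :
    ∃ a b c : V, p = x • b - y • a ∧ q = x • c - z • a ∧ r = y • c - z • b := by
  obtain ⟨b, a, hp⟩ := h.trd p (-r) q (by rw [smul_neg, ← hpqr]; abel)
  -- Substituting p = xb + ya turns the relation into y(q - za) = x(zb + r), so q - za is divisible
  -- by x.
  obtain ⟨c, hc⟩ := h.snd (q - z • a) (z • b + r) (by
    rw [smul_sub, ← hpqr, hp]
    simp only [smul_add, ← mul_smul, mul_comm]
    abel)
  refine ⟨-a, b, c, by rw [hp, smul_neg]; abel, by rw [← hc, smul_neg]; abel, ?_⟩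
  have h0 : x • (z • b + r - y • c) = 0 := by
    have h1 : q = x • c + z • a := by rw [← hc]; abel
    rw [h1, hp] at hpqr
    have h2 : x • r = y • (x • c + z • a) - z • (x • b + y • a) := by
      rw [← hpqr]; abel
    rw [smul_sub, smul_add, h2]
    simp only [smul_add, ← mul_smul, mul_comm]
    abel
  have h3 := h.fst _ h0
  rw [sub_eq_zero] at h3
  rw [← h3]; abel

end RegTriple

/-- If the sequence is regular on `V`, then a section over the intersection of the complements of
`V(I₁)` and `V(I₂)` is the sum of sections over these complements. -/
theorem IsRegTriple.exists_add {A W : Type*} [CommRing A] [AddCommGroup W] [Module A W]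
    {V : Submodule A W} {x y z : A} (h : IsRegTriple A V x y z)
    (I₁ I₂ : Ideal A) (hx : x ∈ I₁ ⊔ I₂) (hy : y ∈ I₁ ⊔ I₂) (hz : z ∈ I₁ ⊔ I₂)
    (hxW : ∀ w : W, x • w = 0 → w = 0) (f : W)
    (hf : ∀ d ∈ I₁, ∀ e ∈ I₂, (d * e) • f ∈ V)
    (d₁ : A) (hd₁ : d₁ ∈ I₁) (hinj : ∀ w : W, d₁ • w = 0 → w = 0)
    (hsurj : ∀ w : W, ∃ w', d₁ • w' = w) :
    ∃ f₁ f₂ : W, f = f₁ + f₂ ∧ (∀ d ∈ I₁, d • f₁ ∈ V) ∧ ∀ d ∈ I₂, d • f₂ ∈ V := by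
  obtain ⟨a₁, ha₁, a₂, ha₂, rfl⟩ := Submodule.mem_sup.1 hx
  obtain ⟨b₁, hb₁, b₂, hb₂, rfl⟩ := Submodule.mem_sup.1 hy
  obtain ⟨c₁, hc₁, c₂, hc₂, rfl⟩ := Submodule.mem_sup.1 hz
  -- If f = f₁ + f₂ as desired, then (s₁ + s₂)f₁ differs from s₂f by s₁f₁ - s₂f₂ ∈ V. So s₂f is the
  -- expected value modulo V, and these values satisfy the Koszul cocycle condition modulo V.
  have key : ∀ s₁ s₂ t₁ t₂ : A, s₁ ∈ I₁ → s₂ ∈ I₂ → t₁ ∈ I₁ → t₂ ∈ I₂ →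
      (s₁ + s₂) • t₂ • f - (t₁ + t₂) • s₂ • f ∈ V := by
    intro s₁ s₂ t₁ t₂ h1 h2 h3 h4
    have : (s₁ + s₂) • t₂ • f - (t₁ + t₂) • s₂ • f = (s₁ * t₂) • f - (t₁ * s₂) • f := by
      simp only [← mul_smul, ← sub_smul]; congr 1; ring
    rw [this]
    exact V.sub_mem (hf _ h1 _ h4) (hf _ h3 _ h2)
  -- Koszul vanishing corrects a₂f and b₂f by elements of V so that x(b₂f - b) = y(a₂f - a) holds
  -- exactly.
  obtain ⟨a, b, c, h1, h2, h3⟩ := h.koszul (p := ⟨_, key a₁ a₂ b₁ b₂ ha₁ ha₂ hb₁ hb₂⟩)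
    (q := ⟨_, key a₁ a₂ c₁ c₂ ha₁ ha₂ hc₁ hc₂⟩) (r := ⟨_, key b₁ b₂ c₁ c₂ hb₁ hb₂ hc₁ hc₂⟩) (by
      ext
      simp only [Submodule.coe_add, Submodule.coe_smul, ← mul_smul, ← sub_smul, ← add_smul]
      congr 1; ring)
  have h1 := congrArg Subtype.val h1
  simp only [Submodule.coe_sub, Submodule.coe_smul] at h1
  set x := a₁ + a₂ with hxdef
  set y := b₁ + b₂ with hydef
  have hxy : x • (b₂ • f - (b : W)) = y • (a₂ • f - (a : W)) := by
    rw [smul_sub, smul_sub]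
    have : x • b₂ • f = y • a₂ • f + (x • (b : W) - y • (a : W)) := by rw [← h1]; abel
    rw [this]; abel
  have hI₁ : ∀ d ∈ I₁, ∀ e ∈ I₂, ∀ v : V, d • (e • f - (v : W)) ∈ V := by
    intro d hd e he v
    rw [smul_sub, ← mul_smul]
    exact V.sub_mem (hf d hd e he) (V.smul_mem _ v.2)
  have hdiv : ∀ d ∈ I₁, ∃ g : V, d • (a₂ • f - (a : W)) = x • (g : W) := by
    intro d hd
    obtain ⟨g, hg⟩ := h.snd ⟨_, hI₁ d hd a₂ ha₂ a⟩ ⟨_, hI₁ d hd b₂ hb₂ b⟩ (by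
      ext
      simp only [Submodule.coe_smul]
      rw [smul_comm y d, ← hxy, smul_comm])
    exact ⟨g, congrArg Subtype.val hg⟩
  -- The summand f₁ is (a₂f - a)/x. Division by x need not be possible in W, but d₁ is bijective
  -- there, so f₁ is found as g₁/d₁.
  obtain ⟨g₁, hg₁⟩ := hdiv d₁ hd₁
  obtain ⟨f₁, hf₁⟩ := hsurj g₁
  have hxcancel : ∀ w w' : W, x • w = x • w' → w = w' := fun w w' hw =>
    sub_eq_zero.1 (hxW _ (by rw [smul_sub, hw, sub_self]))
  have hxf₁ : x • f₁ = a₂ • f - (a : W) := by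
    refine sub_eq_zero.1 (hinj _ ?_)
    rw [smul_sub, hg₁, ← hf₁, smul_comm, sub_self]
  have hyf₁ : y • f₁ = b₂ • f - (b : W) := by
    apply hxcancel
    rw [hxy, ← hxf₁, smul_comm]
  refine ⟨f₁, f - f₁, by abel, fun d hd => ?_, fun d hd => ?_⟩
  · obtain ⟨g, hg⟩ := hdiv d hd
    have : d • f₁ = g := by
      apply hxcancel
      rw [← hg, ← hxf₁, smul_comm]
    rw [this]; exact g.2
  -- The complementary summand satisfies the same equations with the roles of I₁ and I₂ exchanged.
  · have e1 : x • (f - f₁) = a₁ • f + (a : W) := by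
      rw [smul_sub, hxf₁, hxdef, add_smul]; abel
    have e2 : y • (f - f₁) = b₁ • f + (b : W) := by
      rw [smul_sub, hyf₁, hydef, add_smul]; abel
    have hmem : ∀ e ∈ I₁, ∀ v : V, d • (e • f + (v : W)) ∈ V := by
      intro e he v
      rw [smul_add, ← mul_smul, mul_comm]
      exact V.add_mem (hf e he d hd) (V.smul_mem _ v.2)
    obtain ⟨g, hg⟩ := h.snd ⟨_, hmem a₁ ha₁ a⟩ ⟨_, hmem b₁ hb₁ b⟩ (by
      ext
      simp only [Submodule.coe_smul]
      rw [← e1, ← e2, smul_comm x d, smul_comm y d, smul_comm y x])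
    have : d • (f - f₁) = g := by
      apply hxcancel
      have := congrArg Subtype.val hg
      simp only [Submodule.coe_smul] at this
      rw [← this, ← e1, smul_comm]
    rw [this]; exact g.2

/-! ### Cohen–Macaulayness through regular triples -/

section CohenMacaulay

variable {R : Type*} [CommRing R]

/-- A Cohen–Macaulay module of dimension at least three at `p` has a regular triple there. -/
theorem IsCohenMacaulay.exists_isRegTriple [IsNoetherianRing R] {X : Type*} [AddCommGroup X]
    [Module R X] (hX : IsCohenMacaulay R X) (p : Ideal R) [p.IsMaximal]
    (hdim : 3 ≤ Module.supportDim (Localization.AtPrime p) (LocalizedModule p.primeCompl X)) :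
    ∃ x y z : Localization.AtPrime p,
      x ∈ IsLocalRing.maximalIdeal _ ∧ y ∈ IsLocalRing.maximalIdeal _ ∧
      z ∈ IsLocalRing.maximalIdeal _ ∧
      IsRegTriple (Localization.AtPrime p) (LocalizedModule p.primeCompl X) x y z := by
  have hnt : Nontrivial (LocalizedModule p.primeCompl X) := by
    rw [← Module.supportDim_ne_bot_iff_nontrivial (Localization.AtPrime p)]
    intro h
    rw [h] at hdim
    exact absurd hdim (by decide)
  rw [← hX.2 p hnt] at hdim
  have h2 : (2 : ℕ∞) < depth (Localization.AtPrime p) (LocalizedModule p.primeCompl X) := by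
    have h3 : (3 : ℕ∞) ≤ depth (Localization.AtPrime p) (LocalizedModule p.primeCompl X) := by
      exact WithBot.coe_le_coe.1 hdim
    exact lt_of_lt_of_le (by norm_num) h3
  simp only [depth, lt_iSup_iff] at h2
  obtain ⟨rs, hmem, hreg, hlen⟩ := h2
  have hlen' : 2 < rs.length := by exact_mod_cast hlen
  match rs, hlen' with
  | x :: y :: z :: l, _ =>
    refine ⟨x, y, z, hmem x (by simp), hmem y (by simp), hmem z (by simp), ?_⟩
    rw [← isWeaklyRegular_triple_iff]
    exact ((isWeaklyRegular_append_iff _ [x, y, z] l).1 hreg.toIsWeaklyRegular).1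

/-- Depth never exceeds the dimension of the support. Conversely the triple gives depth at least
three, and the ring has no room for a support of larger dimension. -/
theorem isCohenMacaulay_of_isRegTriple [IsNoetherianRing R] {X : Type*} [AddCommGroup X]
    [Module R X] [Module.Finite R X]
    (hdim : ∀ (p : Ideal R) [p.IsMaximal], ringKrullDim (Localization.AtPrime p) ≤ 3)
    (hreg : ∀ (p : Ideal R) [p.IsMaximal], ∃ x ∈ p, ∃ y ∈ p, ∃ z ∈ p, IsRegTriple R X x y z) :
    IsCohenMacaulay R X := by
  refine ⟨inferInstance, fun p _ hnt => ?_⟩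
  have hfin : Module.Finite (Localization.AtPrime p) (LocalizedModule p.primeCompl X) :=
    Module.Finite.of_isLocalizedModule p.primeCompl (LocalizedModule.mkLinearMap p.primeCompl X)
  have hnoeth : IsNoetherianRing (Localization.AtPrime p) :=
    IsLocalization.isNoetherianRing p.primeCompl _ inferInstance
  apply le_antisymm
  · have hle : ∀ rs : List (Localization.AtPrime p),
        IsRegular (LocalizedModule p.primeCompl X) rs →
        ((rs.length : ℕ∞) : WithBot ℕ∞) ≤ Module.supportDim (Localization.AtPrime p)
          (LocalizedModule p.primeCompl X) := by
      intro rs hrs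
      -- Each member of a regular sequence lowers the dimension by one, and the final quotient is
      -- nonzero, so its dimension is not ⊥.
      rw [← Module.supportDim_add_length_eq_supportDim_of_isRegular rs hrs]
      have := hrs.quot_ofList_smul_nontrivial
      have hne := Module.supportDim_ne_bot_of_nontrivial (Localization.AtPrime p)
        (LocalizedModule p.primeCompl X ⧸ Ideal.ofList rs •
          (⊤ : Submodule (Localization.AtPrime p) (LocalizedModule p.primeCompl X)))
      obtain ⟨d, hd⟩ := WithBot.ne_bot_iff_exists.1 hne
      rw [← hd]
      exact_mod_cast le_add_self
    obtain ⟨d, hd⟩ := WithBot.ne_bot_iff_exists.1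
      (Module.supportDim_ne_bot_of_nontrivial (Localization.AtPrime p)
        (LocalizedModule p.primeCompl X))
    rw [← hd]
    rw [WithBot.coe_le_coe]
    refine iSup_le fun rs => iSup_le fun _ => iSup_le fun hrs => ?_
    have := hle rs hrs
    rw [← hd] at this
    exact_mod_cast this
  · refine (Module.supportDim_le_ringKrullDim _ _).trans ((hdim p).trans ?_)
    obtain ⟨x, hx, y, hy, z, hz, h⟩ := hreg p
    have hmem : ∀ r ∈ [x, y, z], r ∈ p := by simp [hx, hy, hz]
    have h' := (isWeaklyRegular_triple_iff.2 h).isRegular_of_isLocalizedModule_of_mem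
      (Localization.AtPrime p) p (LocalizedModule.mkLinearMap p.primeCompl X) hmem
    have : (3 : ℕ∞) ≤ depth (Localization.AtPrime p) (LocalizedModule p.primeCompl X) := by
      refine le_iSup_of_le _ (le_iSup_of_le ?_ (le_iSup_of_le h' ?_))
      · intro r hr
        obtain ⟨r, hr', rfl⟩ := List.mem_map.1 hr
        exact (IsLocalization.AtPrime.to_map_mem_maximal_iff _ p r).2 (hmem r hr')
      · simp
    exact WithBot.coe_le_coe.2 this

end CohenMacaulay

end ToricCM

namespace ToricCM

/-! ### The group algebra of the dual lattice -/

section GroupAlgebra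

variable {𝕜 : Type*} [Field 𝕜] {N : Type*} [AddCommGroup N]

/-- The group algebra of `Hom(N, ℤ)`. -/
abbrev GroupAlg (𝕜 N : Type*) [Field 𝕜] [AddCommGroup N] :=
  AddMonoidAlgebra 𝕜 (Module.Dual ℤ N)

/-- This makes the group algebra a domain; the property is inherited from the integer-valued
functions on N. -/
instance : UniqueSums (Module.Dual ℤ N) :=
  UniqueSums.of_injective_addHom (H := Module.Dual ℤ N) (G := N → ℤ)
    ⟨fun m w => m w, fun _ _ => rfl⟩ (fun _ _ h => LinearMap.ext (congrFun h)) inferInstance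

/-- The character `χ^m`. -/
noncomputable abbrev chi (𝕜 : Type*) [Field 𝕜] (m : Module.Dual ℤ N) : GroupAlg 𝕜 N :=
  AddMonoidAlgebra.single m 1

theorem chi_ne_zero (m : Module.Dual ℤ N) : chi 𝕜 m ≠ 0 := by
  simp [chi]

theorem chi_mul_chi (m m' : Module.Dual ℤ N) : chi 𝕜 m * chi 𝕜 m' = chi 𝕜 (m + m') := by
  simp [chi, AddMonoidAlgebra.single_mul_single]

theorem chi_pow (m : Module.Dual ℤ N) (r : ℕ) : chi 𝕜 m ^ r = chi 𝕜 (r • m) := by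
  simp [chi, AddMonoidAlgebra.single_pow]

theorem chi_zero : chi 𝕜 (0 : Module.Dual ℤ N) = 1 := rfl

theorem coeff_chi_mul (m m' : Module.Dual ℤ N) (f : GroupAlg 𝕜 N) :
    (chi 𝕜 m * f).coeff m' = f.coeff (m' - m) := by
  simp [chi, AddMonoidAlgebra.coeff_single_mul_apply, sub_eq_neg_add]

/-- All exponents of `f` take values at least `c` on `w`. -/
def LowerBound (w : N) (c : ℤ) (f : GroupAlg 𝕜 N) : Prop :=
  ∀ m ∈ f.coeff.support, c ≤ m w

/-- All exponents of `f` take the value `d` on `w`. -/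
def IsHomog (w : N) (d : ℤ) (f : GroupAlg 𝕜 N) : Prop :=
  ∀ m ∈ f.coeff.support, m w = d

/-- The homogeneous component of `f` of degree `d` with respect to `w`. -/
noncomputable def part (w : N) (d : ℤ) : GroupAlg 𝕜 N →+ GroupAlg 𝕜 N where
  toFun f := .ofCoeff (f.coeff.filter fun m => m w = d)
  map_zero' := by ext; simp [Finsupp.filter_apply]
  map_add' f g := by ext; simp [Finsupp.filter_add]

theorem coeff_part (w : N) (d : ℤ) (f : GroupAlg 𝕜 N) (m : Module.Dual ℤ N) :
    (part w d f).coeff m = if m w = d then f.coeff m else 0 := by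
  simp [part, Finsupp.filter_apply]

theorem coeff_part_of_eq {w : N} {d : ℤ} (f : GroupAlg 𝕜 N) {m : Module.Dual ℤ N} (h : m w = d) :
    (part w d f).coeff m = f.coeff m := by
  rw [coeff_part, if_pos h]

theorem isHomog_part (w : N) (d : ℤ) (f : GroupAlg 𝕜 N) : IsHomog w d (part w d f) := by
  intro m hm
  rw [Finsupp.mem_support_iff, coeff_part] at hm
  by_contra h
  exact hm (if_neg h)

theorem support_part_subset (w : N) (d : ℤ) (f : GroupAlg 𝕜 N) :
    (part w d f).coeff.support ⊆ f.coeff.support := by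
  intro m hm
  rw [Finsupp.mem_support_iff, coeff_part] at hm
  rw [Finsupp.mem_support_iff]
  intro h
  simp [h] at hm

theorem IsHomog.part_eq {w : N} {d : ℤ} {f : GroupAlg 𝕜 N} (h : IsHomog w d f) :
    part w d f = f := by
  ext m
  rw [coeff_part]
  split_ifs with hm
  · rfl
  · by_contra hne
    exact hm (h m (Finsupp.mem_support_iff.2 (Ne.symm hne)))

theorem part_eq_zero {w : N} {d : ℤ} {f : GroupAlg 𝕜 N}
    (h : ∀ m ∈ f.coeff.support, m w ≠ d) : part w d f = 0 := by
  ext m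
  rw [coeff_part]
  split_ifs with hm
  · by_contra hne
    exact h m (Finsupp.mem_support_iff.2 hne) hm
  · rfl

theorem LowerBound.zero (w : N) (c : ℤ) : LowerBound w c (0 : GroupAlg 𝕜 N) := by
  intro m hm; simp at hm

theorem LowerBound.mono {w : N} {c c' : ℤ} {f : GroupAlg 𝕜 N} (h : LowerBound w c f)
    (hc : c' ≤ c) : LowerBound w c' f := fun m hm => hc.trans (h m hm)

theorem LowerBound.add {w : N} {c : ℤ} {f g : GroupAlg 𝕜 N} (hf : LowerBound w c f)
    (hg : LowerBound w c g) : LowerBound w c (f + g) := by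
  classical
  intro m hm
  rw [AddMonoidAlgebra.coeff_add] at hm
  rcases Finset.mem_union.1 (Finsupp.support_add hm) with h | h
  exacts [hf m h, hg m h]

theorem LowerBound.neg {w : N} {c : ℤ} {f : GroupAlg 𝕜 N} (hf : LowerBound w c f) :
    LowerBound w c (-f) := by
  intro m hm
  rw [AddMonoidAlgebra.coeff_neg, Finsupp.support_neg] at hm
  exact hf m hm

theorem LowerBound.sub {w : N} {c : ℤ} {f g : GroupAlg 𝕜 N} (hf : LowerBound w c f)
    (hg : LowerBound w c g) : LowerBound w c (f - g) := by
  rw [sub_eq_add_neg]; exact hf.add hg.neg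

theorem LowerBound.mul {w : N} {c d : ℤ} {f g : GroupAlg 𝕜 N} (hf : LowerBound w c f)
    (hg : LowerBound w d g) : LowerBound w (c + d) (f * g) := by
  classical
  intro m hm
  obtain ⟨a, ha, b, hb, rfl⟩ :=
    Finset.mem_add.1 (AddMonoidAlgebra.support_coeff_mul_subset f g hm)
  exact add_le_add (hf a ha) (hg b hb)

theorem IsHomog.lowerBound {w : N} {d : ℤ} {f : GroupAlg 𝕜 N} (h : IsHomog w d f) :
    LowerBound w d f := fun m hm => (h m hm).ge

theorem IsHomog.zero (w : N) (d : ℤ) : IsHomog w d (0 : GroupAlg 𝕜 N) := by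
  intro m hm; simp at hm

theorem IsHomog.add {w : N} {d : ℤ} {f g : GroupAlg 𝕜 N} (hf : IsHomog w d f)
    (hg : IsHomog w d g) : IsHomog w d (f + g) := by
  classical
  intro m hm
  rw [AddMonoidAlgebra.coeff_add] at hm
  rcases Finset.mem_union.1 (Finsupp.support_add hm) with h | h
  exacts [hf m h, hg m h]

theorem IsHomog.sum {ι : Type*} {w : N} {d : ℤ} (s : Finset ι) {f : ι → GroupAlg 𝕜 N}
    (hf : ∀ i ∈ s, IsHomog w d (f i)) : IsHomog w d (∑ i ∈ s, f i) := by
  classical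
  induction s using Finset.induction_on with
  | empty => simpa using IsHomog.zero w d
  | insert a s ha ih =>
    rw [Finset.sum_insert ha]
    exact (hf a (by simp)).add (ih fun i hi => hf i (by simp [hi]))

theorem isHomog_single (w : N) (m : Module.Dual ℤ N) (r : 𝕜) :
    IsHomog w (m w) (AddMonoidAlgebra.single m r) := by
  intro m' hm'
  rw [AddMonoidAlgebra.coeff_single] at hm'
  rw [Finset.mem_singleton.1 (Finsupp.support_single_subset hm')]

theorem IsHomog.part_mul {w : N} {c d : ℤ} {f g : GroupAlg 𝕜 N} (hf : IsHomog w c f) :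
    part w (c + d) (f * g) = f * part w d g := by
  have h : ∀ m ∈ f.coeff.support, ∀ r : 𝕜,
      part w (c + d) (AddMonoidAlgebra.single m r * g) = .single m r * part w d g := by
    intro m hm r
    ext m'
    rw [coeff_part, AddMonoidAlgebra.coeff_single_mul_apply,
      AddMonoidAlgebra.coeff_single_mul_apply, coeff_part]
    have : (m' w = c + d) ↔ ((-m + m') w = d) := by
      rw [LinearMap.add_apply, LinearMap.neg_apply, hf m hm]
      constructor <;> intro h <;> omega
    simp only [this]
    split_ifs <;> simp
  rw [← AddMonoidAlgebra.sum_coeff_single f, Finsupp.sum, Finset.sum_mul, map_sum, Finset.sum_mul]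
  exact Finset.sum_congr rfl fun m hm => h m hm _

theorem LowerBound.sub_part {w : N} {c : ℤ} {f : GroupAlg 𝕜 N} (hf : LowerBound w c f) :
    LowerBound w (c + 1) (f - part w c f) := by
  intro m hm
  have h1 : c ≤ m w := by
    refine hf.sub ((isHomog_part w c f).lowerBound) m hm
  rcases h1.lt_or_eq with h | h
  · omega
  · exfalso
    rw [Finsupp.mem_support_iff, AddMonoidAlgebra.coeff_sub, Finsupp.sub_apply,
      coeff_part_of_eq _ h.symm, sub_self] at hm
    exact hm rfl

theorem LowerBound.part_eq_zero {w : N} {c d : ℤ} {f : GroupAlg 𝕜 N} (hf : LowerBound w c f)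
    (hd : d < c) : part w d f = 0 :=
  ToricCM.part_eq_zero fun m hm h => by have := hf m hm; omega

/-- The order along w is a valuation: lowest parts multiply, and the remainders contribute only in
higher degrees. -/
theorem LowerBound.part_mul {w : N} {c d : ℤ} {f g : GroupAlg 𝕜 N} (hf : LowerBound w c f)
    (hg : LowerBound w d g) : part w (c + d) (f * g) = part w c f * part w d g := by
  have h1 : f * g = part w c f * g + (f - part w c f) * g := by ring
  have h2 : part w (c + d) ((f - part w c f) * g) = 0 :=
    (hf.sub_part.mul hg).part_eq_zero (by omega)
  rw [h1, map_add, h2, add_zero, (isHomog_part w c f).part_mul]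

/-- Multiplication by an element of valuation zero does not raise the valuation along `w`. -/
theorem LowerBound.of_mul {w : N} {c : ℤ} {y f : GroupAlg 𝕜 N} (hy : LowerBound w 0 y)
    (hy0 : part w 0 y ≠ 0) (h : LowerBound w c (y * f)) : LowerBound w c f := by
  by_contra hlt
  simp only [LowerBound, not_forall, not_le] at hlt
  obtain ⟨m₀, hm₀, hlt⟩ := hlt
  obtain ⟨m, hm, hmin⟩ := Finset.exists_min_image f.coeff.support (fun m => m w) ⟨m₀, hm₀⟩
  have hf : LowerBound w (m w) f := fun m' hm' => hmin m' hm'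
  have h0 := hy.part_mul hf
  rw [zero_add, h.part_eq_zero ((hmin m₀ hm₀).trans_lt hlt)] at h0
  have h1 : part w (m w) f ≠ 0 := by
    intro h2
    have h3 := coeff_part_of_eq (d := m w) (w := w) f rfl
    rw [h2] at h3
    exact (Finsupp.mem_support_iff.1 hm) h3.symm
  exact mul_ne_zero hy0 h1 h0.symm

theorem lowerBound_chi (w : N) (m : Module.Dual ℤ N) {c : ℤ} (h : c ≤ m w) :
    LowerBound w c (chi 𝕜 m) :=
  (isHomog_single w m 1).lowerBound.mono h

theorem lowerBound_chi_mul {w : N} (m : Module.Dual ℤ N) {c : ℤ} {f : GroupAlg 𝕜 N} :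
    LowerBound w (c + m w) (chi 𝕜 m * f) ↔ LowerBound w c f := by
  constructor
  · intro h
    have := (lowerBound_chi (𝕜 := 𝕜) w (-m) le_rfl).mul h
    rw [← mul_assoc, chi_mul_chi, neg_add_cancel, chi_zero, one_mul] at this
    exact this.mono (by simp)
  · intro h
    have := (lowerBound_chi (𝕜 := 𝕜) w m le_rfl).mul h
    exact this.mono (by omega)

theorem mem_toricSubmodule_iff {ι : Type*} {n : ι → N} {b : ι → ℤ} {f : GroupAlg 𝕜 N} :
    f ∈ toricSubmodule 𝕜 n b ↔ ∀ i, LowerBound (n i) (-b i) f :=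
  ⟨fun h i m hm => h m hm i, fun h m hm i => h i m hm⟩

theorem mem_toricSubalgebra_iff {ι : Type*} {n : ι → N} {f : GroupAlg 𝕜 N} :
    f ∈ toricSubalgebra 𝕜 n ↔ ∀ i, LowerBound (n i) 0 f :=
  ⟨fun h i m hm => h m hm i, fun h m hm i => h i m hm⟩

theorem single_mem_toricSubalgebra {ι : Type*} {n : ι → N} {m : Module.Dual ℤ N}
    (hm : m ∈ dualMonoid n) (r : 𝕜) : AddMonoidAlgebra.single m r ∈ toricSubalgebra 𝕜 n :=
  mem_toricSubalgebra_iff.2 fun i => (isHomog_single _ _ _).lowerBound.mono (hm i)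

theorem single_mem_toricSubmodule {ι : Type*} {n : ι → N} {b : ι → ℤ} {m : Module.Dual ℤ N}
    (hm : m ∈ weightSet n b) (r : 𝕜) : AddMonoidAlgebra.single m r ∈ toricSubmodule 𝕜 n b :=
  mem_toricSubmodule_iff.2 fun i => (isHomog_single _ _ _).lowerBound.mono (hm i)

theorem toric_smul_def {ι : Type*} {n : ι → N} (r : toricSubalgebra 𝕜 n) (f : GroupAlg 𝕜 N) :
    r • f = (r : GroupAlg 𝕜 N) * f := rfl

end GroupAlgebra

/-! ### Finiteness -/

section Finiteness

variable {𝕜 : Type*} [Field 𝕜] {N : Type*} [AddCommGroup N] {ι : Type*}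

/-- Dickson's lemma: the shifted values at the n_i map S to ℕ^ι so that comparable images give a
difference in the dual monoid, and the minimal images form an antichain, hence a finite set. -/
theorem exists_finite_dominating [Finite ι] (n : ι → N) (b : ι → ℤ) (S : Set (Module.Dual ℤ N))
    (hS : S ⊆ weightSet n b) :
    ∃ T : Set (Module.Dual ℤ N), T.Finite ∧ T ⊆ S ∧ ∀ m ∈ S, ∃ t ∈ T, m - t ∈ dualMonoid n := by
  let φ : Module.Dual ℤ N → ι → ℕ := fun m i => (m (n i) + b i).toNat
  have hφ : ∀ m ∈ S, ∀ m' ∈ S, φ m' ≤ φ m → m - m' ∈ dualMonoid n := by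
    intro m hm m' hm' h i
    have h1 := hS hm i
    have h2 := hS hm' i
    have h3 : (m' (n i) + b i).toNat ≤ (m (n i) + b i).toNat := h i
    rw [LinearMap.sub_apply]
    omega
  let A : Set (ι → ℕ) := {a | Minimal (· ∈ φ '' S) a}
  have hA : A.Finite := WellQuasiOrderedLE.finite_of_isAntichain (setOfPred_minimal_antichain _)
  have hchoose : ∀ a ∈ A, ∃ m ∈ S, φ m = a := fun a ha => ha.1
  choose! ψ hψS hψ using hchoose
  refine ⟨ψ '' A, hA.image ψ, ?_, fun m hm => ?_⟩
  · rintro _ ⟨a, ha, rfl⟩; exact hψS a ha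
  · obtain ⟨a, hle, ha⟩ := exists_minimal_le_of_wellFoundedLT (· ∈ φ '' S) (φ m) ⟨m, hm, rfl⟩
    exact ⟨ψ a, ⟨a, ha, rfl⟩, hφ m hm _ (hψS a ha) (by rw [hψ a ha]; exact hle)⟩

theorem toricSubmodule_finite [Finite ι] (n : ι → N) (b : ι → ℤ) :
    Module.Finite (toricSubalgebra 𝕜 n) (toricSubmodule 𝕜 n b) := by
  obtain ⟨T, hT, hTS, hdom⟩ := exists_finite_dominating n b _ le_rfl
  rw [Module.Finite.iff_fg]
  have : toricSubmodule 𝕜 n b = Submodule.span (toricSubalgebra 𝕜 n) (chi 𝕜 '' T) := by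
    apply le_antisymm
    · intro f hf
      rw [← AddMonoidAlgebra.sum_coeff_single f]
      refine Submodule.sum_mem _ fun m hm => ?_
      obtain ⟨t, ht, hmt⟩ := hdom m (hf m hm)
      have : AddMonoidAlgebra.single m (f.coeff m) =
          (⟨_, single_mem_toricSubalgebra hmt (f.coeff m)⟩ : toricSubalgebra 𝕜 n) • chi 𝕜 t := by
        rw [toric_smul_def, chi, AddMonoidAlgebra.single_mul_single]
        simp
      rw [this]
      exact Submodule.smul_mem _ _ (Submodule.subset_span ⟨t, ht, rfl⟩)
    · rw [Submodule.span_le]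
      rintro _ ⟨t, ht, rfl⟩
      exact single_mem_toricSubmodule (hTS ht) 1
  rw [this]
  exact Submodule.fg_span (hT.image _)

/-- Gordan's lemma. The sum of the values at the n_i is positive on nonzero members of the dual
monoid, so it decreases whenever a dominated generator is split off. -/
theorem toricSubalgebra_finiteType [Finite ι] (n : ι → N)
    (hn : ∀ m : Module.Dual ℤ N, (∀ i, m (n i) = 0) → m = 0) :
    Algebra.FiniteType 𝕜 (toricSubalgebra 𝕜 n) := by
  classical
  have := Fintype.ofFinite ι
  obtain ⟨T, hT, hTS, hdom⟩ := exists_finite_dominating n 0 {m | m ∈ dualMonoid n ∧ m ≠ 0}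
    (fun m hm i => by simpa using hm.1 i)
  have hgen : ∀ (d : ℕ) (m : Module.Dual ℤ N), m ∈ dualMonoid n → (∑ i, m (n i)).toNat = d →
      chi 𝕜 m ∈ Algebra.adjoin 𝕜 (chi 𝕜 '' T) := by
    intro d
    induction d using Nat.strong_induction_on with
    | _ d ih =>
      intro m hm hd
      by_cases h0 : m = 0
      · rw [h0, chi_zero]; exact one_mem _
      · obtain ⟨t, ht, hmt⟩ := hdom m ⟨hm, h0⟩
        have ht' := hTS ht
        have hpos : 0 < ∑ i, t (n i) := by
          refine lt_of_le_of_ne (Finset.sum_nonneg fun i _ => ht'.1 i) fun h => ht'.2 ?_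
          have := (Finset.sum_eq_zero_iff_of_nonneg fun i _ => ht'.1 i).1 h.symm
          exact hn t fun i => this i (Finset.mem_univ i)
        have hsum : ∑ i, m (n i) = ∑ i, t (n i) + ∑ i, (m - t) (n i) := by
          rw [← Finset.sum_add_distrib]; simp
        have hnn : 0 ≤ ∑ i, (m - t) (n i) := Finset.sum_nonneg fun i _ => hmt i
        have h1 := ih (∑ i, (m - t) (n i)).toNat (by omega) (m - t) hmt rfl
        have h2 : chi 𝕜 m = chi 𝕜 t * chi 𝕜 (m - t) := by rw [chi_mul_chi]; simp
        rw [h2]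
        exact mul_mem (Algebra.subset_adjoin ⟨t, ht, rfl⟩) h1
  have : toricSubalgebra 𝕜 n = Algebra.adjoin 𝕜 (chi 𝕜 '' T) := by
    apply le_antisymm
    · intro f hf
      rw [← AddMonoidAlgebra.sum_coeff_single f]
      refine Subalgebra.sum_mem _ fun m hm => ?_
      have h := Subalgebra.smul_mem _ (hgen _ m (hf m hm) rfl) (f.coeff m)
      simpa [chi] using h
    · rw [Algebra.adjoin_le_iff]
      rintro _ ⟨t, ht, rfl⟩
      exact single_mem_toricSubalgebra (hTS ht).1 1
  rw [← Subalgebra.fg_iff_finiteType, this, Subalgebra.fg_def]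
  exact ⟨_, hT.image _, rfl⟩

theorem toricSubalgebra_isNoetherianRing [Finite ι] (n : ι → N)
    (hn : ∀ m : Module.Dual ℤ N, (∀ i, m (n i) = 0) → m = 0) :
    IsNoetherianRing (toricSubalgebra 𝕜 n) :=
  have := toricSubalgebra_finiteType (𝕜 := 𝕜) n hn
  Algebra.FiniteType.isNoetherianRing 𝕜 _

/-- Hilbert's Nullstellensatz: modulo a maximal ideal every element is a scalar. -/
theorem exists_sub_algebraMap_mem {R : Type*} [CommRing R] [Algebra 𝕜 R] [IsAlgClosed 𝕜]
    [Algebra.FiniteType 𝕜 R] (p : Ideal R) [p.IsMaximal] (x : R) :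
    ∃ c : 𝕜, x - algebraMap 𝕜 R c ∈ p := by
  let := Ideal.Quotient.field p
  have : Module.Finite 𝕜 (R ⧸ p) := finite_of_finite_type_of_isJacobsonRing 𝕜 (R ⧸ p)
  obtain ⟨c, hc⟩ := (IsAlgClosed.algebraMap_bijective_of_isIntegral (k := 𝕜) (K := R ⧸ p)).2
    (Ideal.Quotient.mk p x)
  refine ⟨c, ?_⟩
  rw [← Ideal.Quotient.mk_eq_mk_iff_sub_mem, ← hc]
  rfl

/-- By incomparability, a strict inclusion of primes stays strict after contraction. -/
theorem ringKrullDim_le_of_isIntegral (A B : Type*) [CommRing A] [CommRing B] [Algebra A B]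
    [Algebra.IsIntegral A B] : ringKrullDim B ≤ ringKrullDim A := by
  refine Order.krullDim_le_of_strictMono
    (fun q : PrimeSpectrum B => PrimeSpectrum.comap (algebraMap A B) q) fun q r hqr => ?_
  obtain ⟨x, hxr, hxq⟩ := SetLike.exists_of_lt (show q.asIdeal < r.asIdeal from hqr)
  exact Ideal.comap_lt_comap_of_integral_mem_sdiff (le_of_lt hqr) ⟨hxr, hxq⟩
    (Algebra.IsIntegral.isIntegral x)

/-- The three coordinate characters suffice: their inverses, and hence all characters, are algebraic
over the algebra they generate. -/
theorem trdeg_groupAlg_le : Algebra.trdeg 𝕜 (GroupAlg 𝕜 (Fin 3 → ℤ)) ≤ 3 := by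
  classical
  let e : Fin 3 → Module.Dual ℤ (Fin 3 → ℤ) := fun i => LinearMap.proj i
  let s : Set (GroupAlg 𝕜 (Fin 3 → ℤ)) := Set.range fun i => chi 𝕜 (e i)
  have hs : Cardinal.mk s ≤ 3 := by
    have h := Cardinal.mk_range_le_lift (f := fun i => chi 𝕜 (e i))
    simpa [s] using h
  let K := Subalgebra.algebraicClosure (Algebra.adjoin 𝕜 s) (GroupAlg 𝕜 (Fin 3 → ℤ))
  have hpos : ∀ i, chi 𝕜 (e i) ∈ K := fun i =>
    isAlgebraic_algebraMap (⟨_, Algebra.subset_adjoin ⟨i, rfl⟩⟩ : Algebra.adjoin 𝕜 s)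
  have hneg : ∀ i, chi 𝕜 (-e i) ∈ K := by
    intro i
    refine ⟨Polynomial.C ⟨_, Algebra.subset_adjoin ⟨i, rfl⟩⟩ * Polynomial.X - 1, ?_, ?_⟩
    · intro h
      have := congrArg (Polynomial.coeff · 0) h
      simp at this
    · simp only [map_sub, map_mul, Polynomial.aeval_C, Polynomial.aeval_X, map_one]
      rw [sub_eq_zero]
      change chi 𝕜 (e i) * chi 𝕜 (-e i) = 1
      rw [chi_mul_chi, add_neg_cancel, chi_zero]
  have hz : ∀ (i : Fin 3) (c : ℤ), chi 𝕜 (c • e i) ∈ K := by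
    intro i c
    obtain ⟨r, rfl | rfl⟩ := c.eq_nat_or_neg
    · rw [natCast_zsmul, ← chi_pow]; exact pow_mem (hpos i) r
    · rw [neg_smul, ← smul_neg, natCast_zsmul, ← chi_pow]; exact pow_mem (hneg i) r
  have hchi : ∀ m, chi 𝕜 m ∈ K := by
    intro m
    have hm : m = m (Pi.single 0 1) • e 0 + m (Pi.single 1 1) • e 1 + m (Pi.single 2 1) • e 2 := by
      ext i
      fin_cases i <;> simp [e]
    rw [hm, ← chi_mul_chi, ← chi_mul_chi]
    exact mul_mem (mul_mem (hz _ _) (hz _ _)) (hz _ _)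
  have halg : Algebra.IsAlgebraic (Algebra.adjoin 𝕜 s) (GroupAlg 𝕜 (Fin 3 → ℤ)) := by
    refine ⟨fun f => ?_⟩
    change f ∈ K
    rw [← AddMonoidAlgebra.sum_coeff_single f]
    refine Subalgebra.sum_mem _ fun m _ => ?_
    have h : AddMonoidAlgebra.single m (f.coeff m) =
        (algebraMap 𝕜 (GroupAlg 𝕜 (Fin 3 → ℤ)) (f.coeff m)) * chi 𝕜 m := by
      simp [chi, AddMonoidAlgebra.coe_algebraMap, AddMonoidAlgebra.single_mul_single]
    rw [h]
    exact mul_mem (isAlgebraic_algebraMap (algebraMap 𝕜 (Algebra.adjoin 𝕜 s) (f.coeff m))) (hchi m)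
  exact (Algebra.IsAlgebraic.trdeg_le_cardinalMk 𝕜 s).trans hs

/-- Noether normalization makes the ring integral over a polynomial ring, whose number of variables
is at most the transcendence degree of the ambient group algebra. -/
theorem ringKrullDim_toricSubalgebra_le [Finite ι] (n : ι → Fin 3 → ℤ)
    (hn : ∀ m : Module.Dual ℤ (Fin 3 → ℤ), (∀ i, m (n i) = 0) → m = 0) :
    ringKrullDim (toricSubalgebra 𝕜 n) ≤ 3 := by
  have := toricSubalgebra_finiteType (𝕜 := 𝕜) n hn
  obtain ⟨s, g, hg, hfin⟩ := exists_finite_inj_algHom_of_fg 𝕜 (toricSubalgebra 𝕜 n)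
  have hs : s ≤ 3 := by
    have h1 := lift_trdeg_le_of_injective
      ((toricSubalgebra 𝕜 n).val.comp g) (Subtype.val_injective.comp hg)
    rw [MvPolynomial.trdeg_of_isDomain] at h1
    have h2 := h1.trans (Cardinal.lift_le.2 (trdeg_groupAlg_le (𝕜 := 𝕜)))
    simpa using h2
  let := g.toRingHom.toAlgebra
  have : Algebra.IsIntegral (MvPolynomial (Fin s) 𝕜) (toricSubalgebra 𝕜 n) :=
    ⟨hfin.to_isIntegral⟩
  refine (ringKrullDim_le_of_isIntegral (MvPolynomial (Fin s) 𝕜) _).trans ?_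
  rw [MvPolynomial.ringKrullDim_of_isNoetherianRing, ringKrullDim_eq_zero_of_field]
  simp
  exact_mod_cast hs

theorem ringKrullDim_localization_toric_le [Finite ι] (n : ι → Fin 3 → ℤ)
    (hn : ∀ m : Module.Dual ℤ (Fin 3 → ℤ), (∀ i, m (n i) = 0) → m = 0)
    (p : Ideal (toricSubalgebra 𝕜 n)) [p.IsMaximal] :
    ringKrullDim (Localization.AtPrime p) ≤ 3 := by
  rw [IsLocalization.AtPrime.ringKrullDim_eq_height p (Localization.AtPrime p)]
  exact (Ideal.height_le_ringKrullDim_of_ne_top (Ideal.IsPrime.ne_top')).trans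
    (ringKrullDim_toricSubalgebra_le n hn)

end Finiteness

/-! ### Cyclic sign sequences -/

section Cyclic

variable {K : ℕ}

/-- The cyclically next index. -/
def nxt (i : Fin K) : Fin K :=
  if h : (i : ℕ) + 1 < K then ⟨i + 1, h⟩ else ⟨0, by have := i.2; omega⟩

theorem nxt_val_of_lt {i : Fin K} (h : (i : ℕ) + 1 < K) : (nxt i : ℕ) = i + 1 := by
  simp [nxt, h]

theorem nxt_val_of_not_lt {i : Fin K} (h : ¬ (i : ℕ) + 1 < K) : (nxt i : ℕ) = 0 := by
  simp [nxt, h]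

theorem exists_nxt_eq (i : Fin K) : ∃ j, nxt j = i := by
  have := i.2
  by_cases h : (i : ℕ) = 0
  · refine ⟨⟨K - 1, by omega⟩, Fin.ext ?_⟩
    rw [nxt_val_of_not_lt (by simp; omega), h]
  · refine ⟨⟨i - 1, by omega⟩, Fin.ext ?_⟩
    rw [nxt_val_of_lt (by simp; omega)]
    simp; omega

/-- There are no four cyclically ordered indices at which `P` alternates. -/
def NoAlternation (P : Fin K → Prop) : Prop :=
  ∀ a b c d : Fin K, a < b → b < c → c < d →
    ¬ (P a ∧ ¬ P b ∧ P c ∧ ¬ P d) ∧ ¬ (¬ P a ∧ P b ∧ ¬ P c ∧ P d)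

theorem eq_of_forall_between {α : Type*} {P : Fin K → Prop} {lam : Fin K → α}
    (hlam : ∀ i, P (nxt i) → lam i = lam (nxt i)) (r : ℕ) (p q : Fin K) (hpq : (p : ℕ) + r = q)
    (h : ∀ j, p < j → j ≤ q → P j) : lam p = lam q := by
  induction r generalizing q with
  | zero => rw [Fin.ext (a := p) (b := q) (by simpa using hpq)]
  | succ r ih =>
    have := q.2
    have hq' : (p : ℕ) + r < K := by omega
    have h1 := ih ⟨p + r, hq'⟩ rfl fun j hj hj' => h j hj (hj'.trans (by
      rw [Fin.le_def]; simp; omega))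
    have h2 : nxt ⟨p + r, hq'⟩ = q := by
      refine Fin.ext ?_
      rw [nxt_val_of_lt (by simp; omega)]
      simp; omega
    rw [h1, hlam _ (by rw [h2]; exact h q (by rw [Fin.lt_def]; omega) le_rfl), h2]

/-- If the indices with `P` form a cyclic interval, then a function on the edges that is constant
across each of them takes one value near all of them. -/
theorem NoAlternation.eq_of_mem {α : Type*} {P : Fin K → Prop} (hP : NoAlternation P)
    {lam : Fin K → α} (hlam : ∀ i, P (nxt i) → lam i = lam (nxt i)) {p q : Fin K}
    (hp : P p) (hq : P q) : lam p = lam q := by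
  wlog hpq : p < q generalizing p q
  · rcases lt_or_eq_of_le (not_lt.1 hpq) with h | h
    · exact (this hq hp h).symm
    · rw [h]
  by_cases hin : ∀ j, p < j → j < q → P j
  · refine eq_of_forall_between hlam (q - p) p q (by have := Fin.lt_def.1 hpq; omega) ?_
    intro j hj hj'
    rcases lt_or_eq_of_le hj' with h | h
    · exact hin j hj h
    · rwa [h]
  -- An index without `P` strictly between p and q forces `P` everywhere up to p and from q on, so
  -- the two are joined the other way around, across the index 0.
  · push Not at hin
    obtain ⟨r, hpr, hrq, hr⟩ := hin
    have hlow : ∀ j, j ≤ p → P j := by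
      intro j hj
      rcases lt_or_eq_of_le hj with h | h
      · by_contra hj'
        exact (hP j p r q h hpr hrq).2 ⟨hj', hp, hr, hq⟩
      · rwa [h]
    have hhigh : ∀ j, q ≤ j → P j := by
      intro j hj
      rcases lt_or_eq_of_le hj with h | h
      · by_contra hj'
        exact (hP p r q j hpr hrq h).1 ⟨hp, hr, hq, hj'⟩
      · rwa [← h]
    have hK := p.2
    let z : Fin K := ⟨0, by omega⟩
    let l : Fin K := ⟨K - 1, by omega⟩
    have h1 : lam z = lam p := eq_of_forall_between hlam p z p (by simp [z]) fun j _ hj => hlow j hj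
    have h2 : lam q = lam l :=
      eq_of_forall_between hlam (K - 1 - q) q l (by have := q.2; simp only [l]; omega)
        fun j hj _ => hhigh j hj.le
    have h3 : nxt l = z := Fin.ext (nxt_val_of_not_lt (by simp only [l]; omega))
    rw [← h1, h2, hlam l (by rw [h3]; exact hlow z (by rw [Fin.le_def]; simp [z])), h3]

end Cyclic

/-! ### Cones over convex polygons -/

section Cone

/-- The determinant of three vectors. -/
abbrev det3 (u v w : Fin 3 → ℤ) : ℤ := (Matrix.of ![u, v, w]).det

theorem det3_eq (u v w : Fin 3 → ℤ) : det3 u v w =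
    u 0 * v 1 * w 2 - u 0 * v 2 * w 1 - u 1 * v 0 * w 2 + u 1 * v 2 * w 0 + u 2 * v 0 * w 1
      - u 2 * v 1 * w 0 := by
  simp [det3, Matrix.det_fin_three]

theorem det3_rotate (u v w : Fin 3 → ℤ) : det3 v w u = det3 u v w := by
  simp only [det3_eq]; ring

theorem det3_self_right (u v : Fin 3 → ℤ) : det3 u v v = 0 := by
  simp only [det3_eq]; ring

theorem det3_self_outer (u v : Fin 3 → ℤ) : det3 u v u = 0 := by
  simp only [det3_eq]; ring

/-- The functional `det(u, v, ·)`. -/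
def detDual (u v : Fin 3 → ℤ) : Module.Dual ℤ (Fin 3 → ℤ) where
  toFun w := det3 u v w
  map_add' w w' := by simp only [det3_eq, Pi.add_apply]; ring
  map_smul' c w := by simp only [det3_eq, Pi.smul_apply, smul_eq_mul, RingHom.id_apply]; ring

theorem detDual_apply (u v w : Fin 3 → ℤ) : detDual u v w = det3 u v w := rfl

theorem dual_apply_eq (m : Module.Dual ℤ (Fin 3 → ℤ)) (w : Fin 3 → ℤ) :
    m w = w 0 * m (Pi.single 0 1) + w 1 * m (Pi.single 1 1) + w 2 * m (Pi.single 2 1) := by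
  have h : w = w 0 • Pi.single 0 1 + w 1 • Pi.single 1 1 + w 2 • Pi.single 2 1 := by
    ext i; fin_cases i <;> simp
  conv_lhs => rw [h]
  simp only [map_add, map_smul, smul_eq_mul]

/-- The linear relation between four vectors of a three-dimensional space. -/
theorem det3_relation (m : Module.Dual ℤ (Fin 3 → ℤ)) (a b c d : Fin 3 → ℤ) :
    det3 b c d * m a + det3 a b d * m c = det3 a c d * m b + det3 a b c * m d := by
  rw [dual_apply_eq m a, dual_apply_eq m b, dual_apply_eq m c, dual_apply_eq m d]
  simp only [det3_eq]; ring

theorem eq_zero_of_det3_ne_zero {m : Module.Dual ℤ (Fin 3 → ℤ)} {a b c : Fin 3 → ℤ}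
    (h : det3 a b c ≠ 0) (ha : m a = 0) (hb : m b = 0) (hc : m c = 0) : m = 0 := by
  refine LinearMap.ext fun d => ?_
  have := det3_relation m a b c d
  rw [ha, hb, hc] at this
  simp only [mul_zero, zero_add, add_zero] at this
  rcases mul_eq_zero.1 this.symm with h' | h'
  · exact absurd h' h
  · exact h'

/-- The vectors `v_1, …, v_K` span the successive rays of a pointed full-dimensional cone. -/
structure IsConvexList {K : ℕ} (v : Fin K → Fin 3 → ℤ) : Prop where
  three_le : 3 ≤ K
  pos : ∀ a b c, a < b → b < c → 0 < det3 (v a) (v b) (v c)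

variable {K : ℕ} {v : Fin K → Fin 3 → ℤ}

/-- The primitive-up-to-scaling equation of the facet spanned by `v_i` and the next vector. -/
def edge (v : Fin K → Fin 3 → ℤ) (i : Fin K) : Module.Dual ℤ (Fin 3 → ℤ) :=
  detDual (v i) (v (nxt i))

theorem edge_self (v : Fin K → Fin 3 → ℤ) (i : Fin K) : edge v i (v i) = 0 :=
  det3_self_outer _ _

theorem edge_nxt (v : Fin K → Fin 3 → ℤ) (i : Fin K) : edge v i (v (nxt i)) = 0 :=
  det3_self_right _ _

theorem IsConvexList.edge_pos (hv : IsConvexList v) {i j : Fin K} (hji : j ≠ i)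
    (hjn : j ≠ nxt i) : 0 < edge v i (v j) := by
  rw [edge, detDual_apply]
  have h1 : (j : ℕ) ≠ i := fun h => hji (Fin.ext h)
  have h2 : (j : ℕ) ≠ nxt i := fun h => hjn (Fin.ext h)
  have hj := j.2
  by_cases h : (i : ℕ) + 1 < K
  · rw [nxt_val_of_lt h] at h2
    have h3 : i < nxt i := by rw [Fin.lt_def, nxt_val_of_lt h]; omega
    rcases lt_or_gt_of_ne h1 with h4 | h4
    · rw [det3_rotate]
      exact hv.pos j i (nxt i) h4 h3
    · exact hv.pos i (nxt i) j h3 (by rw [Fin.lt_def, nxt_val_of_lt h]; omega)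
  · have hn := nxt_val_of_not_lt h
    rw [← det3_rotate]
    exact hv.pos (nxt i) j i (by rw [Fin.lt_def]; omega) (by rw [Fin.lt_def]; omega)

theorem IsConvexList.edge_nonneg (hv : IsConvexList v) (i j : Fin K) : 0 ≤ edge v i (v j) := by
  by_cases h1 : j = i
  · rw [h1, edge_self]
  by_cases h2 : j = nxt i
  · rw [h2, edge_nxt]
  exact (hv.edge_pos h1 h2).le

theorem IsConvexList.nxt_ne (hv : IsConvexList v) (i : Fin K) : nxt i ≠ i := by
  have := hv.three_le
  intro h
  have h' := congrArg Fin.val h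
  by_cases hi : (i : ℕ) + 1 < K
  · rw [nxt_val_of_lt hi] at h'; omega
  · rw [nxt_val_of_not_lt hi] at h'; omega

theorem IsConvexList.nxt_nxt_ne (hv : IsConvexList v) (i : Fin K) : nxt (nxt i) ≠ i := by
  have := hv.three_le
  have hi2 := i.2
  intro h
  have h' := congrArg Fin.val h
  by_cases hi : (i : ℕ) + 1 < K
  · have h1 := nxt_val_of_lt hi
    by_cases hn : (nxt i : ℕ) + 1 < K
    · rw [nxt_val_of_lt hn] at h'; omega
    · rw [nxt_val_of_not_lt hn] at h'; omega
  · have h1 := nxt_val_of_not_lt hi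
    rw [nxt_val_of_lt (by omega)] at h'; omega

theorem nxt_injective : Function.Injective (nxt : Fin K → Fin K) :=
  Finite.injective_iff_surjective.2 exists_nxt_eq

theorem IsConvexList.exists_edge_pos (hv : IsConvexList v) (i : Fin K) :
    0 < edge v i (v (nxt (nxt i))) :=
  hv.edge_pos (hv.nxt_nxt_ne i) (hv.nxt_ne _)

/-- A weight in the interior of the cone. -/
def totalWeight (v : Fin K → Fin 3 → ℤ) : Fin 3 → ℤ := ∑ j, v j

theorem IsConvexList.edge_totalWeight_pos (hv : IsConvexList v) (i : Fin K) :
    0 < edge v i (totalWeight v) := by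
  rw [totalWeight, map_sum]
  exact Finset.sum_pos' (fun j _ => hv.edge_nonneg i j) ⟨_, Finset.mem_univ _, hv.exists_edge_pos i⟩

/-- The facet equations, scaled to the same degree with respect to the total weight. -/
def scaledEdge (v : Fin K → Fin 3 → ℤ) (i : Fin K) : Module.Dual ℤ (Fin 3 → ℤ) :=
  (∏ j ∈ Finset.univ.erase i, edge v j (totalWeight v)) • edge v i

/-- The common degree of the scaled facet equations. -/
def edgeDegree (v : Fin K → Fin 3 → ℤ) : ℤ := ∏ j, edge v j (totalWeight v)

theorem scaledEdge_totalWeight (v : Fin K → Fin 3 → ℤ) (i : Fin K) :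
    scaledEdge v i (totalWeight v) = edgeDegree v := by
  rw [scaledEdge, LinearMap.smul_apply, smul_eq_mul, edgeDegree]
  exact Finset.prod_erase_mul _ _ (Finset.mem_univ i)

theorem IsConvexList.edgeDegree_pos (hv : IsConvexList v) : 0 < edgeDegree v :=
  Finset.prod_pos fun i _ => hv.edge_totalWeight_pos i

theorem IsConvexList.scaledEdge_pos (hv : IsConvexList v) {i j : Fin K} (hji : j ≠ i)
    (hjn : j ≠ nxt i) : 0 < scaledEdge v i (v j) := by
  rw [scaledEdge, LinearMap.smul_apply, smul_eq_mul]
  exact mul_pos (Finset.prod_pos fun i _ => hv.edge_totalWeight_pos i) (hv.edge_pos hji hjn)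

theorem scaledEdge_self (v : Fin K → Fin 3 → ℤ) (i : Fin K) : scaledEdge v i (v i) = 0 := by
  rw [scaledEdge, LinearMap.smul_apply, edge_self, smul_zero]

theorem scaledEdge_nxt (v : Fin K → Fin 3 → ℤ) (i : Fin K) : scaledEdge v i (v (nxt i)) = 0 := by
  rw [scaledEdge, LinearMap.smul_apply, edge_nxt, smul_zero]

theorem IsConvexList.scaledEdge_nonneg (hv : IsConvexList v) (i j : Fin K) :
    0 ≤ scaledEdge v i (v j) := by
  rw [scaledEdge, LinearMap.smul_apply, smul_eq_mul]
  exact mul_nonneg (Finset.prod_nonneg fun i _ => (hv.edge_totalWeight_pos i).le)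
    (hv.edge_nonneg i j)

theorem IsConvexList.eq_zero (hv : IsConvexList v) {m : Module.Dual ℤ (Fin 3 → ℤ)}
    (hm : ∀ j, m (v j) = 0) : m = 0 := by
  have h := hv.three_le
  exact eq_zero_of_det3_ne_zero
    (hv.pos ⟨0, by omega⟩ ⟨1, by omega⟩ ⟨2, by omega⟩ (by simp) (by simp)).ne'
    (hm _) (hm _) (hm _)

theorem IsConvexList.totalWeight_pos (hv : IsConvexList v) {m : Module.Dual ℤ (Fin 3 → ℤ)}
    (hm : ∀ j, 0 ≤ m (v j)) (hm0 : m ≠ 0) : 0 < m (totalWeight v) := by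
  rw [totalWeight, map_sum]
  refine lt_of_le_of_ne (Finset.sum_nonneg fun j _ => hm j) fun h => hm0 ?_
  have := (Finset.sum_eq_zero_iff_of_nonneg fun j _ => hm j).1 h.symm
  exact hv.eq_zero fun j => this j (Finset.mem_univ j)

/-- A nonzero element of the dual cone vanishes at most at two adjacent vectors. -/
theorem IsConvexList.exists_edge_of_ne_zero (hv : IsConvexList v)
    {m : Module.Dual ℤ (Fin 3 → ℤ)} (hm : ∀ j, 0 ≤ m (v j)) (hm0 : m ≠ 0) :
    ∃ i, ∀ l, m (v l) = 0 → l = i ∨ l = nxt i := by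
  have hK := hv.three_le
  have hthree : ∀ a b c, a < b → b < c → m (v a) = 0 → m (v b) = 0 → m (v c) ≠ 0 :=
    fun a b c hab hbc ha hb hc => hm0 (eq_zero_of_det3_ne_zero (hv.pos a b c hab hbc).ne' ha hb hc)
  by_cases h0 : ∃ a, m (v a) = 0
  swap
  · push Not at h0
    exact ⟨⟨0, by omega⟩, fun l hl => absurd hl (h0 l)⟩
  obtain ⟨a₀, ha₀⟩ := h0
  by_cases h1 : ∃ a b, a < b ∧ m (v a) = 0 ∧ m (v b) = 0
  swap
  · push Not at h1
    refine ⟨a₀, fun l hl => Or.inl ?_⟩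
    rcases lt_trichotomy l a₀ with h | h | h
    · exact absurd ha₀ (h1 l a₀ h hl)
    · exact h
    · exact absurd hl (h1 a₀ l h ha₀)
  obtain ⟨a, b, hab, ha, hb⟩ := h1
  have hl : ∀ l, m (v l) = 0 → l = a ∨ l = b := by
    intro l hl
    rcases lt_trichotomy l a with h | h | h
    · exact absurd hb (hthree l a b h hab hl ha)
    · exact Or.inl h
    · rcases lt_trichotomy l b with h' | h' | h'
      · exact absurd hb (hthree a l b h h' ha hl)
      · exact Or.inr h'
      · exact absurd hl (hthree a b l hab h' ha hb)
  have hab' := Fin.lt_def.1 hab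
  have hb2 := b.2
  by_cases hadj : (a : ℕ) + 1 = b
  · refine ⟨a, fun l h => (hl l h).imp_right fun h => h.trans (Fin.ext ?_)⟩
    rw [nxt_val_of_lt (by omega), hadj]
  by_cases hwrap : (a : ℕ) = 0 ∧ (b : ℕ) + 1 = K
  · refine ⟨b, fun l h => (hl l h).symm.imp_right fun h => h.trans (Fin.ext ?_)⟩
    rw [nxt_val_of_not_lt (by omega), hwrap.1]
  exfalso
  -- Two nonadjacent zeros a, b: the diagonal joining them crosses the one from c to a vertex d on
  -- the other side. The linear relation of the four vectors then forces a zero at c, which makes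
  -- three.
  let c : Fin K := ⟨a + 1, by omega⟩
  have hac : a < c := by rw [Fin.lt_def]; simp [c]
  have hcb : c < b := by rw [Fin.lt_def]; simp only [c]; omega
  have hc0 : m (v c) = 0 := by
    by_cases hd : (b : ℕ) + 1 < K
    · let d : Fin K := ⟨b + 1, hd⟩
      have hbd : b < d := by rw [Fin.lt_def]; simp [d]
      have := det3_relation m (v a) (v c) (v b) (v d)
      rw [ha, hb, mul_zero, mul_zero, add_zero] at this
      have h1 := mul_nonneg (hv.pos a b d hab hbd).le (hm c)
      have h2 := mul_nonneg (hv.pos a c b hac hcb).le (hm d)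
      have h3 : det3 (v a) (v b) (v d) * m (v c) = 0 := by linarith
      exact (mul_eq_zero.1 h3).resolve_left (hv.pos a b d hab hbd).ne'
    · let d : Fin K := ⟨0, by omega⟩
      have hda : d < a := by rw [Fin.lt_def]; simp only [d]; omega
      have := det3_relation m (v d) (v a) (v c) (v b)
      rw [ha, hb, mul_zero, mul_zero, add_zero] at this
      have h1 := mul_nonneg (hv.pos a c b hac hcb).le (hm d)
      have h2 := mul_nonneg (hv.pos d a b hda hab).le (hm c)
      have h3 : det3 (v d) (v a) (v b) * m (v c) = 0 := by linarith
      exact (mul_eq_zero.1 h3).resolve_left (hv.pos d a b hda hab).ne'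
  exact hthree a c b hac hcb ha hc0 hb

/-- Where a vanishes, m does no harm; elsewhere a is at least 1, so the sum of all |m(v_j)| is a
large enough factor. -/
theorem exists_nsmul_sub_nonneg (v : Fin K → Fin 3 → ℤ) {a m : Module.Dual ℤ (Fin 3 → ℤ)}
    (h : ∀ j, 0 ≤ a (v j)) (h0 : ∀ j, a (v j) = 0 → m (v j) ≤ 0) :
    ∃ r : ℕ, ∀ j, 0 ≤ (r • a - m) (v j) := by
  refine ⟨∑ j, (m (v j)).natAbs, fun j => ?_⟩
  rw [LinearMap.sub_apply, LinearMap.smul_apply, nsmul_eq_mul]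
  rcases (h j).lt_or_eq with h1 | h1
  · have h2 : (m (v j)).natAbs ≤ ∑ j, (m (v j)).natAbs :=
      Finset.single_le_sum (f := fun j => (m (v j)).natAbs) (fun _ _ => Nat.zero_le _)
        (Finset.mem_univ j)
    have h3 : m (v j) ≤ ((∑ j, (m (v j)).natAbs : ℕ) : ℤ) := by omega
    nlinarith
  · rw [← h1, mul_zero, zero_sub]
    have := h0 j h1.symm
    omega

end Cone

/-! ### Regular triples in the group algebra -/

section Graded

variable {𝕜 : Type*} [Field 𝕜] {N : Type*} [AddCommGroup N] {J : Type*}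

/-- The span of the characters in the shifted dual cone, as an additive group. -/
def charSpan (𝕜 : Type*) [Field 𝕜] (v : J → N) (c : J → ℤ) : AddSubgroup (GroupAlg 𝕜 N) where
  carrier := {f | ∀ j, LowerBound (v j) (-c j) f}
  zero_mem' _ := LowerBound.zero _ _
  add_mem' hf hg j := (hf j).add (hg j)
  neg_mem' hf j := (hf j).neg

theorem mem_charSpan {v : J → N} {c : J → ℤ} {f : GroupAlg 𝕜 N} :
    f ∈ charSpan 𝕜 v c ↔ ∀ j, LowerBound (v j) (-c j) f := Iff.rfl

theorem mem_charSpan_zero {v : J → N} {f : GroupAlg 𝕜 N} :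
    f ∈ charSpan 𝕜 v 0 ↔ ∀ j, LowerBound (v j) 0 f := by
  simp [mem_charSpan]

theorem mul_mem_charSpan {v : J → N} {c : J → ℤ} {r f : GroupAlg 𝕜 N} (hr : r ∈ charSpan 𝕜 v 0)
    (hf : f ∈ charSpan 𝕜 v c) : r * f ∈ charSpan 𝕜 v c := fun j =>
  ((hr j).mul (hf j)).mono (by simp)

theorem part_mem_charSpan {v : J → N} {c : J → ℤ} {f : GroupAlg 𝕜 N} (hf : f ∈ charSpan 𝕜 v c)
    (w : N) (d : ℤ) : part w d f ∈ charSpan 𝕜 v c := fun j m hm =>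
  hf j m (support_part_subset w d f hm)

theorem algebraMap_mem_charSpan (v : J → N) (r : 𝕜) :
    algebraMap 𝕜 (GroupAlg 𝕜 N) r ∈ charSpan 𝕜 v 0 := by
  rw [AddMonoidAlgebra.coe_algebraMap]
  exact mem_charSpan_zero.2 fun j => (isHomog_single _ _ _).lowerBound

/-- Regular sequences of length three on an additive subgroup of the group algebra. -/
structure IsRegIn (M : AddSubgroup (GroupAlg 𝕜 N)) (x y z : GroupAlg 𝕜 N) : Prop where
  fst : x ≠ 0
  snd : ∀ u ∈ M, ∀ v ∈ M, y * u = x * v → ∃ w ∈ M, u = x * w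
  trd : ∀ u ∈ M, ∀ v ∈ M, ∀ w ∈ M, z * u = x * v + y * w → ∃ v' ∈ M, ∃ w' ∈ M, u = x * v' + y * w'

theorem IsHomog.sub_algebraMap_lowerBound {w : N} {d : ℤ} {x : GroupAlg 𝕜 N}
    (hx : IsHomog w (-d) x) (hd : 0 < d) (r : 𝕜) :
    LowerBound w (-d) (x - algebraMap 𝕜 _ r) := by
  refine hx.lowerBound.sub ?_
  rw [AddMonoidAlgebra.coe_algebraMap]
  exact (isHomog_single w 0 _).lowerBound.mono (by simp; omega)

theorem IsHomog.part_sub_algebraMap {w : N} {d : ℤ} {x : GroupAlg 𝕜 N}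
    (hx : IsHomog w (-d) x) (hd : 0 < d) (r : 𝕜) :
    part w (-d) (x - algebraMap 𝕜 _ r) = x := by
  rw [map_sub, hx.part_eq, AddMonoidAlgebra.coe_algebraMap]
  have h : IsHomog w 0 ((AddMonoidAlgebra.single 0 ∘ algebraMap 𝕜 𝕜) r : GroupAlg 𝕜 N) := by
    simpa using isHomog_single w (0 : Module.Dual ℤ N) r
  rw [h.lowerBound.part_eq_zero (by omega), sub_zero]

theorem IsHomog.part_sub_algebraMap_mul {w : N} {d e : ℤ} {x f : GroupAlg 𝕜 N}
    (hx : IsHomog w (-d) x) (hd : 0 < d) (r : 𝕜) (hf : LowerBound w e f) :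
    part w (-d + e) ((x - algebraMap 𝕜 _ r) * f) = x * part w e f := by
  rw [(hx.sub_algebraMap_lowerBound hd r).part_mul hf, hx.part_sub_algebraMap hd r]

theorem LowerBound.sub_sub_algebraMap_mul {w : N} {d e : ℤ} {u t α : GroupAlg 𝕜 N}
    (hd : 0 < d) (r : 𝕜) (hu : LowerBound w (e + 1) (u - t * α)) (hα : IsHomog w (e + d) α) :
    LowerBound w (e + 1) (u - (t - algebraMap 𝕜 _ r) * α) := by
  have h1 : u - (t - algebraMap 𝕜 _ r) * α = (u - t * α) + algebraMap 𝕜 _ r * α := by ring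
  rw [h1]
  refine hu.add ?_
  rw [AddMonoidAlgebra.coe_algebraMap]
  have h2 : LowerBound w 0 ((AddMonoidAlgebra.single 0 ∘ algebraMap 𝕜 𝕜) r : GroupAlg 𝕜 N) := by
    simpa using (isHomog_single w (0 : Module.Dual ℤ N) r).lowerBound
  exact (h2.mul hα.lowerBound).mono (by omega)

/-- A homogeneous regular sequence stays regular after subtracting scalars. -/
theorem IsRegIn.sub_algebraMap {v : J → N} {c : J → ℤ} {x y z : GroupAlg 𝕜 N}
    (h : IsRegIn (charSpan 𝕜 v c) x y z) (hx : x ∈ charSpan 𝕜 v 0) (hy : y ∈ charSpan 𝕜 v 0)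
    (hz : z ∈ charSpan 𝕜 v 0) {w : N} {d E : ℤ} (hd : 0 < d) (hxd : IsHomog w (-d) x)
    (hyd : IsHomog w (-d) y) (hzd : IsHomog w (-d) z)
    (hE : ∀ f ∈ charSpan 𝕜 v c, ∀ e, E < e → LowerBound w e f → f = 0)
    (hbot : ∀ f : GroupAlg 𝕜 N, ∃ e, LowerBound w e f) (r₁ r₂ r₃ : 𝕜) :
    IsRegIn (charSpan 𝕜 v c) (x - algebraMap 𝕜 _ r₁) (y - algebraMap 𝕜 _ r₂)
      (z - algebraMap 𝕜 _ r₃) := by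
  have hx' : x - algebraMap 𝕜 _ r₁ ∈ charSpan 𝕜 v 0 :=
    sub_mem hx (algebraMap_mem_charSpan v r₁)
  have hy' : y - algebraMap 𝕜 _ r₂ ∈ charSpan 𝕜 v 0 :=
    sub_mem hy (algebraMap_mem_charSpan v r₂)
  have hz' : z - algebraMap 𝕜 _ r₃ ∈ charSpan 𝕜 v 0 :=
    sub_mem hz (algebraMap_mem_charSpan v r₃)
  have hbound : ∀ f g k : GroupAlg 𝕜 N, ∃ r : ℕ,
      LowerBound w (E + 1 - r) f ∧ LowerBound w (E + 1 - r) g ∧ LowerBound w (E + 1 - r) k := by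
    intro f g k
    obtain ⟨e₁, h₁⟩ := hbot f
    obtain ⟨e₂, h₂⟩ := hbot g
    obtain ⟨e₃, h₃⟩ := hbot k
    exact ⟨(E + 1 - e₁).toNat + (E + 1 - e₂).toNat + (E + 1 - e₃).toNat, h₁.mono (by omega),
      h₂.mono (by omega), h₃.mono (by omega)⟩
  -- The witnesses supplied by regularity may be inhomogeneous; only their component of degree e + d
  -- matters.
  have hcomp : ∀ {t f α : GroupAlg 𝕜 N} (e : ℤ), IsHomog w (-d) t → part w e f = t * α →
      part w e f = t * part w (e + d) α := by
    intro t f α e ht hf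
    have h1 := ht.part_mul (d := e + d) (g := α)
    rw [show -d + (e + d) = e by ring] at h1
    rw [← h1, ← hf, (isHomog_part w e f).part_eq]
  have hlead : ∀ {u t α : GroupAlg 𝕜 N} {e : ℤ} (r : 𝕜), LowerBound w e u →
      part w e u = t * α → IsHomog w (e + d) α →
      LowerBound w (e + 1) (u - (t - algebraMap 𝕜 _ r) * α) := by
    intro u t α e r hu hpart hα
    exact LowerBound.sub_sub_algebraMap_mul hd r (by rw [← hpart]; exact hu.sub_part) hα
  refine ⟨?_, ?_, ?_⟩
  · intro h0
    have := hxd.part_sub_algebraMap hd r₁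
    rw [h0, map_zero] at this
    exact h.fst this.symm
  -- Induction on the distance of the orders along w from E + 1, where all elements of the module
  -- vanish. Each step strips off the lowest parts, in which the subtracted scalars are invisible.
  · have key : ∀ (r : ℕ), ∀ u ∈ charSpan 𝕜 v c, ∀ v' ∈ charSpan 𝕜 v c,
        LowerBound w (E + 1 - r) u → LowerBound w (E + 1 - r) v' →
        (y - algebraMap 𝕜 _ r₂) * u = (x - algebraMap 𝕜 _ r₁) * v' →
        ∃ w' ∈ charSpan 𝕜 v c, u = (x - algebraMap 𝕜 _ r₁) * w' := by
      intro r
      induction r with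
      | zero =>
        intro u hu v' hv' hub _ _
        exact ⟨0, zero_mem _, by rw [hE u hu _ (by simp) hub, mul_zero]⟩
      | succ r ih =>
        intro u hu v' hv' hub hvb heq
        set e : ℤ := E + 1 - (r + 1 : ℕ) with he
        have htop := congrArg (part w (-d + e)) heq
        rw [hyd.part_sub_algebraMap_mul hd _ hub, hxd.part_sub_algebraMap_mul hd _ hvb] at htop
        obtain ⟨α₀, hα₀, hα₁⟩ := h.snd _ (part_mem_charSpan hu w e) _
          (part_mem_charSpan hv' w e) htop
        have hα₂ := hcomp e hxd hα₁
        set α := part w (e + d) α₀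
        have hα : α ∈ charSpan 𝕜 v c := part_mem_charSpan hα₀ w _
        have hαh : IsHomog w (e + d) α := isHomog_part _ _ _
        have hv₂ : part w e v' = y * α := by
          refine mul_left_cancel₀ h.fst ?_
          rw [← htop, hα₂]; ring
        obtain ⟨w', hw', hw''⟩ := ih (u - (x - algebraMap 𝕜 _ r₁) * α)
          (sub_mem hu (mul_mem_charSpan hx' hα)) (v' - (y - algebraMap 𝕜 _ r₂) * α)
          (sub_mem hv' (mul_mem_charSpan hy' hα))
          ((hlead r₁ hub hα₂ hαh).mono (by rw [he]; push_cast; omega))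
          ((hlead r₂ hvb hv₂ hαh).mono (by rw [he]; push_cast; omega))
          (by rw [mul_sub, mul_sub, heq]; ring)
        exact ⟨w' + α, add_mem hw' hα, by rw [mul_add, ← hw'']; ring⟩
    intro u hu v' hv' heq
    obtain ⟨r, h1, h2, -⟩ := hbound u v' 0
    exact key r u hu v' hv' h1 h2 heq
  · have key : ∀ (r : ℕ), ∀ u ∈ charSpan 𝕜 v c, ∀ v' ∈ charSpan 𝕜 v c, ∀ w' ∈ charSpan 𝕜 v c,
        LowerBound w (E + 1 - r) u → LowerBound w (E + 1 - r) v' → LowerBound w (E + 1 - r) w' →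
        (z - algebraMap 𝕜 _ r₃) * u =
          (x - algebraMap 𝕜 _ r₁) * v' + (y - algebraMap 𝕜 _ r₂) * w' →
        ∃ v'' ∈ charSpan 𝕜 v c, ∃ w'' ∈ charSpan 𝕜 v c,
          u = (x - algebraMap 𝕜 _ r₁) * v'' + (y - algebraMap 𝕜 _ r₂) * w'' := by
      intro r
      induction r with
      | zero =>
        intro u hu v' hv' w' hw' hub _ _ _
        exact ⟨0, zero_mem _, 0, zero_mem _, by
          rw [hE u hu _ (by simp) hub, mul_zero, mul_zero, add_zero]⟩
      | succ r ih =>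
        intro u hu v' hv' w' hw' hub hvb hwb heq
        set e : ℤ := E + 1 - (r + 1 : ℕ) with he
        have htop := congrArg (part w (-d + e)) heq
        rw [map_add, hzd.part_sub_algebraMap_mul hd _ hub, hxd.part_sub_algebraMap_mul hd _ hvb,
          hyd.part_sub_algebraMap_mul hd _ hwb] at htop
        obtain ⟨α₀, hα₀, β₀, hβ₀, hαβ₀⟩ := h.trd _ (part_mem_charSpan hu w e) _
          (part_mem_charSpan hv' w e) _ (part_mem_charSpan hw' w e) htop
        have hαβ : part w e u = x * part w (e + d) α₀ + y * part w (e + d) β₀ := by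
          have h1 := hxd.part_mul (d := e + d) (g := α₀)
          have h2 := hyd.part_mul (d := e + d) (g := β₀)
          rw [show -d + (e + d) = e by ring] at h1 h2
          rw [← h1, ← h2, ← map_add, ← hαβ₀, (isHomog_part w e u).part_eq]
        set α := part w (e + d) α₀
        set β := part w (e + d) β₀
        have hα : α ∈ charSpan 𝕜 v c := part_mem_charSpan hα₀ w _
        have hβ : β ∈ charSpan 𝕜 v c := part_mem_charSpan hβ₀ w _
        have hαh : IsHomog w (e + d) α := isHomog_part _ _ _
        have hβh : IsHomog w (e + d) β := isHomog_part _ _ _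
        -- The choice of α and β settles only u. The lowest parts of v' and w' may still differ from
        -- zα and zβ by a syzygy of x and y, which is a multiple γ of the Koszul one.
        have hsyz : y * (part w e w' - z * β) = x * (z * α - part w e v') := by
          rw [hαβ] at htop
          linear_combination -htop
        obtain ⟨γ₀, hγ₀, hγ₁⟩ := h.snd _
          (sub_mem (part_mem_charSpan hw' w e) (mul_mem_charSpan hz hβ)) _
          (sub_mem (mul_mem_charSpan hz hα) (part_mem_charSpan hv' w e)) hsyz
        have hpz : part w e (part w e w' - z * β) = part w e w' - z * β := by
          have h2 := hzd.part_mul (d := e + d) (g := β)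
          rw [show -d + (e + d) = e by ring, hβh.part_eq] at h2
          rw [map_sub, h2, (isHomog_part w e w').part_eq]
        have hγ₂ := hcomp e hxd (by rw [hpz]; exact hγ₁)
        rw [hpz] at hγ₂
        set γ := part w (e + d) γ₀
        have hγ : γ ∈ charSpan 𝕜 v c := part_mem_charSpan hγ₀ w _
        have hγh : IsHomog w (e + d) γ := isHomog_part _ _ _
        have hv₂ : z * α - part w e v' = y * γ := by
          refine mul_left_cancel₀ h.fst ?_
          rw [← hsyz, hγ₂]; ring
        have hconst : ∀ (s : 𝕜) {f : GroupAlg 𝕜 N}, IsHomog w (e + d) f →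
            LowerBound w (e + 1) (algebraMap 𝕜 (GroupAlg 𝕜 N) s * f) := by
          intro s f hf
          have := LowerBound.sub_sub_algebraMap_mul (t := 0) (u := 0) hd s
            (by rw [zero_mul, sub_zero]; exact LowerBound.zero _ _) hf
          simpa using this
        have hu₁ : LowerBound w (e + 1)
            (u - (x - algebraMap 𝕜 _ r₁) * α - (y - algebraMap 𝕜 _ r₂) * β) := by
          have h1 : u - (x - algebraMap 𝕜 _ r₁) * α - (y - algebraMap 𝕜 _ r₂) * β =
              (u - part w e u) + algebraMap 𝕜 _ r₁ * α + algebraMap 𝕜 _ r₂ * β := by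
            rw [hαβ]; ring
          rw [h1]
          exact (hub.sub_part.add (hconst _ hαh)).add (hconst _ hβh)
        have hv₁ : LowerBound w (e + 1)
            (v' - (z - algebraMap 𝕜 _ r₃) * α + (y - algebraMap 𝕜 _ r₂) * γ) := by
          have h1 : v' - (z - algebraMap 𝕜 _ r₃) * α + (y - algebraMap 𝕜 _ r₂) * γ =
              (v' - part w e v') + algebraMap 𝕜 _ r₃ * α - algebraMap 𝕜 _ r₂ * γ := by
            linear_combination -hv₂
          rw [h1]
          exact (hvb.sub_part.add (hconst _ hαh)).sub (hconst _ hγh)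
        have hw₁ : LowerBound w (e + 1)
            (w' - (z - algebraMap 𝕜 _ r₃) * β - (x - algebraMap 𝕜 _ r₁) * γ) := by
          have h1 : w' - (z - algebraMap 𝕜 _ r₃) * β - (x - algebraMap 𝕜 _ r₁) * γ =
              (w' - part w e w') + algebraMap 𝕜 _ r₃ * β + algebraMap 𝕜 _ r₁ * γ := by
            linear_combination hγ₂
          rw [h1]
          exact (hwb.sub_part.add (hconst _ hβh)).add (hconst _ hγh)
        have hee : E + 1 - (r : ℤ) ≤ e + 1 := by rw [he]; push_cast; omega
        obtain ⟨v'', hv'', w'', hw'', hres⟩ := ih _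
          (sub_mem (sub_mem hu (mul_mem_charSpan hx' hα)) (mul_mem_charSpan hy' hβ)) _
          (add_mem (sub_mem hv' (mul_mem_charSpan hz' hα)) (mul_mem_charSpan hy' hγ)) _
          (sub_mem (sub_mem hw' (mul_mem_charSpan hz' hβ)) (mul_mem_charSpan hx' hγ))
          (hu₁.mono hee) (hv₁.mono hee) (hw₁.mono hee) (by linear_combination heq)
        exact ⟨v'' + α, add_mem hv'' hα, w'' + β, add_mem hw'' hβ, by
          linear_combination hres⟩
    intro u hu v' hv' w' hw' heq
    obtain ⟨r, h1, h2, h3⟩ := hbound u v' w'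
    exact key r u hu v' hv' w' hw' h1 h2 h3 heq

end Graded

/-! ### Parameters of the toric ring of a polygon -/

section Parameters

variable {𝕜 : Type*} [Field 𝕜] {K : ℕ} {v : Fin K → Fin 3 → ℤ}

/-- The product of the squares of all edge characters. -/
noncomputable def xPar (𝕜 : Type*) [Field 𝕜] (v : Fin K → Fin 3 → ℤ) : GroupAlg 𝕜 (Fin 3 → ℤ) :=
  chi 𝕜 (2 • ∑ i, scaledEdge v i)

/-- A power sum of the edge characters. -/
noncomputable def yPar (𝕜 : Type*) [Field 𝕜] (v : Fin K → Fin 3 → ℤ) : GroupAlg 𝕜 (Fin 3 → ℤ) :=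
  ∑ i, chi 𝕜 ((2 * K) • scaledEdge v i)

/-- A sum of powers of the products of adjacent edge characters. -/
noncomputable def zPar (𝕜 : Type*) [Field 𝕜] (v : Fin K → Fin 3 → ℤ) : GroupAlg 𝕜 (Fin 3 → ℤ) :=
  ∑ i, chi 𝕜 (K • (scaledEdge v i + scaledEdge v (nxt i)))

/-- The degree of the parameters. -/
def parDegree (v : Fin K → Fin 3 → ℤ) : ℤ := 2 * K * edgeDegree v

theorem IsConvexList.parDegree_pos (hv : IsConvexList v) : 0 < parDegree v := by
  have h1 := hv.three_le
  have h2 := hv.edgeDegree_pos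
  have h3 : (0 : ℤ) < K := by omega
  unfold parDegree
  positivity

theorem isHomog_chi {w : Fin 3 → ℤ} {m : Module.Dual ℤ (Fin 3 → ℤ)} {d : ℤ} (h : m w = d) :
    IsHomog w d (chi 𝕜 m) := h ▸ isHomog_single w m 1

/-- The exponents 2, 2K and K give the three parameters a common degree, as `IsRegIn.sub_algebraMap`
requires. The weight is negated so that lowest parts are those of top degree in `totalWeight`. -/
theorem isHomog_xPar (v : Fin K → Fin 3 → ℤ) :
    IsHomog (-totalWeight v) (-parDegree v) (xPar 𝕜 v) := by
  refine isHomog_chi ?_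
  simp only [map_neg, LinearMap.smul_apply, LinearMap.sum_apply, scaledEdge_totalWeight,
    Finset.sum_const, Finset.card_univ, Fintype.card_fin, parDegree, nsmul_eq_mul]
  push_cast; ring

theorem isHomog_yPar (v : Fin K → Fin 3 → ℤ) :
    IsHomog (-totalWeight v) (-parDegree v) (yPar 𝕜 v) := by
  refine IsHomog.sum _ fun i _ => isHomog_chi ?_
  simp only [map_neg, LinearMap.smul_apply, scaledEdge_totalWeight, parDegree, nsmul_eq_mul]
  push_cast; ring

theorem isHomog_zPar (v : Fin K → Fin 3 → ℤ) :
    IsHomog (-totalWeight v) (-parDegree v) (zPar 𝕜 v) := by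
  refine IsHomog.sum _ fun i _ => isHomog_chi ?_
  simp only [map_neg, LinearMap.smul_apply, LinearMap.add_apply, scaledEdge_totalWeight, parDegree,
    nsmul_eq_mul]
  ring

theorem chi_mem_charSpan {m : Module.Dual ℤ (Fin 3 → ℤ)} (h : ∀ j, 0 ≤ m (v j)) :
    chi 𝕜 m ∈ charSpan 𝕜 v 0 :=
  mem_charSpan_zero.2 fun j => lowerBound_chi _ _ (h j)

theorem IsConvexList.xPar_mem (hv : IsConvexList v) : xPar 𝕜 v ∈ charSpan 𝕜 v 0 := by
  refine chi_mem_charSpan fun j => ?_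
  rw [LinearMap.smul_apply, LinearMap.sum_apply]
  exact nsmul_nonneg (Finset.sum_nonneg fun i _ => hv.scaledEdge_nonneg i j) _

theorem IsConvexList.yPar_mem (hv : IsConvexList v) : yPar 𝕜 v ∈ charSpan 𝕜 v 0 :=
  sum_mem fun i _ => chi_mem_charSpan fun j => by
    rw [LinearMap.smul_apply]
    exact nsmul_nonneg (hv.scaledEdge_nonneg i j) _

theorem IsConvexList.zPar_mem (hv : IsConvexList v) : zPar 𝕜 v ∈ charSpan 𝕜 v 0 :=
  sum_mem fun i _ => chi_mem_charSpan fun j => by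
    rw [LinearMap.smul_apply, LinearMap.add_apply]
    exact nsmul_nonneg (add_nonneg (hv.scaledEdge_nonneg i j) (hv.scaledEdge_nonneg _ j)) _

/-- The summand of the edge starting at v_j has order zero along v_j. Exponents of different
summands are not shown to be distinct, so its coefficient is a positive count, nonzero in
characteristic zero. -/
theorem part_yPar_ne_zero [CharZero 𝕜] (v : Fin K → Fin 3 → ℤ) (j : Fin K) :
    part (v j) 0 (yPar 𝕜 v) ≠ 0 := by
  classical
  intro h
  have h1 := coeff_part_of_eq (w := v j) (d := 0) (yPar 𝕜 v) (m := (2 * K) • scaledEdge v j)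
    (by rw [LinearMap.smul_apply, scaledEdge_self, smul_zero])
  rw [h, yPar, AddMonoidAlgebra.coeff_sum, Finsupp.finsetSum_apply] at h1
  simp only [chi, AddMonoidAlgebra.coeff_single, Finsupp.single_apply, Finset.sum_boole,
    AddMonoidAlgebra.coeff_zero, Finsupp.zero_apply] at h1
  have h2 := Nat.cast_eq_zero.1 h1.symm
  rw [Finset.card_eq_zero] at h2
  exact Finset.notMem_empty j (h2 ▸ by simp)

theorem chi_mul_cancel_mem {m : Module.Dual ℤ (Fin 3 → ℤ)} {w : Fin 3 → ℤ} {c : ℤ}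
    {f : GroupAlg 𝕜 (Fin 3 → ℤ)} (h : m w = 0) (hf : LowerBound w c (chi 𝕜 m * f)) :
    LowerBound w c f := by
  refine (lowerBound_chi_mul (𝕜 := 𝕜) m).1 ?_
  rwa [h, add_zero]

theorem chi_neg_mul_cancel (m : Module.Dual ℤ (Fin 3 → ℤ)) (f : GroupAlg 𝕜 (Fin 3 → ℤ)) :
    chi 𝕜 m * (chi 𝕜 (-m) * f) = f := by
  rw [← mul_assoc, chi_mul_chi, add_neg_cancel, chi_zero, one_mul]

/-- An element of the quotient field that becomes regular after multiplication with both the first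
and the second parameter is regular. -/
theorem IsConvexList.snd_par [CharZero 𝕜] (hv : IsConvexList v) (c : Fin K → ℤ)
    {u u' : GroupAlg 𝕜 (Fin 3 → ℤ)} (hu' : u' ∈ charSpan 𝕜 v c)
    (h : yPar 𝕜 v * u = xPar 𝕜 v * u') : ∃ w ∈ charSpan 𝕜 v c, u = xPar 𝕜 v * w := by
  set a := 2 • ∑ i, scaledEdge v i with ha
  -- The monomial x is a unit of the group algebra, so the witness is u/x. Its product with y is u',
  -- and y has order zero along every ray.
  refine ⟨chi 𝕜 (-a) * u, fun j => ?_, (chi_neg_mul_cancel a u).symm⟩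
  refine LowerBound.of_mul (mem_charSpan_zero.1 hv.yPar_mem j) (part_yPar_ne_zero v j) ?_
  have : yPar 𝕜 v * (chi 𝕜 (-a) * u) = u' := by
    refine mul_left_cancel₀ (chi_ne_zero (𝕜 := 𝕜) a) ?_
    rw [show chi 𝕜 a = xPar 𝕜 v from rfl, ← h, mul_left_comm, xPar, ← ha, chi_neg_mul_cancel]
  rw [this]
  exact hu' j

/-- The vanishing of the first Čech cohomology of the punctured spectrum, graded piece by graded
piece: the sections over the open sets of the edges can be corrected by a common section. -/
theorem exists_common_correction (c : Fin K → ℤ)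
    (halt : ∀ m : Module.Dual ℤ (Fin 3 → ℤ), NoAlternation fun j => m (v j) < -c j)
    (g : Fin K → GroupAlg 𝕜 (Fin 3 → ℤ))
    (hg : ∀ i, LowerBound (v (nxt i)) (-c (nxt i)) (g i - g (nxt i))) :
    ∃ f : GroupAlg 𝕜 (Fin 3 → ℤ), ∀ i, LowerBound (v i) (-c i) (g i - f) ∧
      LowerBound (v (nxt i)) (-c (nxt i)) (g i - f) := by
  classical
  let neg : Module.Dual ℤ (Fin 3 → ℤ) → Fin K → Prop := fun m j => m (v j) < -c j
  have hstep : ∀ m i, neg m (nxt i) → (g i).coeff m = (g (nxt i)).coeff m := by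
    intro m i hm
    by_contra hne
    have h1 : m ∈ (g i - g (nxt i)).coeff.support := by
      rw [Finsupp.mem_support_iff, AddMonoidAlgebra.coeff_sub, Finsupp.sub_apply]
      exact sub_ne_zero.2 hne
    exact absurd (hg i m h1) (not_le.2 hm)
  -- In degree m the correction copies the coefficient of g at any violated vertex; absence of
  -- alternation makes the choice immaterial. Degrees without violated vertices need no correction.
  let φ : Module.Dual ℤ (Fin 3 → ℤ) → 𝕜 := fun m =>
    if h : ∃ j, neg m j then (g h.choose).coeff m else 0
  have hφ : ∀ m j, neg m j → φ m = (g j).coeff m := by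
    intro m j hj
    have h : ∃ j, neg m j := ⟨j, hj⟩
    simp only [φ, dif_pos h]
    exact (halt m).eq_of_mem (lam := fun j => (g j).coeff m) (hstep m) h.choose_spec hj
  have hφ0 : ∀ m, φ m ≠ 0 → m ∈ Finset.univ.biUnion fun j => (g j).coeff.support := by
    intro m hm
    by_cases h : ∃ j, neg m j
    · obtain ⟨j, hj⟩ := h
      rw [hφ m j hj] at hm
      exact Finset.mem_biUnion.2 ⟨j, Finset.mem_univ _, Finsupp.mem_support_iff.2 hm⟩
    · exact absurd (dif_neg h) hm
  refine ⟨.ofCoeff (Finsupp.onFinset _ φ hφ0), fun i => ⟨fun m hm => ?_, fun m hm => ?_⟩⟩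
  · by_contra hlt
    rw [Finsupp.mem_support_iff, AddMonoidAlgebra.coeff_sub, Finsupp.sub_apply] at hm
    exact hm (sub_eq_zero.2 (hφ m i (not_le.1 hlt)).symm)
  · by_contra hlt
    rw [Finsupp.mem_support_iff, AddMonoidAlgebra.coeff_sub, Finsupp.sub_apply] at hm
    refine hm (sub_eq_zero.2 ?_)
    rw [hstep m i (not_le.1 hlt)]
    exact (hφ m (nxt i) (not_le.1 hlt)).symm

/-- The quotient by the first two parameters has no section supported at the vertex. -/
theorem IsConvexList.mem_of_edge_mul_mem [CharZero 𝕜] (hv : IsConvexList v) (c : Fin K → ℤ)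
    (halt : ∀ m : Module.Dual ℤ (Fin 3 → ℤ), NoAlternation fun j => m (v j) < -c j)
    (r : Fin K → ℕ) {u : GroupAlg 𝕜 (Fin 3 → ℤ)} (p q : Fin K → GroupAlg 𝕜 (Fin 3 → ℤ))
    (hp : ∀ i, p i ∈ charSpan 𝕜 v c) (hq : ∀ i, q i ∈ charSpan 𝕜 v c)
    (h : ∀ i, chi 𝕜 (r i • scaledEdge v i) * u = xPar 𝕜 v * p i + yPar 𝕜 v * q i) :
    ∃ v' ∈ charSpan 𝕜 v c, ∃ w' ∈ charSpan 𝕜 v c, u = xPar 𝕜 v * v' + yPar 𝕜 v * w' := by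
  set x := xPar 𝕜 v with hx
  set y := yPar 𝕜 v with hy
  have h0 := hv.three_le
  have hx0 : x ≠ 0 := chi_ne_zero _
  let i₀ : Fin K := ⟨0, by omega⟩
  let m : Fin K → Module.Dual ℤ (Fin 3 → ℤ) := fun i => r i • scaledEdge v i
  have hm₁ : ∀ i, m i (v i) = 0 := fun i => by
    simp only [m, LinearMap.smul_apply, scaledEdge_self, smul_zero]
  have hm₂ : ∀ i, m i (v (nxt i)) = 0 := fun i => by
    simp only [m, LinearMap.smul_apply, scaledEdge_nxt, smul_zero]
  -- Dividing by the character of the edge i presents u as xν + yω over the chart of that edge, with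
  -- ν and ω satisfying the bounds at both of its ends.
  let ν : Fin K → GroupAlg 𝕜 (Fin 3 → ℤ) := fun i => chi 𝕜 (-m i) * p i
  let ω : Fin K → GroupAlg 𝕜 (Fin 3 → ℤ) := fun i => chi 𝕜 (-m i) * q i
  have hmul : ∀ (i : Fin K) (f : GroupAlg 𝕜 (Fin 3 → ℤ)), f ∈ charSpan 𝕜 v c →
      LowerBound (v i) (-c i) (chi 𝕜 (-m i) * f) ∧
      LowerBound (v (nxt i)) (-c (nxt i)) (chi 𝕜 (-m i) * f) := by
    intro i f hf
    refine ⟨chi_mul_cancel_mem (hm₁ i) ?_, chi_mul_cancel_mem (hm₂ i) ?_⟩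
    · rw [chi_neg_mul_cancel]; exact hf i
    · rw [chi_neg_mul_cancel]; exact hf (nxt i)
  have hu : ∀ i, u = x * ν i + y * ω i := by
    intro i
    refine mul_left_cancel₀ (chi_ne_zero (𝕜 := 𝕜) (m i)) ?_
    rw [show chi 𝕜 (m i) * u = x * p i + y * q i from h i, mul_add, mul_left_comm _ x,
      mul_left_comm _ y]
    simp only [ν, ω, chi_neg_mul_cancel]
  let a := 2 • ∑ i, scaledEdge v i
  have hxa : ∀ f, x * (chi 𝕜 (-a) * f) = f := fun f => chi_neg_mul_cancel a f
  -- Two presentations of u differ by a multiple of the syzygy (-y, x); `g i` is the multiplier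
  -- between those of i₀ and i. Correcting all multipliers by a common f makes the presentation
  -- global.
  let g : Fin K → GroupAlg 𝕜 (Fin 3 → ℤ) := fun i => chi 𝕜 (-a) * (ω i - ω i₀)
  have hg : ∀ i, LowerBound (v (nxt i)) (-c (nxt i)) (g i - g (nxt i)) := by
    intro i
    refine LowerBound.of_mul (mem_charSpan_zero.1 hv.yPar_mem (nxt i))
      (part_yPar_ne_zero v (nxt i)) ?_
    have : yPar 𝕜 v * (g i - g (nxt i)) = ν (nxt i) - ν i := by
      refine mul_left_cancel₀ hx0 ?_
      have h1 : x * (y * (g i - g (nxt i))) = y * (x * g i - x * g (nxt i)) := by ring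
      rw [← hy, h1]
      simp only [g, hxa]
      have h2 := hu i
      have h3 := hu (nxt i)
      linear_combination h3 - h2
    rw [this]
    exact (hmul (nxt i) _ (hp _)).1.sub (hmul i _ (hp _)).2
  obtain ⟨f, hf⟩ := exists_common_correction c halt g hg
  have hxmem : x ∈ charSpan 𝕜 v 0 := hv.xPar_mem
  have hymem : y ∈ charSpan 𝕜 v 0 := hv.yPar_mem
  have hlb : ∀ {j : Fin K} {t e : GroupAlg 𝕜 (Fin 3 → ℤ)}, t ∈ charSpan 𝕜 v 0 →
      LowerBound (v j) (-c j) e → LowerBound (v j) (-c j) (t * e) := by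
    intro j t e ht he
    exact ((mem_charSpan_zero.1 ht j).mul he).mono (by simp)
  have hω : ∀ i, ω i₀ + x * f = ω i - x * (g i - f) := by
    intro i
    rw [mul_sub]; simp only [g, hxa]; ring
  have hν : ∀ i, ν i₀ - y * f = ν i + y * (g i - f) := by
    intro i
    refine mul_left_cancel₀ hx0 ?_
    have h2 := hu i
    have h3 := hu i₀
    have h4 : x * g i = ω i - ω i₀ := by simp only [g, hxa]
    linear_combination h2 - h3 - y * h4
  refine ⟨ν i₀ - y * f, fun j => ?_, ω i₀ + x * f, fun j => ?_, ?_⟩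
  · rw [hν j]
    exact (hmul j _ (hp j)).1.add (hlb hymem (hf j).1)
  · rw [hω j]
    exact (hmul j _ (hq j)).1.sub (hlb hxmem (hf j).1)
  · rw [hu i₀]; ring

theorem mem_toricSubalgebra_iff_mem_charSpan (v : Fin K → Fin 3 → ℤ) {f : GroupAlg 𝕜 (Fin 3 → ℤ)} :
    f ∈ toricSubalgebra 𝕜 v ↔ f ∈ charSpan 𝕜 v 0 := by
  rw [mem_toricSubalgebra_iff, mem_charSpan_zero]

/-- Some power of each edge character lies in the ideal of the parameters. -/
theorem IsConvexList.exists_chi_pow_mem (hv : IsConvexList v) (i : Fin K) :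
    ∃ r : ℕ, ∃ α ∈ charSpan 𝕜 v 0, ∃ β ∈ charSpan 𝕜 v 0, ∃ γ ∈ charSpan 𝕜 v 0,
      chi 𝕜 (r • scaledEdge v i) = xPar 𝕜 v * α + yPar 𝕜 v * β + zPar 𝕜 v * γ := by
  classical
  let R := toricSubalgebra 𝕜 v
  have hK := hv.three_le
  let mk : ∀ m : Module.Dual ℤ (Fin 3 → ℤ), (∀ j, 0 ≤ m (v j)) → R :=
    fun m hm => ⟨chi 𝕜 m, single_mem_toricSubalgebra hm 1⟩
  have hE : ∀ i j, 0 ≤ scaledEdge v i (v j) := hv.scaledEdge_nonneg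
  let s : Fin K → R := fun i => mk (scaledEdge v i) (hE i)
  let x : R := ⟨xPar 𝕜 v, (mem_toricSubalgebra_iff_mem_charSpan v).2 hv.xPar_mem⟩
  let y : R := ⟨yPar 𝕜 v, (mem_toricSubalgebra_iff_mem_charSpan v).2 hv.yPar_mem⟩
  let z : R := ⟨zPar 𝕜 v, (mem_toricSubalgebra_iff_mem_charSpan v).2 hv.zPar_mem⟩
  have hy : y = ∑ i, s i ^ (2 * K) := by
    apply Subtype.ext
    simp [y, yPar, s, mk, AddSubmonoidClass.coe_finsetSum]
  have hz : z = ∑ i, (s i * s (nxt i)) ^ K := by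
    apply Subtype.ext
    simp [z, zPar, s, mk, AddSubmonoidClass.coe_finsetSum]
  -- Let q be a prime containing the parameters. Interior characters lie in q because a power is
  -- divisible by x; z then yields the products of adjacent edge characters, and y the edge
  -- characters themselves.
  have hrad : s i ∈ (Ideal.span {x, y, z}).radical := by
    rw [Ideal.radical_eq_sInf, Submodule.mem_sInf]
    rintro (q : Ideal R) ⟨hle, hq⟩
    have hxq : x ∈ q := hle (Ideal.subset_span (by simp))
    have hyq : y ∈ q := hle (Ideal.subset_span (by simp))
    have hzq : z ∈ q := hle (Ideal.subset_span (by simp))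
    have hint : ∀ (m : Module.Dual ℤ (Fin 3 → ℤ)) (hm : ∀ j, 0 < m (v j)),
        mk m (fun j => (hm j).le) ∈ q := by
      intro m hm
      obtain ⟨r, hr⟩ := exists_nsmul_sub_nonneg v (a := m) (m := 2 • ∑ i, scaledEdge v i)
        (fun j => (hm j).le) (fun j h => absurd h (hm j).ne')
      refine hq.mem_of_pow_mem r ?_
      have : mk m (fun j => (hm j).le) ^ r = x * mk _ hr := by
        apply Subtype.ext
        simp only [mk, x, xPar, SubmonoidClass.coe_pow, MulMemClass.coe_mul, chi_pow, chi_mul_chi]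
        congr 1
        abel
      rw [this]
      exact q.mul_mem_right _ hxq
    have hnonadj : ∀ a b : Fin K, b ≠ a → b ≠ nxt a → a ≠ nxt b → s a * s b ∈ q := by
      intro a b h1 h2 h3
      have hpos : ∀ j, 0 < (scaledEdge v a + scaledEdge v b) (v j) := by
        intro j
        rw [LinearMap.add_apply]
        by_cases hj : j = a ∨ j = nxt a
        · have : 0 < scaledEdge v b (v j) := by
            refine hv.scaledEdge_pos ?_ ?_
            · rcases hj with rfl | rfl
              exacts [h1.symm, h2.symm]
            · rcases hj with rfl | rfl
              exacts [h3, fun h => h1 (nxt_injective h).symm]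
          have := hE a j
          omega
        · push Not at hj
          have := hv.scaledEdge_pos hj.1 hj.2
          have := hE b j
          omega
      have := hint _ hpos
      have h4 : s a * s b = mk _ (fun j => (hpos j).le) := by
        apply Subtype.ext
        simp [s, mk]
      rwa [h4]
    have htriple : ∀ a b : Fin K, b ≠ a → b ≠ nxt a → s a * s (nxt a) * s b ∈ q := by
      intro a b h1 h2
      have hpos : ∀ j, 0 < (scaledEdge v a + scaledEdge v (nxt a) + scaledEdge v b) (v j) := by
        intro j
        rw [LinearMap.add_apply, LinearMap.add_apply]
        have e1 := hE a j
        have e2 := hE (nxt a) j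
        have e3 := hE b j
        by_cases hja : j = a
        · have h5 : 0 < scaledEdge v (nxt a) (v j) :=
            hv.scaledEdge_pos (by rw [hja]; exact (hv.nxt_ne a).symm)
              (by rw [hja]; exact (hv.nxt_nxt_ne a).symm)
          omega
        · by_cases hjn : j = nxt a
          · have h5 : 0 < scaledEdge v b (v j) :=
              hv.scaledEdge_pos (by rw [hjn]; exact h2.symm)
                (by rw [hjn]; exact fun h => h1 (nxt_injective h).symm)
            omega
          · have := hv.scaledEdge_pos hja hjn
            omega
      have := hint _ hpos
      have h4 : s a * s (nxt a) * s b = mk _ (fun j => (hpos j).le) := by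
        apply Subtype.ext
        simp [s, mk]
      rwa [h4]
    have hK0 : K ≠ 0 := by omega
    -- Multiplied by the a-th adjacent product, z keeps modulo q only its a-th summand: every other
    -- term is a multiple of a product of three distinct edge characters, which is interior.
    have hadj : ∀ a : Fin K, s a * s (nxt a) ∈ q := by
      intro a
      have h1 : s a * s (nxt a) * z ∈ q := q.mul_mem_left _ hzq
      rw [hz, Finset.mul_sum, ← Finset.add_sum_erase _ _ (Finset.mem_univ a)] at h1
      have h2 : ∑ b ∈ Finset.univ.erase a, s a * s (nxt a) * (s b * s (nxt b)) ^ K ∈ q := by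
        refine Ideal.sum_mem _ fun b hb => ?_
        have hba := Finset.ne_of_mem_erase hb
        have h3 : s a * s (nxt a) * (s b * s (nxt b)) ∈ q := by
          by_cases hb2 : b = nxt a
          · have := htriple a (nxt b) (by rw [hb2]; exact hv.nxt_nxt_ne a)
              (by rw [hb2]; exact hv.nxt_ne _)
            rw [show s a * s (nxt a) * (s b * s (nxt b)) = s b * (s a * s (nxt a) * s (nxt b)) by
              ring]
            exact q.mul_mem_left _ this
          · rw [show s a * s (nxt a) * (s b * s (nxt b)) = s (nxt b) * (s a * s (nxt a) * s b) by
              ring]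
            exact q.mul_mem_left _ (htriple a b hba hb2)
        rw [← mul_pow_sub_one hK0, ← mul_assoc]
        exact q.mul_mem_right _ h3
      have h3 := (Ideal.add_mem_iff_left q h2).1 h1
      rw [← pow_succ'] at h3
      exact hq.mem_of_pow_mem _ h3
    have hmul : ∀ a b : Fin K, b ≠ a → s a * s b ∈ q := by
      intro a b hba
      by_cases h1 : b = nxt a
      · rw [h1]; exact hadj a
      by_cases h2 : a = nxt b
      · rw [h2, mul_comm]; exact hadj b
      exact hnonadj a b hba h1 h2
    have h1 : s i * y ∈ q := q.mul_mem_left _ hyq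
    rw [hy, Finset.mul_sum, ← Finset.add_sum_erase _ _ (Finset.mem_univ i)] at h1
    have h2 : ∑ b ∈ Finset.univ.erase i, s i * s b ^ (2 * K) ∈ q := by
      refine Ideal.sum_mem _ fun b hb => ?_
      rw [← mul_pow_sub_one (show 2 * K ≠ 0 by omega), ← mul_assoc]
      exact q.mul_mem_right _ (hmul i b (Finset.ne_of_mem_erase hb))
    have h3 := (Ideal.add_mem_iff_left q h2).1 h1
    rw [← pow_succ'] at h3
    exact hq.mem_of_pow_mem _ h3
  obtain ⟨r, hr⟩ := hrad
  rw [Ideal.mem_span_insert] at hr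
  obtain ⟨α, t, ht, hα⟩ := hr
  rw [Ideal.mem_span_pair] at ht
  obtain ⟨β, γ, ht⟩ := ht
  refine ⟨r, α, (mem_toricSubalgebra_iff_mem_charSpan v).1 α.2,
    β, (mem_toricSubalgebra_iff_mem_charSpan v).1 β.2, γ,
    (mem_toricSubalgebra_iff_mem_charSpan v).1 γ.2, ?_⟩
  have := congrArg Subtype.val hα
  rw [← ht] at this
  simp only [s, mk, SubmonoidClass.coe_pow, chi_pow, AddMemClass.coe_add, MulMemClass.coe_mul, x,
    y, z] at this
  rw [this]; ring

/-- For the third member: since (x, y, z) contains a power of each edge character, zu ∈ xM + yM puts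
the product of u with these powers into xM + yM, and `IsConvexList.mem_of_edge_mul_mem` removes
them. -/
theorem IsConvexList.isRegIn [CharZero 𝕜] (hv : IsConvexList v) (c : Fin K → ℤ)
    (halt : ∀ m : Module.Dual ℤ (Fin 3 → ℤ), NoAlternation fun j => m (v j) < -c j) :
    IsRegIn (charSpan 𝕜 v c) (xPar 𝕜 v) (yPar 𝕜 v) (zPar 𝕜 v) where
  fst := chi_ne_zero _
  snd u _ u' hu' h := hv.snd_par c hu' h
  trd u hu u₁ hu₁ u₂ hu₂ h := by
    choose r α hα β hβ γ hγ hr using hv.exists_chi_pow_mem (𝕜 := 𝕜)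
    refine hv.mem_of_edge_mul_mem c halt r (fun i => α i * u + γ i * u₁)
      (fun i => β i * u + γ i * u₂)
      (fun i => add_mem (mul_mem_charSpan (hα i) hu) (mul_mem_charSpan (hγ i) hu₁))
      (fun i => add_mem (mul_mem_charSpan (hβ i) hu) (mul_mem_charSpan (hγ i) hu₂)) fun i => ?_
    rw [hr i]
    linear_combination γ i * h

end Parameters

/-! ### Sufficiency of the sign criterion -/

/-- The list `n` consists of the members of the convex list `n ∘ g`, possibly with repetitions. -/
structure IsFrame {ι : Type*} {K : ℕ} (n : ι → Fin 3 → ℤ) (g : Fin K → ι) : Prop where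
  convex : IsConvexList fun j => n (g j)
  cover : ∀ i, ∃ j, n i = n (g j)

/-- The vector `b` takes equal values at equal members of the list `n`. -/
def IsCompatible {ι N : Type*} (n : ι → N) (b : ι → ℤ) : Prop :=
  ∀ i i', n i = n i' → b i = b i'

section Frame

variable {𝕜 : Type*} [Field 𝕜] {ι : Type*} {K : ℕ} {n : ι → Fin 3 → ℤ} {g : Fin K → ι}

theorem IsFrame.eq_zero (hg : IsFrame n g) {m : Module.Dual ℤ (Fin 3 → ℤ)}
    (hm : ∀ i, m (n i) = 0) : m = 0 := hg.convex.eq_zero fun j => hm (g j)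

theorem IsFrame.mem_toricSubmodule_iff (hg : IsFrame n g) {b : ι → ℤ} (hb : IsCompatible n b)
    {f : GroupAlg 𝕜 (Fin 3 → ℤ)} :
    f ∈ toricSubmodule 𝕜 n b ↔ f ∈ charSpan 𝕜 (fun j => n (g j)) fun j => b (g j) := by
  rw [ToricCM.mem_toricSubmodule_iff, mem_charSpan]
  refine ⟨fun h j => h (g j), fun h i => ?_⟩
  obtain ⟨j, hj⟩ := hg.cover i
  rw [hj, hb i (g j) hj]
  exact h j

theorem IsFrame.mem_toricSubalgebra_iff (hg : IsFrame n g) {f : GroupAlg 𝕜 (Fin 3 → ℤ)} :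
    f ∈ toricSubalgebra 𝕜 n ↔ f ∈ charSpan 𝕜 (fun j => n (g j)) 0 := by
  rw [ToricCM.mem_toricSubalgebra_iff, mem_charSpan_zero]
  refine ⟨fun h j => h (g j), fun h i => ?_⟩
  obtain ⟨j, hj⟩ := hg.cover i
  rw [hj]
  exact h j

theorem exists_lowerBound {N : Type*} [AddCommGroup N] (w : N) (f : GroupAlg 𝕜 N) :
    ∃ e, LowerBound w e f := by
  by_cases hf : f.coeff.support.Nonempty
  · obtain ⟨m, -, hm⟩ := Finset.exists_min_image f.coeff.support (fun m => m w) hf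
    exact ⟨m w, hm⟩
  · exact ⟨0, fun m hm => absurd ⟨m, hm⟩ hf⟩

/-- Exponents in the module have total weight at least -∑ c_j. This supplies the bound E that stops
the induction in `IsRegIn.sub_algebraMap`. -/
theorem eq_zero_of_mem_charSpan {v : Fin K → Fin 3 → ℤ} {c : Fin K → ℤ}
    {f : GroupAlg 𝕜 (Fin 3 → ℤ)} (hf : f ∈ charSpan 𝕜 v c) {e : ℤ} (he : ∑ j, c j < e)
    (h : LowerBound (-totalWeight v) e f) : f = 0 := by
  ext m
  by_contra hne
  have hm := Finsupp.mem_support_iff.2 hne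
  have h1 := h m hm
  have h2 : ∑ j, -c j ≤ ∑ j, m (v j) := Finset.sum_le_sum fun j _ => hf j m hm
  rw [map_neg, totalWeight, map_sum] at h1
  rw [Finset.sum_neg_distrib] at h2
  omega

theorem coe_toric_smul {b : ι → ℤ} (r : toricSubalgebra 𝕜 n) (u : toricSubmodule 𝕜 n b) :
    ((r • u : toricSubmodule 𝕜 n b) : GroupAlg 𝕜 (Fin 3 → ℤ)) =
      (r : GroupAlg 𝕜 (Fin 3 → ℤ)) * (u : GroupAlg 𝕜 (Fin 3 → ℤ)) := rfl

theorem IsRegIn.isRegTriple (hg : IsFrame n g) {b : ι → ℤ} (hb : IsCompatible n b)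
    {x y z : toricSubalgebra 𝕜 n}
    (h : IsRegIn (charSpan 𝕜 (fun j => n (g j)) fun j => b (g j))
      (x : GroupAlg 𝕜 (Fin 3 → ℤ)) y z) :
    IsRegTriple (toricSubalgebra 𝕜 n) (toricSubmodule 𝕜 n b) x y z := by
  have hmem : ∀ u : toricSubmodule 𝕜 n b,
      (u : GroupAlg 𝕜 (Fin 3 → ℤ)) ∈ charSpan 𝕜 (fun j => n (g j)) fun j => b (g j) := fun u =>
    (hg.mem_toricSubmodule_iff hb).1 u.2
  refine ⟨fun u hu => ?_, fun u u' hu => ?_, fun u u' u'' hu => ?_⟩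
  · have h1 : (x : GroupAlg 𝕜 (Fin 3 → ℤ)) * (u : GroupAlg 𝕜 (Fin 3 → ℤ)) = 0 := by
      rw [← coe_toric_smul, hu]; rfl
    exact Subtype.ext ((mul_eq_zero.1 h1).resolve_left h.fst)
  · have h1 : (y : GroupAlg 𝕜 (Fin 3 → ℤ)) * (u : GroupAlg 𝕜 (Fin 3 → ℤ)) =
        (x : GroupAlg 𝕜 (Fin 3 → ℤ)) * (u' : GroupAlg 𝕜 (Fin 3 → ℤ)) := by
      rw [← coe_toric_smul, ← coe_toric_smul, hu]
    obtain ⟨w, hw, hw'⟩ := h.snd _ (hmem u) _ (hmem u') h1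
    exact ⟨⟨w, (hg.mem_toricSubmodule_iff hb).2 hw⟩, Subtype.ext hw'⟩
  · have h1 : (z : GroupAlg 𝕜 (Fin 3 → ℤ)) * (u : GroupAlg 𝕜 (Fin 3 → ℤ)) =
        (x : GroupAlg 𝕜 (Fin 3 → ℤ)) * (u' : GroupAlg 𝕜 (Fin 3 → ℤ)) +
          (y : GroupAlg 𝕜 (Fin 3 → ℤ)) * (u'' : GroupAlg 𝕜 (Fin 3 → ℤ)) := by
      rw [← coe_toric_smul, ← coe_toric_smul, ← coe_toric_smul, hu, Submodule.coe_add]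
    obtain ⟨w, hw, w', hw', h'⟩ := h.trd _ (hmem u) _ (hmem u') _ (hmem u'') h1
    exact ⟨⟨w, (hg.mem_toricSubmodule_iff hb).2 hw⟩, ⟨w', (hg.mem_toricSubmodule_iff hb).2 hw'⟩,
      Subtype.ext h'⟩

/-- If no sign sequence alternates, then finite direct sums of the modules are Cohen–Macaulay. -/
theorem IsFrame.isCohenMacaulay [IsAlgClosed 𝕜] [CharZero 𝕜] [Finite ι] (hg : IsFrame n g)
    {I : Type*} [Finite I] (b : I → ι → ℤ) (hb : ∀ i, IsCompatible n (b i))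
    (halt : ∀ i, ∀ m : Module.Dual ℤ (Fin 3 → ℤ),
      NoAlternation fun j => m (n (g j)) < -b i (g j))
    {X : Type*} [AddCommGroup X] [Module (toricSubalgebra 𝕜 n) X]
    (e : X ≃ₗ[toricSubalgebra 𝕜 n] ∀ i, toricSubmodule 𝕜 n (b i)) :
    IsCohenMacaulay (toricSubalgebra 𝕜 n) X := by
  have hn : ∀ m : Module.Dual ℤ (Fin 3 → ℤ), (∀ i, m (n i) = 0) → m = 0 := fun m => hg.eq_zero
  have := toricSubalgebra_isNoetherianRing (𝕜 := 𝕜) n hn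
  have := toricSubalgebra_finiteType (𝕜 := 𝕜) n hn
  have := fun i => toricSubmodule_finite (𝕜 := 𝕜) n (b i)
  have : Module.Finite (toricSubalgebra 𝕜 n) X := Module.Finite.equiv e.symm
  refine isCohenMacaulay_of_isRegTriple (fun p _ => ringKrullDim_localization_toric_le n hn p)
    fun p _ => ?_
  set v := fun j => n (g j) with hv
  let x : toricSubalgebra 𝕜 n := ⟨xPar 𝕜 v, hg.mem_toricSubalgebra_iff.2 hg.convex.xPar_mem⟩
  let y : toricSubalgebra 𝕜 n := ⟨yPar 𝕜 v, hg.mem_toricSubalgebra_iff.2 hg.convex.yPar_mem⟩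
  let z : toricSubalgebra 𝕜 n := ⟨zPar 𝕜 v, hg.mem_toricSubalgebra_iff.2 hg.convex.zPar_mem⟩
  -- One homogeneous sequence serves all maximal ideals: p contains its translates by suitable
  -- scalars.
  obtain ⟨r₁, h₁⟩ := exists_sub_algebraMap_mem (𝕜 := 𝕜) p x
  obtain ⟨r₂, h₂⟩ := exists_sub_algebraMap_mem (𝕜 := 𝕜) p y
  obtain ⟨r₃, h₃⟩ := exists_sub_algebraMap_mem (𝕜 := 𝕜) p z
  refine ⟨_, h₁, _, h₂, _, h₃, ?_⟩
  refine IsRegTriple.of_retract (V := X) (V' := ∀ i, toricSubmodule 𝕜 n (b i))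
    (IsRegTriple.pi fun i => ?_) (e : X →ₗ[toricSubalgebra 𝕜 n] _)
    (e.symm : _ →ₗ[toricSubalgebra 𝕜 n] X) e.symm_apply_apply
  refine IsRegIn.isRegTriple hg (hb i) ?_
  exact (hg.convex.isRegIn (𝕜 := 𝕜) _ (halt i)).sub_algebraMap hg.convex.xPar_mem
    hg.convex.yPar_mem hg.convex.zPar_mem hg.convex.parDegree_pos (isHomog_xPar v)
    (isHomog_yPar v) (isHomog_zPar v) (fun f hf e he h => eq_zero_of_mem_charSpan hf he h)
    (exists_lowerBound _) r₁ r₂ r₃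

end Frame

/-! ### The vertex of the toric variety -/

section Vertex

variable {𝕜 : Type*} [Field 𝕜] {K : ℕ} {v : Fin K → Fin 3 → ℤ}

/-- Restriction of functions to the face of the dual cone on which `w` vanishes. -/
noncomputable def faceHom (v : Fin K → Fin 3 → ℤ) (w : Fin 3 → ℤ)
    (hw : ∀ m ∈ dualMonoid v, 0 ≤ m w) : toricSubalgebra 𝕜 v →+* GroupAlg 𝕜 (Fin 3 → ℤ) where
  toFun f := part w 0 f
  map_one' := IsHomog.part_eq (by
    have h := isHomog_single w (0 : Module.Dual ℤ (Fin 3 → ℤ)) (1 : 𝕜)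
    rw [LinearMap.zero_apply] at h
    exact h)
  map_zero' := map_zero _
  map_add' f g := map_add _ _ _
  map_mul' f g := by
    have hf : LowerBound w 0 (f : GroupAlg 𝕜 (Fin 3 → ℤ)) := fun m hm => hw m (f.2 m hm)
    have hg : LowerBound w 0 (g : GroupAlg 𝕜 (Fin 3 → ℤ)) := fun m hm => hw m (g.2 m hm)
    exact hf.part_mul hg

/-- The prime ideal of functions that vanish on the face of the dual cone cut out by `w`. -/
noncomputable def faceIdeal (𝕜 : Type*) [Field 𝕜] (v : Fin K → Fin 3 → ℤ) (w : Fin 3 → ℤ)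
    (hw : ∀ m ∈ dualMonoid v, 0 ≤ m w) : Ideal (toricSubalgebra 𝕜 v) :=
  RingHom.ker (faceHom v w hw)

instance (w : Fin 3 → ℤ) (hw : ∀ m ∈ dualMonoid v, 0 ≤ m w) : (faceIdeal 𝕜 v w hw).IsPrime :=
  RingHom.ker_isPrime _

theorem mem_faceIdeal {w : Fin 3 → ℤ} {hw : ∀ m ∈ dualMonoid v, 0 ≤ m w}
    {f : toricSubalgebra 𝕜 v} :
    f ∈ faceIdeal 𝕜 v w hw ↔ ∀ m ∈ (f : GroupAlg 𝕜 (Fin 3 → ℤ)).coeff.support, 0 < m w := by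
  rw [faceIdeal, RingHom.mem_ker]
  change part w 0 (f : GroupAlg 𝕜 (Fin 3 → ℤ)) = 0 ↔ _
  refine ⟨fun h m hm => ?_, fun h => part_eq_zero fun m hm => (h m hm).ne'⟩
  refine lt_of_le_of_ne (hw m (f.2 m hm)) fun h0 => ?_
  have h1 := coeff_part_of_eq (w := w) (d := 0) (f : GroupAlg 𝕜 (Fin 3 → ℤ)) h0.symm
  rw [h] at h1
  exact Finsupp.mem_support_iff.1 hm h1.symm

/-- A character of the dual cone as an element of the toric ring. -/
noncomputable def toricChi (𝕜 : Type*) [Field 𝕜] {v : Fin K → Fin 3 → ℤ}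
    (m : Module.Dual ℤ (Fin 3 → ℤ)) (hm : m ∈ dualMonoid v) : toricSubalgebra 𝕜 v :=
  ⟨chi 𝕜 m, single_mem_toricSubalgebra hm 1⟩

theorem toricChi_mem_faceIdeal {w : Fin 3 → ℤ} {hw : ∀ m ∈ dualMonoid v, 0 ≤ m w}
    {m : Module.Dual ℤ (Fin 3 → ℤ)} (hm : m ∈ dualMonoid v) :
    toricChi 𝕜 m hm ∈ faceIdeal 𝕜 v w hw ↔ 0 < m w := by
  classical
  rw [mem_faceIdeal]
  simp [toricChi, chi]

theorem totalWeight_nonneg (m : Module.Dual ℤ (Fin 3 → ℤ)) (hm : m ∈ dualMonoid v) :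
    0 ≤ m (totalWeight v) := by
  rw [totalWeight, map_sum]
  exact Finset.sum_nonneg fun j _ => hm j

/-- The ideal of the torus-fixed point. -/
noncomputable abbrev vertexIdeal (𝕜 : Type*) [Field 𝕜] (v : Fin K → Fin 3 → ℤ) :
    Ideal (toricSubalgebra 𝕜 v) :=
  faceIdeal 𝕜 v (totalWeight v) totalWeight_nonneg

theorem IsConvexList.mem_vertexIdeal (hv : IsConvexList v) {f : toricSubalgebra 𝕜 v} :
    f ∈ vertexIdeal 𝕜 v ↔ (f : GroupAlg 𝕜 (Fin 3 → ℤ)).coeff 0 = 0 := by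
  rw [mem_faceIdeal]
  constructor
  · intro h
    by_contra hne
    simpa using h 0 (Finsupp.mem_support_iff.2 hne)
  · intro h m hm
    refine hv.totalWeight_pos (f.2 m hm) fun h0 => ?_
    rw [h0] at hm
    exact Finsupp.mem_support_iff.1 hm h

theorem IsConvexList.vertexIdeal_isMaximal (hv : IsConvexList v) :
    (vertexIdeal 𝕜 v).IsMaximal := by
  rw [Ideal.isMaximal_iff]
  refine ⟨fun h => (vertexIdeal 𝕜 v).one_notMem h, fun J f hJ hf hfJ => ?_⟩
  rw [hv.mem_vertexIdeal] at hf
  set c := (f : GroupAlg 𝕜 (Fin 3 → ℤ)).coeff 0 with hc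
  have h1 : f - algebraMap 𝕜 (toricSubalgebra 𝕜 v) c ∈ vertexIdeal 𝕜 v := by
    rw [hv.mem_vertexIdeal]
    change (((f : GroupAlg 𝕜 (Fin 3 → ℤ)) - algebraMap 𝕜 (GroupAlg 𝕜 (Fin 3 → ℤ)) c)).coeff 0 = 0
    rw [AddMonoidAlgebra.coeff_sub, AddMonoidAlgebra.coe_algebraMap]
    simp [hc]
  have h2 : algebraMap 𝕜 (toricSubalgebra 𝕜 v) c ∈ J := by
    have := J.sub_mem hfJ (hJ h1)
    simpa using this
  have h3 := J.mul_mem_left (algebraMap 𝕜 (toricSubalgebra 𝕜 v) c⁻¹) h2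
  rwa [← map_mul, inv_mul_cancel₀ hf, map_one] at h3

theorem edge_mem_dualMonoid (hv : IsConvexList v) (i : Fin K) : edge v i ∈ dualMonoid v :=
  fun j => hv.edge_nonneg i j

theorem scaledEdge_mem_dualMonoid (hv : IsConvexList v) (i : Fin K) :
    scaledEdge v i ∈ dualMonoid v :=
  fun j => hv.scaledEdge_nonneg i j

/-- A flag of faces of the dual cone (the facet where v_i vanishes, the ray where v_i and v_j
vanish, the vertex) gives a chain of primes above ⊥, and edge characters witness that it is strict.
-/
theorem IsConvexList.three_le_height (hv : IsConvexList v) : 3 ≤ (vertexIdeal 𝕜 v).height := by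
  have hK := hv.three_le
  let i : Fin K := ⟨0, by omega⟩
  obtain ⟨h, hh⟩ := exists_nxt_eq i
  let j := nxt i
  have hhj : h ≠ j := fun e => hv.nxt_nxt_ne i (by rw [← show h = nxt i from e, hh])
  have hw₁ : ∀ m ∈ dualMonoid v, 0 ≤ m (v i) := fun m hm => hm i
  have hw₂ : ∀ m ∈ dualMonoid v, 0 ≤ m (v i + v j) := fun m hm => by
    rw [map_add]; exact add_nonneg (hm i) (hm j)
  let P₁ := faceIdeal 𝕜 v (v i) hw₁
  let P₂ := faceIdeal 𝕜 v (v i + v j) hw₂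
  have h01 : ⊥ < P₁ := by
    rw [bot_lt_iff_ne_bot]
    intro h0
    have h1 : toricChi 𝕜 _ (edge_mem_dualMonoid hv j) ∈ P₁ :=
      (toricChi_mem_faceIdeal _).2 (hv.edge_pos (hv.nxt_ne i).symm (hv.nxt_nxt_ne i).symm)
    rw [h0, Ideal.mem_bot] at h1
    exact chi_ne_zero (𝕜 := 𝕜) (edge v j) (congrArg Subtype.val h1)
  have h12 : P₁ < P₂ := by
    refine SetLike.lt_iff_le_and_exists.2 ⟨fun f hf => ?_, toricChi 𝕜 _ (edge_mem_dualMonoid hv h),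
      (toricChi_mem_faceIdeal _).2 ?_, fun h1 => ?_⟩
    · rw [mem_faceIdeal] at hf ⊢
      intro m hm
      rw [map_add]
      exact add_pos_of_pos_of_nonneg (hf m hm) (f.2 m hm j)
    · rw [map_add, ← hh, edge_nxt, zero_add]
      exact hv.edge_pos hhj.symm (by rw [hh]; exact hv.nxt_ne i)
    · have := (toricChi_mem_faceIdeal _).1 h1
      rw [← hh, edge_nxt] at this
      exact lt_irrefl _ this
  have h23 : P₂ < vertexIdeal 𝕜 v := by
    refine SetLike.lt_iff_le_and_exists.2 ⟨fun f hf => ?_, toricChi 𝕜 _ (edge_mem_dualMonoid hv i),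
      (toricChi_mem_faceIdeal _).2 (hv.edge_totalWeight_pos i), fun h1 => ?_⟩
    · rw [mem_faceIdeal] at hf ⊢
      intro m hm
      refine hv.totalWeight_pos (f.2 m hm) fun h0 => ?_
      have := hf m hm
      rw [h0] at this
      simp at this
    · have := (toricChi_mem_faceIdeal _).1 h1
      rw [map_add, edge_self, edge_nxt] at this
      simp at this
  have hb : (⊥ : Ideal (toricSubalgebra 𝕜 v)).IsPrime := Ideal.isPrime_bot
  have e1 := Ideal.height_add_one_le_of_lt_of_isPrime h01
  have e2 := Ideal.height_add_one_le_of_lt_of_isPrime h12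
  have e3 := Ideal.height_add_one_le_of_lt_of_isPrime h23
  rw [Ideal.height_bot, zero_add] at e1
  calc (3 : ℕ∞) = 1 + 1 + 1 := by norm_num
    _ ≤ P₁.height + 1 + 1 := by gcongr
    _ ≤ P₂.height + 1 := by gcongr
    _ ≤ _ := e3

theorem IsConvexList.weightSet_nonempty (hv : IsConvexList v) (b : Fin K → ℤ) :
    ∃ m, m ∈ weightSet v b := by
  have hK := hv.three_le
  let a := ∑ i, edge v i
  have ha : ∀ j, 0 < a (v j) := by
    intro j
    simp only [a, LinearMap.sum_apply]
    obtain ⟨i, rfl⟩ := exists_nxt_eq j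
    obtain ⟨i, rfl⟩ := exists_nxt_eq i
    exact Finset.sum_pos' (fun i _ => hv.edge_nonneg i _)
      ⟨_, Finset.mem_univ _, hv.exists_edge_pos i⟩
  refine ⟨(∑ j, (b j).natAbs : ℕ) • a, fun j => ?_⟩
  rw [LinearMap.smul_apply, nsmul_eq_mul]
  have h2 : (b j).natAbs ≤ ∑ j, (b j).natAbs :=
    Finset.single_le_sum (f := fun j => (b j).natAbs) (fun _ _ => Nat.zero_le _)
      (Finset.mem_univ j)
  have h3 : -b j ≤ ((∑ j, (b j).natAbs : ℕ) : ℤ) := by omega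
  have := ha j
  nlinarith

/-- The powers of the edge characters generate an ideal primary to the vertex ideal. -/
theorem IsConvexList.vertexIdeal_le_radical (hv : IsConvexList v) (r : ℕ) :
    vertexIdeal 𝕜 v ≤ (Ideal.span (Set.range fun i =>
      toricChi 𝕜 _ (scaledEdge_mem_dualMonoid hv i) ^ r)).radical := by
  intro f hf
  rw [Ideal.radical_eq_sInf, Submodule.mem_sInf]
  rintro (q : Ideal (toricSubalgebra 𝕜 v)) ⟨hle, hq⟩
  have hs : ∀ i, toricChi 𝕜 _ (scaledEdge_mem_dualMonoid hv i) ∈ q := fun i =>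
    hq.mem_of_pow_mem r (hle (Ideal.subset_span ⟨i, rfl⟩))
  have hm : ∀ m (hm : m ∈ dualMonoid v), m ≠ 0 → toricChi 𝕜 m hm ∈ q := by
    intro m hm hm0
    -- The zeros of m lie among the ends of one edge i, so a multiple of m dominates the equation of
    -- that edge.
    obtain ⟨i, hi⟩ := hv.exists_edge_of_ne_zero hm hm0
    obtain ⟨t, ht⟩ := exists_nsmul_sub_nonneg v (a := m) (m := scaledEdge v i) hm fun j hj => by
      rcases hi j hj with rfl | rfl
      · rw [scaledEdge_self]
      · rw [scaledEdge_nxt]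
    refine hq.mem_of_pow_mem t ?_
    have : toricChi 𝕜 m hm ^ t =
        toricChi 𝕜 _ (scaledEdge_mem_dualMonoid hv i) * toricChi 𝕜 _ ht := by
      apply Subtype.ext
      simp only [toricChi, SubmonoidClass.coe_pow, MulMemClass.coe_mul, chi_pow, chi_mul_chi]
      congr 1; abel
    rw [this]
    exact q.mul_mem_right _ (hs i)
  have hsum : f = ∑ m ∈ (f : GroupAlg 𝕜 (Fin 3 → ℤ)).coeff.support.attach,
      algebraMap 𝕜 _ ((f : GroupAlg 𝕜 (Fin 3 → ℤ)).coeff m) * toricChi 𝕜 m.1 (f.2 m.1 m.2) := by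
    apply Subtype.ext
    rw [AddSubmonoidClass.coe_finsetSum]
    conv_lhs => rw [← AddMonoidAlgebra.sum_coeff_single (f : GroupAlg 𝕜 (Fin 3 → ℤ)), Finsupp.sum,
      ← Finset.sum_attach]
    refine Finset.sum_congr rfl fun m _ => ?_
    rw [MulMemClass.coe_mul]
    change _ = algebraMap 𝕜 (GroupAlg 𝕜 (Fin 3 → ℤ)) _ * chi 𝕜 m.1
    simp [chi, AddMonoidAlgebra.coe_algebraMap, AddMonoidAlgebra.single_mul_single]
  rw [hsum]
  refine Ideal.sum_mem _ fun m _ => q.mul_mem_left _ (hm _ _ fun h0 => ?_)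
  have := m.2
  rw [h0] at this
  exact Finsupp.mem_support_iff.1 this (hv.mem_vertexIdeal.1 hf)

end Vertex

/-! ### Splitting elements along a Cohen–Macaulay module -/

section Split

variable {R L X : Type*} [CommRing R] [AddCommGroup L] [Module R L] [AddCommGroup X] [Module R X]

/-- A module with a torsion-free element has at least the dimension of the ring. -/
theorem le_supportDim_localizedModule [IsDomain R] (p : Ideal R) [p.IsPrime] {x : X}
    (hx : ∀ r : R, r • x = 0 → r = 0) {d : ℕ∞} (hd : d ≤ p.height) :
    (d : WithBot ℕ∞) ≤
      Module.supportDim (Localization.AtPrime p) (LocalizedModule p.primeCompl X) := by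
  let φ : Localization.AtPrime p →ₗ[Localization.AtPrime p] LocalizedModule p.primeCompl X :=
    LinearMap.toSpanSingleton _ _ (LocalizedModule.mk x 1)
  have hφ : Function.Injective φ := by
    rw [injective_iff_map_eq_zero]
    intro r hr
    induction r using Localization.induction_on with | _ y
    obtain ⟨a, s⟩ := y
    rw [LinearMap.toSpanSingleton_apply, LocalizedModule.mk_smul_mk, ← LocalizedModule.zero_mk 1,
      LocalizedModule.mk_eq] at hr
    obtain ⟨t, ht⟩ := hr
    simp only [smul_zero, one_smul, Submonoid.smul_def] at ht
    rw [smul_smul] at ht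
    have ht0 : (t : R) ≠ 0 := fun h0 => t.2 (by rw [h0]; exact zero_mem _)
    rw [(mul_eq_zero.1 (hx _ ht)).resolve_left ht0, Localization.mk_zero]
  refine le_trans ?_ (Module.supportDim_le_of_injective φ hφ)
  rw [Module.supportDim_self_eq_ringKrullDim, IsLocalization.AtPrime.ringKrullDim_eq_height p]
  exact WithBot.coe_le_coe.2 hd

/-- The localization of a submodule, inside the localization of the module. -/
noncomputable def localizedRange (S : Submonoid R) (V : Submodule R L) :
    Submodule (Localization S) (LocalizedModule S L) :=
  LinearMap.range (LocalizedModule.map S V.subtype)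

theorem mk_mem_localizedRange {S : Submonoid R} {V : Submodule R L} {l : L} {s : S} :
    LocalizedModule.mk l s ∈ localizedRange S V ↔ ∃ u : S, u • l ∈ V := by
  constructor
  · rintro ⟨w, hw⟩
    induction w with | _ a t
    rw [LocalizedModule.map_mk, LocalizedModule.mk_eq] at hw
    obtain ⟨u, hu⟩ := hw
    refine ⟨u * t, ?_⟩
    rw [mul_smul, ← hu]
    exact V.smul_mem _ (V.smul_mem _ a.2)
  · rintro ⟨u, hu⟩
    refine ⟨LocalizedModule.mk ⟨u • l, hu⟩ (u * s), ?_⟩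
    rw [LocalizedModule.map_mk, LocalizedModule.mk_eq]
    refine ⟨1, ?_⟩
    simp only [one_smul, Submodule.coe_subtype]
    rw [smul_smul, mul_comm]

/-- Localization preserves retracts. The localized submodule is kept inside the localization of L,
where `IsRegTriple.exists_add` can divide. -/
theorem IsRegTriple.localizedRange_of_retract {S : Submonoid R} {V : Submodule R L}
    {x y z : Localization S} (h : IsRegTriple (Localization S) (LocalizedModule S X) x y z)
    (i : V →ₗ[R] X) (p : X →ₗ[R] V) (hip : ∀ a, p (i a) = a) :
    IsRegTriple (Localization S) (localizedRange S V) x y z := by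
  have hinj : Function.Injective (LocalizedModule.map S V.subtype) :=
    LocalizedModule.map_injective S _ V.injective_subtype
  let e : LocalizedModule S V ≃ₗ[Localization S] localizedRange S V :=
    LinearEquiv.ofInjective _ hinj
  refine h.of_retract (LocalizedModule.map S i ∘ₗ e.symm.toLinearMap)
    (e.toLinearMap ∘ₗ LocalizedModule.map S p) fun a => ?_
  obtain ⟨a, rfl⟩ := e.surjective a
  change e (LocalizedModule.map S p (LocalizedModule.map S i (e.symm (e a)))) = e a
  rw [e.symm_apply_apply]
  congr 1
  induction a with | _ a t
  rw [LocalizedModule.map_mk, LocalizedModule.map_mk, hip]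

/-- V is torsion-free and 𝔪 has height at least three, so X has a regular triple at 𝔪, which its
retract V inherits. `IsRegTriple.exists_add` splits f in the localization, and q is the common
denominator. -/
theorem IsCohenMacaulay.exists_split [IsDomain R] [IsNoetherianRing R] {V : Submodule R L}
    (hX : IsCohenMacaulay R X) (i : V →ₗ[R] X) (p : X →ₗ[R] V) (hip : ∀ a, p (i a) = a)
    (hL : ∀ (r : R) (l : L), r • l = 0 → r = 0 ∨ l = 0) (hV : ∃ v : V, v ≠ 0)
    (𝔪 : Ideal R) [𝔪.IsMaximal] (hht : 3 ≤ 𝔪.height) (J₁ J₂ : Ideal R)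
    (hJ : 𝔪 ≤ (J₁ ⊔ J₂).radical) (f : L) (hf : ∀ d ∈ J₁, ∀ e ∈ J₂, (d * e) • f ∈ V)
    {d e : R} (hd : d ∈ J₁) (he : e ∈ J₂) (hd0 : d ≠ 0) (hdL : ∀ l : L, ∃ l', d • l' = l) :
    ∃ q ∉ 𝔪, ∃ l₁ l₂ : L, q • f = l₁ + l₂ ∧ d • l₁ ∈ V ∧ e • l₂ ∈ V := by
  set S := 𝔪.primeCompl with hS
  have hS0 : ∀ s : S, (s : R) ≠ 0 := fun s h0 => s.2 (by rw [h0]; exact zero_mem _)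
  have hLS : ∀ (s : S) (l : L), s • l = 0 → l = 0 := fun s l h => (hL s l h).resolve_left (hS0 s)
  obtain ⟨v₀, hv₀⟩ := hV
  have hinj : Function.Injective i := Function.LeftInverse.injective hip
  have hdim := le_supportDim_localizedModule 𝔪 (x := i v₀) (fun r hr => by
    rw [← map_smul] at hr
    have h1 : r • v₀ = 0 := hinj (by rw [hr, map_zero])
    exact (hL r v₀ (congrArg Subtype.val h1)).resolve_right fun h => hv₀ (Subtype.ext h)) hht
  obtain ⟨x, y, z, hx, hy, hz, hreg⟩ := hX.exists_isRegTriple 𝔪 hdim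
  have := hX.1
  have hfin : Module.Finite (Localization.AtPrime 𝔪) (LocalizedModule 𝔪.primeCompl X) :=
    Module.Finite.of_isLocalizedModule 𝔪.primeCompl (LocalizedModule.mkLinearMap 𝔪.primeCompl X)
  have hnoeth : IsNoetherianRing (Localization.AtPrime 𝔪) :=
    IsLocalization.isNoetherianRing 𝔪.primeCompl _ inferInstance
  -- The power 𝔪^N lies in J₁ + J₂. The exponent N + 1 is used below because N may be zero.
  obtain ⟨N, hN⟩ := Ideal.exists_pow_le_of_le_radical_of_fg hJ (IsNoetherian.noetherian 𝔪)
  have hreg' : IsRegTriple (Localization.AtPrime 𝔪) (localizedRange S V) (x ^ (N + 1)) (y ^ (N + 1))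
      (z ^ (N + 1)) :=
    (hreg.pow hx hy hz N.succ_ne_zero).localizedRange_of_retract i p hip
  let A := Localization.AtPrime 𝔪
  let I (J : Ideal R) : Ideal A := J.map (algebraMap R A)
  have hmem : ∀ w ∈ IsLocalRing.maximalIdeal A, w ^ (N + 1) ∈ I J₁ ⊔ I J₂ := by
    intro w hw
    have h1 : w ^ (N + 1) ∈ IsLocalRing.maximalIdeal A ^ (N + 1) := Ideal.pow_mem_pow hw _
    rw [← Localization.AtPrime.map_eq_maximalIdeal, ← Ideal.map_pow] at h1
    rw [← Ideal.map_sup]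
    exact Ideal.map_mono ((Ideal.pow_le_pow_right N.le_succ).trans hN) h1
  have hsmul : ∀ (r : R) (l : L) (s : S),
      algebraMap R A r • LocalizedModule.mk l s = LocalizedModule.mk (r • l) s := by
    intro r l s
    rw [algebraMap_smul, LocalizedModule.smul'_mk]
  have hfI : ∀ d ∈ I J₁, ∀ e ∈ I J₂,
      (d * e) • (LocalizedModule.mk f 1 : LocalizedModule S L) ∈ localizedRange S V := by
    intro d hd e he
    let T : Ideal A := (localizedRange S V).comap
      (LinearMap.toSpanSingleton A (LocalizedModule S L) (LocalizedModule.mk f 1))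
    suffices h : I (J₁ * J₂) ≤ T by
      have h1 : d * e ∈ I (J₁ * J₂) := by
        rw [show I (J₁ * J₂) = I J₁ * I J₂ from Ideal.map_mul _ _ _]
        exact Ideal.mul_mem_mul hd he
      exact h h1
    simp only [I]
    rw [Ideal.map_le_iff_le_comap, Ideal.mul_le]
    intro a ha b hb
    change algebraMap R A (a * b) • (LocalizedModule.mk f 1 : LocalizedModule S L) ∈
      localizedRange S V
    rw [hsmul]
    exact mk_mem_localizedRange.2 ⟨1, by rw [one_smul]; exact hf a ha b hb⟩
  have hxW : ∀ w : LocalizedModule S L, x ^ (N + 1) • w = 0 → w = 0 := by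
    have hx0 : x ^ (N + 1) ≠ 0 := by
      intro h0
      have h1 := hreg'.fst ⟨LocalizedModule.mk (v₀ : L) 1,
        mk_mem_localizedRange.2 ⟨1, by rw [one_smul]; exact v₀.2⟩⟩ (by rw [h0, zero_smul])
      have h2 := congrArg Subtype.val h1
      change (LocalizedModule.mk (v₀ : L) 1 : LocalizedModule S L) = 0 at h2
      rw [← LocalizedModule.zero_mk 1, LocalizedModule.mk_eq] at h2
      obtain ⟨u, hu⟩ := h2
      simp only [smul_zero, one_smul] at hu
      exact hv₀ (Subtype.ext (hLS _ _ hu))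
    generalize x ^ (N + 1) = c at hx0
    intro w hw
    induction w with | _ l t
    induction c using Localization.induction_on with | _ c
    obtain ⟨a, s⟩ := c
    rw [LocalizedModule.mk_smul_mk, ← LocalizedModule.zero_mk 1, LocalizedModule.mk_eq] at hw
    obtain ⟨u, hu⟩ := hw
    simp only [smul_zero, one_smul] at hu
    rcases hL _ _ (hLS _ _ hu) with rfl | rfl
    · exact absurd (Localization.mk_zero _) hx0
    · exact LocalizedModule.zero_mk _
  obtain ⟨f₁, f₂, hfe, h₁, h₂⟩ := hreg'.exists_add (I J₁) (I J₂) (hmem x hx) (hmem y hy) (hmem z hz)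
    hxW (LocalizedModule.mk f 1) hfI (algebraMap R A d) (Ideal.mem_map_of_mem _ hd)
    (fun w hw => by
      induction w with | _ l t
      rw [hsmul, ← LocalizedModule.zero_mk 1, LocalizedModule.mk_eq] at hw
      obtain ⟨u, hu⟩ := hw
      simp only [smul_zero, one_smul] at hu
      rw [(hL _ _ (hLS _ _ hu)).resolve_left hd0, LocalizedModule.zero_mk])
    (fun w => by
      induction w with | _ l t
      obtain ⟨l', hl'⟩ := hdL l
      exact ⟨LocalizedModule.mk l' t, by rw [hsmul, hl']⟩)
  have h₁ := h₁ _ (Ideal.mem_map_of_mem _ hd)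
  have h₂ := h₂ _ (Ideal.mem_map_of_mem _ he)
  induction f₁ with | _ l₁ t₁
  induction f₂ with | _ l₂ t₂
  rw [hsmul, mk_mem_localizedRange] at h₁ h₂
  obtain ⟨u₁, h₁⟩ := h₁
  obtain ⟨u₂, h₂⟩ := h₂
  rw [LocalizedModule.mk_add_mk, LocalizedModule.mk_eq] at hfe
  obtain ⟨u, hu⟩ := hfe
  rw [one_smul] at hu
  -- Here t₁, t₂ are the denominators, u realizes the equality of fractions, and u₁, u₂ bring the
  -- multiplied numerators into V.
  refine ⟨(u₁ * u₂ * u * (t₁ * t₂) : S), (u₁ * u₂ * u * (t₁ * t₂) : S).2,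
    (u₁ * u₂ * u * t₂ : S) • l₁,
    (u₁ * u₂ * u * t₁ : S) • l₂, ?_, ?_, ?_⟩
  · change (u₁ * u₂ * u * (t₁ * t₂) : S) • f = _
    simp only [mul_smul] at hu ⊢
    rw [hu]
    simp only [smul_add]
  · rw [smul_comm, show u₁ * u₂ * u * t₂ = (u₂ * u * t₂) * u₁ by ac_rfl, mul_smul]
    exact V.smul_mem _ h₁
  · rw [smul_comm, show u₁ * u₂ * u * t₁ = (u₁ * u * t₁) * u₂ by ac_rfl, mul_smul]
    exact V.smul_mem _ h₂

end Split

/-! ### Necessity of the sign criterion -/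

section Necessity

variable {𝕜 : Type*} [Field 𝕜] {K : ℕ} {v : Fin K → Fin 3 → ℤ} {b : Fin K → ℤ}

/-- The edges inside a cyclic interval and those outside meet only at its end points. -/
theorem nxt_mem_endpoints {p q i j l : Fin K} (hi : p ≤ i ∧ i < q) (hj : ¬ (p ≤ j ∧ j < q))
    (hil : l = i ∨ l = nxt i) (hjl : l = j ∨ l = nxt j) : l = p ∨ l = q := by
  have h1 : (i : ℕ) + 1 < K := by have := q.2; omega
  have h2 := nxt_val_of_lt h1
  have h3 : (j : ℕ) + 1 < K ∧ (nxt j : ℕ) = j + 1 ∨ ¬ (j : ℕ) + 1 < K ∧ (nxt j : ℕ) = 0 := by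
    by_cases h : (j : ℕ) + 1 < K
    · exact .inl ⟨h, nxt_val_of_lt h⟩
    · exact .inr ⟨h, nxt_val_of_not_lt h⟩
  simp only [Fin.ext_iff, Fin.le_def, Fin.lt_def] at *
  have := q.2
  have := j.2
  omega

theorem toricChi_pow_smul (hv : IsConvexList v) (i : Fin K) (r : ℕ)
    (f : GroupAlg 𝕜 (Fin 3 → ℤ)) :
    toricChi 𝕜 _ (scaledEdge_mem_dualMonoid hv i) ^ r • f = chi 𝕜 (r • scaledEdge v i) * f := by
  rw [toric_smul_def, SubmonoidClass.coe_pow]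
  simp only [toricChi, chi_pow]

/-- The character of the edge i has order zero along v_i, so the product with its power already
bounds the exponents of l there. -/
theorem coeff_eq_zero_of_toricChi_pow_smul_mem (hv : IsConvexList v) {i : Fin K} {r : ℕ}
    {l : GroupAlg 𝕜 (Fin 3 → ℤ)}
    (hl : toricChi 𝕜 _ (scaledEdge_mem_dualMonoid hv i) ^ r • l ∈ toricSubmodule 𝕜 v b)
    {m : Module.Dual ℤ (Fin 3 → ℤ)} (hm : m (v i) < -b i) : l.coeff m = 0 := by
  rw [toricChi_pow_smul hv, mem_toricSubmodule_iff] at hl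
  have h1 := hl i
  have h2 : (r • scaledEdge v i) (v i) = 0 := by
    rw [LinearMap.smul_apply, scaledEdge_self, smul_zero]
  rw [← add_zero (-b i), ← h2, lowerBound_chi_mul] at h1
  by_contra hne
  exact absurd (h1 m (Finsupp.mem_support_iff.2 hne)) (not_le.2 hm)

/-- The satisfied vertices p and q cut the boundary into two arcs, each containing a violated
vertex. Their edges define two open sets covering the punctured spectrum, and χ^m is a section over
the intersection that cannot be split. -/
theorem not_isCohenMacaulay_of_arc (hv : IsConvexList v) {X : Type*} [AddCommGroup X]
    [Module (toricSubalgebra 𝕜 v) X] (hX : IsCohenMacaulay (toricSubalgebra 𝕜 v) X)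
    (ι : toricSubmodule 𝕜 v b →ₗ[toricSubalgebra 𝕜 v] X)
    (π : X →ₗ[toricSubalgebra 𝕜 v] toricSubmodule 𝕜 v b) (hπ : ∀ a, π (ι a) = a)
    {m : Module.Dual ℤ (Fin 3 → ℤ)} {p q e e' : Fin K} (hp : -b p ≤ m (v p)) (hq : -b q ≤ m (v q))
    (he : p ≤ e ∧ e < q) (he' : ¬ (p ≤ e' ∧ e' < q)) (hme : m (v e) < -b e)
    (hme' : m (v e') < -b e') : False := by
  have hR : IsNoetherianRing (toricSubalgebra 𝕜 v) :=
    toricSubalgebra_isNoetherianRing v fun m hm => hv.eq_zero hm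
  have hmax := hv.vertexIdeal_isMaximal (𝕜 := 𝕜)
  let r : ℕ := ∑ l, (m (v l) + b l).natAbs
  have hr : ∀ l, -b l ≤ r + m (v l) := fun l => by
    have : (m (v l) + b l).natAbs ≤ r := Finset.single_le_sum
      (f := fun l => (m (v l) + b l).natAbs) (fun _ _ => Nat.zero_le _) (Finset.mem_univ l)
    omega
  let t (i : Fin K) : toricSubalgebra 𝕜 v := toricChi 𝕜 _ (scaledEdge_mem_dualMonoid hv i) ^ r
  let J₁ : Ideal (toricSubalgebra 𝕜 v) := Ideal.span (t '' {i | p ≤ i ∧ i < q})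
  let J₂ : Ideal (toricSubalgebra 𝕜 v) := Ideal.span (t '' {i | ¬ (p ≤ i ∧ i < q)})
  have hJ : vertexIdeal 𝕜 v ≤ (J₁ ⊔ J₂).radical := by
    refine (hv.vertexIdeal_le_radical r).trans (Ideal.radical_mono (Ideal.span_le.2 ?_))
    rintro _ ⟨i, rfl⟩
    by_cases hi : p ≤ i ∧ i < q
    · exact Ideal.mem_sup_left (Ideal.subset_span ⟨i, hi, rfl⟩)
    · exact Ideal.mem_sup_right (Ideal.subset_span ⟨i, hi, rfl⟩)
  -- An edge of one arc and an edge of the other share at most the satisfied vertices p and q. At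
  -- any other vertex one of the two characters is positive, and its power r outweighs the
  -- violation.
  have hf : ∀ d ∈ J₁, ∀ d' ∈ J₂, (d * d') • chi 𝕜 m ∈ toricSubmodule 𝕜 v b := by
    let T : Ideal (toricSubalgebra 𝕜 v) := (toricSubmodule 𝕜 v b).comap
      (LinearMap.toSpanSingleton _ _ (chi 𝕜 m))
    suffices h : J₁ * J₂ ≤ T from fun d hd d' hd' => h (Ideal.mul_mem_mul hd hd')
    rw [Ideal.span_mul_span', Ideal.span_le]
    rintro _ ⟨_, ⟨i, hi, rfl⟩, _, ⟨j, hj, rfl⟩, rfl⟩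
    change (t i * t j) • chi 𝕜 m ∈ toricSubmodule 𝕜 v b
    rw [mul_smul, toricChi_pow_smul hv, toricChi_pow_smul hv, chi_mul_chi, chi_mul_chi]
    refine single_mem_toricSubmodule (fun l => ?_) 1
    simp only [LinearMap.add_apply, LinearMap.smul_apply, nsmul_eq_mul]
    have h1 := hv.scaledEdge_nonneg i l
    have h2 := hv.scaledEdge_nonneg j l
    have h3 := hr l
    have h4 : (0 : ℤ) ≤ r := Nat.cast_nonneg r
    by_cases hil : l = i ∨ l = nxt i
    · by_cases hjl : l = j ∨ l = nxt j
      · have h5 : -b l ≤ m (v l) := by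
          rcases nxt_mem_endpoints hi hj hil hjl with rfl | rfl
          · exact hp
          · exact hq
        nlinarith
      · rw [not_or] at hjl
        have := hv.scaledEdge_pos hjl.1 hjl.2
        nlinarith
    · rw [not_or] at hil
      have := hv.scaledEdge_pos hil.1 hil.2
      nlinarith
  obtain ⟨m₀, hm₀⟩ := hv.weightSet_nonempty b
  obtain ⟨c, hc, l₁, l₂, hsum, h₁, h₂⟩ := hX.exists_split ι π hπ
    (fun r l h => (mul_eq_zero.1 h).imp_left fun h0 => Subtype.ext h0)
    ⟨⟨chi 𝕜 m₀, single_mem_toricSubmodule hm₀ 1⟩, fun h =>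
      chi_ne_zero m₀ (congrArg Subtype.val h)⟩
    (vertexIdeal 𝕜 v) hv.three_le_height J₁ J₂ hJ (chi 𝕜 m) hf
    (Ideal.subset_span ⟨e, he, rfl⟩) (Ideal.subset_span ⟨e', he', rfl⟩)
    (pow_ne_zero _ fun h => chi_ne_zero (𝕜 := 𝕜) (scaledEdge v e) (congrArg Subtype.val h))
    (fun l => ⟨chi 𝕜 (-(r • scaledEdge v e)) * l, by
      rw [toricChi_pow_smul hv, ← mul_assoc, chi_mul_chi, add_neg_cancel, chi_zero, one_mul]⟩)
  -- Compare coefficients of χ^m: both summands have none, as m is violated at e and at e', while on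
  -- the left it is the constant coefficient of c, nonzero because c lies outside the vertex ideal.
  have h3 := congrArg (fun g : GroupAlg 𝕜 (Fin 3 → ℤ) => g.coeff m) hsum
  simp only [AddMonoidAlgebra.coeff_add, Finsupp.add_apply] at h3
  rw [coeff_eq_zero_of_toricChi_pow_smul_mem hv h₁ hme,
    coeff_eq_zero_of_toricChi_pow_smul_mem hv h₂ hme', toric_smul_def, mul_comm, coeff_chi_mul,
    sub_self, add_zero] at h3
  exact hc (hv.mem_vertexIdeal.2 h3)

/-- If `𝕜 M_b` is a retract of a Cohen–Macaulay module, then the vertices at which a character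
violates the inequalities of `M_b` form a cyclic interval. -/
theorem IsConvexList.noAlternation (hv : IsConvexList v) {X : Type*} [AddCommGroup X]
    [Module (toricSubalgebra 𝕜 v) X] (hX : IsCohenMacaulay (toricSubalgebra 𝕜 v) X)
    (ι : toricSubmodule 𝕜 v b →ₗ[toricSubalgebra 𝕜 v] X)
    (π : X →ₗ[toricSubalgebra 𝕜 v] toricSubmodule 𝕜 v b) (hπ : ∀ a, π (ι a) = a)
    (m : Module.Dual ℤ (Fin 3 → ℤ)) : NoAlternation fun j => m (v j) < -b j := by
  refine fun x y z w hxy hyz hzw => ⟨fun ⟨h1, h2, h3, h4⟩ => ?_, fun ⟨h1, h2, h3, h4⟩ => ?_⟩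
  · exact not_isCohenMacaulay_of_arc hv hX ι π hπ (not_lt.1 h2) (not_lt.1 h4) ⟨hyz.le, hzw⟩
      (fun h => absurd h.1 (not_le.2 hxy)) h3 h1
  · exact not_isCohenMacaulay_of_arc hv hX ι π hπ (not_lt.1 h1) (not_lt.1 h3) ⟨hxy.le, hyz⟩
      (fun h => absurd h.2 (not_lt.2 hzw.le)) h2 h4

end Necessity

/-! ### Endomorphism modules -/

section MatrixForm

variable {R J : Type*} [CommRing R] (M : J → Type*) [∀ j, AddCommGroup (M j)]
  [∀ j, Module R (M j)]

variable [DecidableEq J]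

/-- The matrix of an endomorphism of a direct sum. -/
noncomputable def directSumMatrix :
    Module.End R (⨁ j, M j) →ₗ[R] ∀ p : J × J, M p.1 →ₗ[R] M p.2 where
  toFun φ p := DirectSum.component R J M p.2 ∘ₗ φ ∘ₗ DirectSum.lof R J M p.1
  map_add' _ _ := rfl
  map_smul' r φ := by
    funext p
    ext x
    exact map_smul (DirectSum.component R J M p.2) r _

theorem directSumMatrix_apply (φ : Module.End R (⨁ j, M j)) (j i : J) (x : M j) :
    directSumMatrix M φ (j, i) x =
      DirectSum.component R J M i (φ (DirectSum.lof R J M j x)) := rfl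

theorem directSumMatrix_bijective [Finite J] : Function.Bijective (directSumMatrix (R := R) M) := by
  have := Fintype.ofFinite J
  constructor
  · intro φ ψ h
    refine DirectSum.linearMap_ext R fun j => LinearMap.ext fun x => ?_
    refine DFinsupp.ext fun i => ?_
    have := LinearMap.congr_fun (congrFun h (j, i)) x
    rw [directSumMatrix_apply, directSumMatrix_apply] at this
    exact this
  · intro F
    refine ⟨DirectSum.toModule R J _ fun j => ∑ i, DirectSum.lof R J M i ∘ₗ F (j, i), ?_⟩
    funext p
    obtain ⟨j, i⟩ := p
    ext x
    rw [directSumMatrix_apply, DirectSum.toModule_lof, LinearMap.sum_apply, map_sum,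
      Finset.sum_eq_single i]
    · rw [LinearMap.comp_apply, DirectSum.component.lof_self]
    · intro i' _ hne
      rw [LinearMap.comp_apply, DirectSum.component.of, dif_neg hne]
    · simp

end MatrixForm

section Hom

variable {R L : Type*} [CommRing R] [CommRing L] [Algebra R L]

/-- Multiplication by the elements of `W`, as homomorphisms from `V` to `V'`. -/
noncomputable def mulHom (V V' W : Submodule R L) (h : ∀ f ∈ W, ∀ u ∈ V, f * u ∈ V') :
    W →ₗ[R] V →ₗ[R] V' where
  toFun f :=
    { toFun u := ⟨f * u, h f f.2 u u.2⟩
      map_add' _ _ := Subtype.ext (mul_add _ _ _)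
      map_smul' _ _ := Subtype.ext (mul_smul_comm _ _ _) }
  map_add' _ _ := LinearMap.ext fun _ => Subtype.ext (add_mul _ _ _)
  map_smul' _ _ := LinearMap.ext fun _ => Subtype.ext (smul_mul_assoc _ _ _)

/-- Each u ∈ V is proportional to the unit u₀ up to non-zero-divisors, so a homomorphism is
multiplication by its value at u₀ divided by u₀. -/
theorem mulHom_bijective {V V' W : Submodule R L} (h : ∀ f ∈ W, ∀ u ∈ V, f * u ∈ V')
    {u₀ w₀ : L} (hu₀ : u₀ ∈ V) (hw₀ : w₀ * u₀ = 1)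
    (hdiv : ∀ u ∈ V, ∃ r s : R, (∀ l : L, r • l = 0 → l = 0) ∧ r • u = s • u₀)
    (hW : ∀ f, (∀ u ∈ V, f * u ∈ V') → f ∈ W) : Function.Bijective (mulHom V V' W h) := by
  constructor
  · rw [injective_iff_map_eq_zero]
    intro f hf
    have h1 : (f : L) * u₀ = 0 := congrArg Subtype.val (LinearMap.congr_fun hf ⟨u₀, hu₀⟩)
    refine Subtype.ext ?_
    rw [← mul_one (f : L), ← hw₀, mul_left_comm, h1, mul_zero]
    rfl
  · intro φ
    let f : L := w₀ * φ ⟨u₀, hu₀⟩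
    have hφ : ∀ u : V, (φ u : L) = f * u := by
      intro u
      obtain ⟨r, s, hr, hrs⟩ := hdiv u u.2
      have h1 : r • u = s • (⟨u₀, hu₀⟩ : V) := Subtype.ext hrs
      have h2 := congrArg (fun y => (φ y : L)) h1
      simp only [map_smul, Submodule.coe_smul] at h2
      refine sub_eq_zero.1 (hr _ ?_)
      rw [smul_sub, h2, ← mul_smul_comm, hrs, mul_smul_comm, ← smul_sub, sub_eq_zero.2, smul_zero]
      simp only [f]
      linear_combination (-(φ ⟨u₀, hu₀⟩ : L)) * hw₀
    exact ⟨⟨f, hW f fun u hu => by rw [← hφ ⟨u, hu⟩]; exact Subtype.coe_prop _⟩,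
      LinearMap.ext fun u => Subtype.ext (hφ u).symm⟩

/-- The endomorphisms of a direct sum of submodules as matrices of multipliers. -/
noncomputable def endEquivOfMulHom {J : Type*} [Finite J] (V : J → Submodule R L)
    (W : J × J → Submodule R L) (h : ∀ p, ∀ f ∈ W p, ∀ u ∈ V p.1, f * u ∈ V p.2)
    (hbij : ∀ p, Function.Bijective (mulHom (V p.1) (V p.2) (W p) (h p))) :
    Module.End R (⨁ j, V j) ≃ₗ[R] ∀ p, W p :=
  have := Classical.decEq J
  (LinearEquiv.ofBijective _ (directSumMatrix_bijective fun j => V j)).trans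
    (LinearEquiv.piCongrRight fun p => (LinearEquiv.ofBijective _ (hbij p)).symm)

end Hom

/-! ### Homomorphisms between modules of weights -/

section EndFrame

variable {𝕜 : Type*} [Field 𝕜] {ι : Type*} {K : ℕ} {n : ι → Fin 3 → ℤ} {g : Fin K → ι}

/-- The height coordinate, scaled by -b_i, is exact at n_i because all heights are 1. Adding a large
multiple of the two edge equations through n_i repairs the other inequalities without changing the
value there. -/
theorem IsFrame.exists_tight [Finite ι] (hg : IsFrame n g) (h1 : ∀ i, n i 2 = 1) {b : ι → ℤ}
    (hb : IsCompatible n b) (i : ι) : ∃ m ∈ weightSet n b, m (n i) = -b i := by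
  have := Fintype.ofFinite ι
  obtain ⟨j, hj⟩ := hg.cover i
  obtain ⟨j', rfl⟩ := exists_nxt_eq j
  let v : Fin K → Fin 3 → ℤ := fun j => n (g j)
  let a : Module.Dual ℤ (Fin 3 → ℤ) := edge v j' + edge v (nxt j')
  let N : ℕ := ∑ l, (b l - b i).natAbs
  have h0 : a (n i) = 0 := by
    rw [hj, LinearMap.add_apply]
    change edge v j' (v (nxt j')) + edge v (nxt j') (v (nxt j')) = 0
    rw [edge_nxt, edge_self, add_zero]
  have hpos : ∀ l, n l ≠ n i → 0 < a (n l) := by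
    intro l hl
    obtain ⟨q, hq⟩ := hg.cover l
    rw [hq] at hl ⊢
    have hqj : q ≠ nxt j' := by rintro rfl; exact hl hj.symm
    change 0 < edge v j' (v q) + edge v (nxt j') (v q)
    by_cases hq' : q = j'
    · rw [hq', edge_self, zero_add]
      exact hg.convex.edge_pos (hg.convex.nxt_ne j').symm (hg.convex.nxt_nxt_ne j').symm
    · exact add_pos_of_pos_of_nonneg (hg.convex.edge_pos hq' hqj) (hg.convex.edge_nonneg _ _)
  refine ⟨(-b i) • LinearMap.proj 2 + N • a, fun l => ?_, ?_⟩
  · rw [LinearMap.add_apply, LinearMap.smul_apply, LinearMap.smul_apply, LinearMap.proj_apply,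
      h1, smul_eq_mul, nsmul_eq_mul, mul_one]
    by_cases hl : n l = n i
    · rw [hl, h0, hb l i hl]
      simp
    · have h2 := hpos l hl
      have h3 : (b l - b i).natAbs ≤ N := Finset.single_le_sum
        (f := fun l => (b l - b i).natAbs) (fun _ _ => Nat.zero_le _) (Finset.mem_univ l)
      have h4 : b i - b l ≤ N := by omega
      nlinarith
  · rw [LinearMap.add_apply, LinearMap.smul_apply, LinearMap.smul_apply, LinearMap.proj_apply,
      h1, h0]
    simp

theorem mul_mem_toricSubmodule {b b' : ι → ℤ} {f u : GroupAlg 𝕜 (Fin 3 → ℤ)}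
    (hf : f ∈ toricSubmodule 𝕜 n (b' - b)) (hu : u ∈ toricSubmodule 𝕜 n b) :
    f * u ∈ toricSubmodule 𝕜 n b' := mem_toricSubmodule_iff.2 fun i => by
  have h3 := (mem_toricSubmodule_iff.1 hf i).mul (mem_toricSubmodule_iff.1 hu i)
  rwa [Pi.sub_apply, show -(b' i - b i) + -b i = -b' i by ring] at h3

/-- A multiplier from M_b to M_{b'} must satisfy the bounds of b' - b: test it against a character
of M_b that is tight at n_i. -/
theorem mulHom_toricSubmodule_bijective {b b' : ι → ℤ}
    (hb : ∀ i, ∃ m ∈ weightSet n b, m (n i) = -b i)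
    (hne : (weightSet n b).Nonempty) (hne' : (weightSet n (-b)).Nonempty) :
    Function.Bijective (mulHom (toricSubmodule 𝕜 n b) (toricSubmodule 𝕜 n b')
      (toricSubmodule 𝕜 n (b' - b)) fun _ hf _ hu => mul_mem_toricSubmodule hf hu) := by
  obtain ⟨m₀, hm₀⟩ := hne
  obtain ⟨c, hc⟩ := hne'
  refine mulHom_bijective _ (single_mem_toricSubmodule hm₀ 1) (w₀ := chi 𝕜 (-m₀)) ?_ ?_ ?_
  · exact (chi_mul_chi _ _).trans (by rw [neg_add_cancel, chi_zero])
  · intro u hu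
    refine ⟨⟨chi 𝕜 (m₀ + c), single_mem_toricSubalgebra (fun i => ?_) 1⟩,
      ⟨chi 𝕜 c * u, mem_toricSubalgebra_iff.2 fun i => ?_⟩, fun l hl => ?_, ?_⟩
    · have h1 := hm₀ i
      have h2 := hc i
      rw [LinearMap.add_apply]
      simp only [Pi.neg_apply] at h2
      omega
    · have h2 := hc i
      refine ((lowerBound_chi_mul c).2 (mem_toricSubmodule_iff.1 hu i)).mono ?_
      simp only [Pi.neg_apply] at h2
      omega
    · exact (mul_eq_zero.1 hl).resolve_left (chi_ne_zero _)
    · change chi 𝕜 (m₀ + c) * u = chi 𝕜 c * u * chi 𝕜 m₀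
      rw [← chi_mul_chi]
      ring
  · intro f hf
    refine mem_toricSubmodule_iff.2 fun i => ?_
    obtain ⟨m, hm, hmi⟩ := hb i
    have h1 := mem_toricSubmodule_iff.1 (hf _ (single_mem_toricSubmodule hm 1)) i
    rw [mul_comm, show -b' i = -(b' - b) i + m (n i) by rw [hmi, Pi.sub_apply]; ring] at h1
    exact (lowerBound_chi_mul m).1 h1

/-- The endomorphisms of a direct sum of modules of weights are matrices of differences. -/
noncomputable def IsFrame.endEquiv [Finite ι] (hg : IsFrame n g) (h1 : ∀ i, n i 2 = 1)
    {J : Type*} [Finite J] (b : J → ι → ℤ) (hb : ∀ j, IsCompatible n (b j)) :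
    Module.End (ToricRing 𝕜 n) (⨁ j, ToricModule 𝕜 n (b j)) ≃ₗ[ToricRing 𝕜 n]
      ∀ p : J × J, ToricModule 𝕜 n (b p.2 - b p.1) :=
  endEquivOfMulHom (fun j => toricSubmodule 𝕜 n (b j))
    (fun p => toricSubmodule 𝕜 n (b p.2 - b p.1)) (fun _ _ hf _ hu => mul_mem_toricSubmodule hf hu)
    fun p => by
      have hK := hg.convex.three_le
      let i := g ⟨0, by omega⟩
      have hneg : IsCompatible n (-b p.1) := fun i i' h => congrArg Neg.neg (hb p.1 i i' h)
      obtain ⟨m, hm, -⟩ := hg.exists_tight h1 (hb p.1) i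
      obtain ⟨m', hm', -⟩ := hg.exists_tight h1 hneg i
      exact mulHom_toricSubmodule_bijective (hg.exists_tight h1 (hb p.1)) ⟨m, hm⟩ ⟨m', hm'⟩

end EndFrame

/-! ### Polygons as convex lists -/

section Polygon

variable {k : ℕ}

theorem finRotate_eq_nxt (i : Fin k) : finRotate k i = nxt i := by
  have hi := i.2
  obtain ⟨k, rfl⟩ : ∃ l, k = l + 1 := ⟨k - 1, by omega⟩
  by_cases h : (i : ℕ) + 1 < k + 1
  · exact Fin.ext ((coe_finRotate_of_ne_last fun e => by simp [e] at h).trans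
      (nxt_val_of_lt h).symm)
  · have : i = Fin.last k := Fin.ext (by simp; omega)
    subst this
    rw [finRotate_last]
    exact Fin.ext (nxt_val_of_not_lt h).symm

/-- The three-term Plücker relation modulo a, used to propagate positivity of determinants to
distant triples. -/
theorem det3_pluecker (a x y z w : Fin 3 → ℤ) :
    det3 a x z * det3 a y w = det3 a x y * det3 a z w + det3 a x w * det3 a y z := by
  simp only [det3_eq]
  ring

/-- The edge conditions cover triples with two consecutive members. The rest follows by induction on
the gap between b and c, through the Plücker relation with a + 1 as reference point. -/
theorem IsPolygon.isConvexList {n : Fin k → Fin 3 → ℤ} (hP : IsPolygon n) : IsConvexList n := by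
  obtain ⟨hk, -, hpos⟩ := hP
  have hpos' : ∀ i j : Fin k, j ≠ i → (j : ℕ) ≠ i + 1 → (h : (i : ℕ) + 1 < k) →
      0 < det3 (n i) (n ⟨i + 1, h⟩) (n j) := by
    intro i j h1 h2 h
    have h3 : nxt i = ⟨i + 1, h⟩ := Fin.ext (nxt_val_of_lt h)
    have := hpos i j h1 (by rw [finRotate_eq_nxt, h3]; exact fun e => h2 (congrArg Fin.val e))
    rwa [finRotate_eq_nxt, h3] at this
  refine ⟨hk, ?_⟩
  suffices h : ∀ (r a b : ℕ) (hc : b + r + 1 < k) (hab : a < b), 0 < det3 (n ⟨a, by omega⟩)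
      (n ⟨b, by omega⟩) (n ⟨b + r + 1, hc⟩) by
    intro a b c hab hbc
    rw [Fin.lt_def] at hab hbc
    have := h (c - b - 1) a b (by omega) hab
    have e : (⟨b + (c - b - 1) + 1, by omega⟩ : Fin k) = c := Fin.ext (by simp; omega)
    rwa [e] at this
  intro r a b
  induction r with
  | zero =>
    intro hc hab
    rw [← det3_rotate]
    exact hpos' ⟨b, by omega⟩ ⟨a, by omega⟩ (by simp; omega) (by simp; omega) hc
  | succ r ih =>
    intro hc hab
    rcases Nat.lt_or_ge (a + 1) b with h | h
    · have h1 := ih (by omega) hab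
      have h2 : 0 < det3 (n ⟨a, by omega⟩) (n ⟨b + r + 1, by omega⟩) (n ⟨b + (r + 1) + 1, hc⟩) := by
        rw [← det3_rotate]
        exact hpos' ⟨b + r + 1, by omega⟩ ⟨a, by omega⟩ (by simp; omega) (by simp; omega) hc
      have h3 (x : Fin k) (hx : a + 1 < x) :
          0 < det3 (n ⟨a, by omega⟩) (n ⟨a + 1, by omega⟩) (n x) :=
        hpos' ⟨a, by omega⟩ x (by simp [Fin.ext_iff]; omega) (by simp; omega) (by simp; omega)
      have h4 := det3_pluecker (n ⟨a, by omega⟩) (n ⟨a + 1, by omega⟩) (n ⟨b, by omega⟩)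
        (n ⟨b + r + 1, by omega⟩) (n ⟨b + (r + 1) + 1, hc⟩)
      have h5 := h3 ⟨b, by omega⟩ h
      have h6 := h3 ⟨b + r + 1, by omega⟩ (by simp; omega)
      have h7 := h3 ⟨b + (r + 1) + 1, hc⟩ (by simp; omega)
      exact pos_of_mul_pos_right (h4 ▸ add_pos (mul_pos h5 h2) (mul_pos h7 h1)) h6.le
    · obtain rfl : b = a + 1 := by omega
      exact hpos' ⟨a, by omega⟩ ⟨a + 1 + (r + 1) + 1, hc⟩ (by simp [Fin.ext_iff]; omega)
        (by simp; omega) (by simp; omega)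

theorem IsConvexList.injective {n : Fin k → Fin 3 → ℤ} (hn : IsConvexList n) :
    Function.Injective n := by
  suffices h : ∀ i j : Fin k, i < j → n i ≠ n j by
    intro i j hij
    rcases lt_trichotomy i j with h1 | h1 | h1
    · exact absurd hij (h _ _ h1)
    · exact h1
    · exact absurd hij.symm (h _ _ h1)
  intro i j hij e
  have hk := hn.three_le
  rw [Fin.lt_def] at hij
  obtain ⟨l, hli, hlj⟩ : ∃ l : Fin k, l ≠ i ∧ l ≠ j := by
    by_cases h0 : (i : ℕ) = 0
    · by_cases h1 : (j : ℕ) = 1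
      · exact ⟨⟨2, by omega⟩, by simp [Fin.ext_iff]; omega, by simp [Fin.ext_iff]; omega⟩
      · exact ⟨⟨1, by omega⟩, by simp [Fin.ext_iff]; omega, by simp [Fin.ext_iff]; omega⟩
    · exact ⟨⟨0, by omega⟩, by simp [Fin.ext_iff]; omega, by simp [Fin.ext_iff]; omega⟩
  rcases lt_or_gt_of_ne hli with h1 | h1
  · have := hn.pos _ _ _ h1 (Fin.lt_def.2 hij)
    rw [e, det3_self_right] at this
    exact lt_irrefl _ this
  · rcases lt_or_gt_of_ne hlj with h2 | h2
    · have := hn.pos _ _ _ h1 h2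
      rw [e, det3_self_outer] at this
      exact lt_irrefl _ this
    · have := hn.pos _ _ _ (Fin.lt_def.2 hij) h2
      rw [e, ← det3_rotate, det3_self_outer] at this
      exact lt_irrefl _ this

end Polygon

/-! ### Signs and rounding -/

section Signs

variable {k : ℕ}

theorem NoAlternation.comp {l : ℕ} {P : Fin k → Prop} (hP : NoAlternation P) {g : Fin l → Fin k}
    (hg : StrictMono g) : NoAlternation fun j => P (g j) :=
  fun _ _ _ _ h1 h2 h3 => hP _ _ _ _ (hg h1) (hg h2) (hg h3)

/-- Two equal neighbours cannot carry opposite signs, so weak inequalities suffice. This allows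
pulling back along monotone maps that are not injective. -/
theorem NoAlternation.of_le {P : Fin k → Prop} (hP : NoAlternation P) {a b c d : Fin k}
    (hab : a ≤ b) (hbc : b ≤ c) (hcd : c ≤ d) :
    ¬ (P a ∧ ¬ P b ∧ P c ∧ ¬ P d) ∧ ¬ (¬ P a ∧ P b ∧ ¬ P c ∧ P d) := by
  rcases hab.lt_or_eq with hab | rfl
  · rcases hbc.lt_or_eq with hbc | rfl
    · rcases hcd.lt_or_eq with hcd | rfl
      · exact hP a b c d hab hbc hcd
      · tauto
    · tauto
  · tauto

theorem PM.round_mono (s : PM) {x y : ℝ} (h : x ≤ y) : s.round x ≤ s.round y := by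
  cases s
  · exact Int.ceil_mono h
  · exact Int.floor_mono h

theorem PM.round_add_intCast (s : PM) (x : ℝ) (z : ℤ) : s.round (x + z) = s.round x + z := by
  cases s
  · exact Int.ceil_add_intCast x z
  · exact Int.floor_add_intCast x z

theorem PM.round_intCast (s : PM) (z : ℤ) : s.round z = z := by
  cases s
  · exact Int.ceil_intCast z
  · exact Int.floor_intCast z

/-- The sign at a point of an edge, after rounding, is the sign at one of the end points. -/
theorem PM.round_sub_round_sign (s : PM) {α β : ℝ} (hα : 0 ≤ α) (hβ : 0 ≤ β) (hαβ : α + β = 1)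
    {p q r : ℤ} (hr : (r : ℝ) = α * p + β * q) (b₁ b₂ b₁' b₂' : ℤ) :
    let Q := r < -(s.round (α * b₁' + β * b₂') - s.round (α * b₁ + β * b₂))
    (Q ↔ p < -(b₁' - b₁)) ∨ (Q ↔ q < -(b₂' - b₂)) := by
  intro Q
  by_cases hp : p < -(b₁' - b₁) <;> by_cases hq : q < -(b₂' - b₂)
  · left
    refine iff_of_true ?_ hp
    have h1 : (p : ℝ) + b₁' - b₁ ≤ -1 := by exact_mod_cast (by omega : p + b₁' - b₁ ≤ -1)
    have h2 : (q : ℝ) + b₂' - b₂ ≤ -1 := by exact_mod_cast (by omega : q + b₂' - b₂ ≤ -1)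
    -- Integrality makes both violations at least 1, hence so is their convex combination; the
    -- integer shifts by r and -1 then pass through the rounding.
    have h3 : α * b₁' + β * b₂' + (r : ℤ) ≤ α * b₁ + β * b₂ + (-1 : ℤ) := by
      rw [hr]
      push_cast
      nlinarith
    have h4 := s.round_mono h3
    rw [s.round_add_intCast, s.round_add_intCast] at h4
    simp only [Q]
    omega
  · by_cases hQ : Q
    · exact .inl (iff_of_true hQ hp)
    · exact .inr (iff_of_false hQ hq)
  · by_cases hQ : Q
    · exact .inr (iff_of_true hQ hq)
    · exact .inl (iff_of_false hQ hp)
  · left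
    refine iff_of_false ?_ hp
    have h1 : 0 ≤ (p : ℝ) + b₁' - b₁ := by exact_mod_cast (by omega : 0 ≤ p + b₁' - b₁)
    have h2 : 0 ≤ (q : ℝ) + b₂' - b₂ := by exact_mod_cast (by omega : 0 ≤ q + b₂' - b₂)
    have h3 : α * b₁ + β * b₂ ≤ α * b₁' + β * b₂' + (r : ℤ) := by
      rw [hr]
      nlinarith
    have h4 := s.round_mono h3
    rw [s.round_add_intCast] at h4
    simp only [Q]
    omega

end Signs

/-! ### Cutting a corner -/

section OmitCorner

variable {k : ℕ} {α : Type*}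

theorem omitCorner_of_lt (x : Fin (k + 2) → α) {j : ℕ} (hj : j < k - 1) :
    omitCorner x ⟨j, by omega⟩ = x ⟨j, by omega⟩ := by
  have h : (⟨j, by omega⟩ : Fin (k + 1)).castSucc < ⟨k - 1, by omega⟩ := Fin.lt_def.2 hj
  rw [omitCorner, Fin.succAbove_of_castSucc_lt _ _ h]
  rfl

theorem omitCorner_of_le (x : Fin (k + 2) → α) {j : ℕ} (hj : k - 1 ≤ j) (hj' : j < k + 1) :
    omitCorner x ⟨j, hj'⟩ = x ⟨j + 1, by omega⟩ := by
  rw [omitCorner, Fin.succAbove_of_le_castSucc _ _ (Fin.le_def.2 hj)]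
  rfl

end OmitCorner

section ConvexInduce

variable {k : ℕ} (t : Weights k 2) (s : Fin 2 → PM) (b : Fin k → ℤ)

theorem convexInduce_of_lt {j : ℕ} (hj : j < k) :
    convexInduce t s b ⟨j, by omega⟩ = b ⟨j, hj⟩ := by
  have h1 : (⟨j, by omega⟩ : Fin (k + 2)) = Fin.castSucc (Fin.castSucc ⟨j, hj⟩) := rfl
  rw [h1]
  simp only [convexInduce]
  rw [Fin.snoc_castSucc, Fin.snoc_castSucc]

theorem convexInduce_fst :
    convexInduce t s b ⟨k, by omega⟩ = (s 0).round (∑ j : Fin k, t 0 j * (b j : ℝ)) := by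
  have h1 : (⟨k, by omega⟩ : Fin (k + 2)) = Fin.castSucc (Fin.last k) := rfl
  rw [h1]
  simp only [convexInduce]
  rw [Fin.snoc_castSucc]
  exact Fin.snoc_last (n := k) (α := fun _ => ℤ) _ _

theorem convexInduce_snd :
    convexInduce t s b ⟨k + 1, by omega⟩ = (s 1).round (∑ j : Fin (k + 1), t 1 j *
      (convexInduce t s b ⟨j, by omega⟩ : ℝ)) := by
  have h1 : (⟨k + 1, by omega⟩ : Fin (k + 2)) = Fin.last (k + 1) := rfl
  have h2 : ∀ j : Fin (k + 1), (⟨j, by omega⟩ : Fin (k + 2)) = Fin.castSucc j := fun _ => rfl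
  rw [h1]
  simp only [h2]
  simp only [convexInduce]
  rw [Fin.snoc_last]
  simp only [Fin.snoc_castSucc]
  rfl

end ConvexInduce

/-- The list `v` arises from the convex list `n` by replacing the last vertex with a point `A` of
the incoming edge and a point `B` of the outgoing edge. -/
structure IsCorner {k : ℕ} (hk : 3 ≤ k) (n : Fin k → Fin 3 → ℤ) (v : Fin (k + 1) → Fin 3 → ℤ)
    (α β γ δ : ℝ) : Prop where
  alpha_pos : 0 < α
  beta_nonneg : 0 ≤ β
  alpha_add_beta : α + β = 1
  gamma_nonneg : 0 ≤ γ
  delta_pos : 0 < δ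
  gamma_add_delta : γ + δ = 1
  of_lt : ∀ j (hj : j < k - 1), v ⟨j, by omega⟩ = n ⟨j, by omega⟩
  fst : ∀ c, (v ⟨k - 1, by omega⟩ c : ℝ) =
    α * n ⟨k - 2, by omega⟩ c + β * n ⟨k - 1, by omega⟩ c
  snd : ∀ c, (v ⟨k, by omega⟩ c : ℝ) = γ * n ⟨k - 1, by omega⟩ c + δ * n ⟨0, by omega⟩ c

/-- The entries of `c` are those of `b`, with the rounded interpolations at the new points. -/
structure IsCornerVector {k : ℕ} (hk : 3 ≤ k) (α β γ δ : ℝ) (s₀ s₁ : PM) (b : Fin k → ℤ)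
    (c : Fin (k + 1) → ℤ) : Prop where
  of_lt : ∀ j (hj : j < k - 1), c ⟨j, by omega⟩ = b ⟨j, by omega⟩
  fst : c ⟨k - 1, by omega⟩ = s₀.round (α * b ⟨k - 2, by omega⟩ + β * b ⟨k - 1, by omega⟩)
  snd : c ⟨k, by omega⟩ = s₁.round (γ * b ⟨k - 1, by omega⟩ + δ * b ⟨0, by omega⟩)

/-- In each step only the two coefficients at the ends of the edge survive. The new points differ
from n_k, which makes the weights α and δ of the far ends positive. -/
theorem IsCornerCut.exists_isCorner {k : ℕ} (hk : 3 ≤ k) {n : Fin k → Fin 3 → ℤ} {t : Weights k 2}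
    {n' : Fin (k + 2) → Fin 3 → ℤ} (h : IsCornerCut n t n') :
    ∃ α β γ δ : ℝ, IsCorner hk n (omitCorner n') α β γ δ ∧ ∀ s b,
      IsCornerVector hk α β γ δ (s 0) (s 1) b (omitCorner (convexInduce t s b)) := by
  have hn : ∀ j (hj : j < k), n' ⟨j, by omega⟩ = n ⟨j, hj⟩ := fun j hj => h.induced.1 ⟨j, hj⟩
  let t₀ : Fin k → ℝ := t 0
  let t₁ : Fin (k + 1) → ℝ := t 1
  have hsum₀ : ∀ x : Fin k → ℝ, ∑ j, t₀ j * x j =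
      t₀ ⟨k - 2, by omega⟩ * x ⟨k - 2, by omega⟩ + t₀ ⟨k - 1, by omega⟩ * x ⟨k - 1, by omega⟩ := by
    intro x
    refine Fintype.sum_eq_add _ _ (by simp [Fin.ext_iff]; omega) fun j hj => ?_
    have : t₀ j = 0 := by
      by_contra hne
      have := h.edge₁ j hne
      simp only [ne_eq, Fin.ext_iff] at hj
      omega
    rw [this, zero_mul]
  have hsum₁ : ∀ x : Fin (k + 1) → ℝ, ∑ j, t₁ j * x j =
      t₁ ⟨k - 1, by omega⟩ * x ⟨k - 1, by omega⟩ + t₁ ⟨0, by omega⟩ * x ⟨0, by omega⟩ := by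
    intro x
    refine Fintype.sum_eq_add _ _ (by simp [Fin.ext_iff]; omega) fun j hj => ?_
    have : t₁ j = 0 := by
      by_contra hne
      have := h.edge₂ j hne
      simp only [ne_eq, Fin.ext_iff] at hj
      omega
    rw [this, zero_mul]
  have hone₀ := hsum₀ 1
  have hone₁ := hsum₁ 1
  have hd₀ : ∑ j, t₀ j = 1 := (h.datum 0).2
  have hd₁ : ∑ j, t₁ j = 1 := (h.datum 1).2
  simp only [Pi.one_apply, mul_one] at hone₀ hone₁
  rw [hd₀] at hone₀
  rw [hd₁] at hone₁
  have hA : ∀ c, (n' ⟨k, by omega⟩ c : ℝ) = t₀ ⟨k - 2, by omega⟩ * n ⟨k - 2, by omega⟩ c +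
      t₀ ⟨k - 1, by omega⟩ * n ⟨k - 1, by omega⟩ c := by
    intro c
    refine (h.induced.2 0 c).trans ((hsum₀ fun j => (n' ⟨j, by omega⟩ c : ℝ)).trans ?_)
    simp only
    rw [hn (k - 2) (by omega), hn (k - 1) (by omega)]
  have hB : ∀ c, (n' ⟨k + 1, by omega⟩ c : ℝ) = t₁ ⟨k - 1, by omega⟩ * n ⟨k - 1, by omega⟩ c +
      t₁ ⟨0, by omega⟩ * n ⟨0, by omega⟩ c := by
    intro c
    refine (h.induced.2 1 c).trans ((hsum₁ fun j => (n' ⟨j, by omega⟩ c : ℝ)).trans ?_)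
    simp only
    rw [hn (k - 1) (by omega), hn 0 (by omega)]
  have hge₀ : ∀ j, 0 ≤ t₀ j := fun j => ((h.datum 0).1 j).1
  have hge₁ : ∀ j, 0 ≤ t₁ j := fun j => ((h.datum 1).1 j).1
  refine ⟨t₀ ⟨k - 2, by omega⟩, t₀ ⟨k - 1, by omega⟩, t₁ ⟨k - 1, by omega⟩, t₁ ⟨0, by omega⟩,
    ⟨lt_of_le_of_ne (hge₀ _) fun h0 => h.ne₁ ?_, hge₀ _, hone₀.symm, hge₁ _,
      lt_of_le_of_ne (hge₁ _) fun h0 => h.ne₂ ?_, hone₁.symm, fun j hj => ?_, fun c => ?_,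
      fun c => ?_⟩, fun s b => ⟨fun j hj => ?_, ?_, ?_⟩⟩
  · funext c
    have := hA c
    rw [← h0, show t₀ ⟨k - 1, by omega⟩ = 1 by linarith, ← hn (k - 1) (by omega)] at this
    rw [zero_mul, zero_add, one_mul] at this
    exact_mod_cast this
  · funext c
    have := hB c
    rw [← h0, show t₁ ⟨k - 1, by omega⟩ = 1 by linarith, ← hn (k - 1) (by omega)] at this
    rw [zero_mul, add_zero, one_mul] at this
    exact_mod_cast this
  · rw [omitCorner_of_lt _ hj, hn j (by omega)]
  · rw [omitCorner_of_le _ le_rfl, show (⟨k - 1 + 1, by omega⟩ : Fin (k + 2)) = ⟨k, by omega⟩ from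
      Fin.ext (by simp; omega)]
    exact hA c
  · rw [omitCorner_of_le _ (by omega)]
    exact hB c
  · rw [omitCorner_of_lt _ hj, convexInduce_of_lt t s b (by omega)]
  · rw [omitCorner_of_le _ le_rfl, show (⟨k - 1 + 1, by omega⟩ : Fin (k + 2)) = ⟨k, by omega⟩ from
      Fin.ext (by simp; omega), convexInduce_fst]
    exact congrArg _ (hsum₀ fun j => (b j : ℝ))
  · rw [omitCorner_of_le _ (by omega), convexInduce_snd]
    refine congrArg _ ((hsum₁ fun j => (convexInduce t s b ⟨j, by omega⟩ : ℝ)).trans ?_)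
    simp only
    rw [convexInduce_of_lt t s b (by omega), convexInduce_of_lt t s b (by omega)]

/-! ### Vertices and sign patterns after the cut -/

section CornerFrame

theorem cast_det3_of_combo {A P Q : Fin 3 → ℤ} {α β : ℝ}
    (h : ∀ c, (A c : ℝ) = α * P c + β * Q c) (x y : Fin 3 → ℤ) :
    (det3 x y A : ℝ) = α * det3 x y P + β * det3 x y Q := by
  simp only [det3_eq]
  push_cast
  rw [h, h, h]
  ring

theorem cast_apply_of_combo {A P Q : Fin 3 → ℤ} {α β : ℝ}
    (h : ∀ c, (A c : ℝ) = α * P c + β * Q c) (m : Module.Dual ℤ (Fin 3 → ℤ)) :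
    (m A : ℝ) = α * m P + β * m Q := by
  rw [dual_apply_eq m A, dual_apply_eq m P, dual_apply_eq m Q]
  push_cast
  rw [h, h, h]
  ring

variable {k : ℕ} {hk : 3 ≤ k} {n : Fin k → Fin 3 → ℤ} {v : Fin (k + 1) → Fin 3 → ℤ} {α β γ δ : ℝ}

theorem IsConvexList.det3_nonneg (hn : IsConvexList n) {a b c : Fin k} (hab : a ≤ b) (hbc : b ≤ c) :
    0 ≤ det3 (n a) (n b) (n c) := by
  rcases hab.lt_or_eq with hab | rfl
  · rcases hbc.lt_or_eq with hbc | rfl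
    · exact (hn.pos _ _ _ hab hbc).le
    · rw [det3_self_right]
  · rw [← det3_rotate, det3_self_outer]

/-- The entries of the list after a corner cut that do not repeat another entry. -/
def cornerSupport (k : ℕ) (β γ : ℝ) : Set (Fin (k + 1)) :=
  {j | ((j : ℕ) = k - 1 → β ≠ 0) ∧ ((j : ℕ) = k → γ ≠ 0)}

/-- Expanding multilinearly in the new points leaves determinants of old vertices, nonnegative by
convexity; one with a positive coefficient is strictly positive. -/
theorem IsCorner.det3_pos (h : IsCorner hk n v α β γ δ) (hn : IsConvexList n) {a b c : Fin (k + 1)}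
    (ha : a ∈ cornerSupport k β γ) (hb : b ∈ cornerSupport k β γ) (hc : c ∈ cornerSupport k β γ)
    (hab : a < b) (hbc : b < c) : 0 < det3 (v a) (v b) (v c) := by
  obtain ⟨a, ha'⟩ := a
  obtain ⟨b, hb'⟩ := b
  obtain ⟨c, hc'⟩ := c
  simp only [cornerSupport, Set.mem_ofPred_eq] at ha hb hc
  rw [Fin.lt_def] at hab hbc
  simp only at hab hbc
  have hα := h.alpha_pos
  have hβ := h.beta_nonneg
  have hγ := h.gamma_nonneg
  have hδ := h.delta_pos
  rw [h.of_lt a (by omega)]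
  rcases Nat.lt_or_ge b (k - 1) with hbk | hbk
  · rw [h.of_lt b hbk]
    have hpos : 0 < det3 (n ⟨a, by omega⟩) (n ⟨b, by omega⟩) (n ⟨k - 1, by omega⟩) :=
      hn.pos _ _ _ (Fin.lt_def.2 hab) (Fin.lt_def.2 hbk)
    rcases Nat.lt_or_ge c (k - 1) with hck | hck
    · rw [h.of_lt c hck]
      exact hn.pos _ _ _ (Fin.lt_def.2 hab) (Fin.lt_def.2 hbc)
    rw [← Int.cast_pos (R := ℝ)]
    have hpos' := Int.cast_pos (R := ℝ).2 hpos
    rcases eq_or_ne c (k - 1) with rfl | hck'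
    · have hβ' : 0 < β := lt_of_le_of_ne hβ (hc.1 rfl).symm
      rw [cast_det3_of_combo h.fst]
      have h1 : 0 ≤ det3 (n ⟨a, by omega⟩) (n ⟨b, by omega⟩) (n ⟨k - 2, by omega⟩) :=
        hn.det3_nonneg (Fin.le_def.2 hab.le) (Fin.le_def.2 (by simp; omega))
      have h1' := Int.cast_nonneg (R := ℝ) h1
      positivity
    · obtain rfl : c = k := by omega
      have hγ' : 0 < γ := lt_of_le_of_ne hγ (hc.2 rfl).symm
      rw [cast_det3_of_combo h.snd]
      have h1 : 0 ≤ det3 (n ⟨a, by omega⟩) (n ⟨b, by omega⟩) (n ⟨0, by omega⟩) := by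
        rw [det3_rotate]
        exact hn.det3_nonneg (Fin.le_def.2 (by simp)) (Fin.le_def.2 hab.le)
      have h1' := Int.cast_nonneg (R := ℝ) h1
      positivity
  · obtain rfl : b = k - 1 := by omega
    obtain rfl : c = k := by omega
    have hβ' : 0 < β := lt_of_le_of_ne hβ (hb.1 rfl).symm
    have hγ' : 0 < γ := lt_of_le_of_ne hγ (hc.2 rfl).symm
    rw [← Int.cast_pos (R := ℝ), cast_det3_of_combo h.snd,
      det3_rotate (n ⟨c - 1, by omega⟩) (n ⟨a, by omega⟩) (v ⟨c - 1, by omega⟩),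
      det3_rotate (n ⟨0, by omega⟩) (n ⟨a, by omega⟩) (v ⟨c - 1, by omega⟩),
      cast_det3_of_combo h.fst, cast_det3_of_combo h.fst, det3_self_outer,
      ← det3_rotate (n ⟨c - 1, by omega⟩)]
    have h1 : 0 ≤ det3 (n ⟨a, by omega⟩) (n ⟨c - 2, by omega⟩) (n ⟨c - 1, by omega⟩) :=
      hn.det3_nonneg (Fin.le_def.2 (by simp; omega)) (Fin.le_def.2 (by simp; omega))
    have h2 : 0 ≤ det3 (n ⟨0, by omega⟩) (n ⟨a, by omega⟩) (n ⟨c - 2, by omega⟩) :=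
      hn.det3_nonneg (Fin.le_def.2 (by simp)) (Fin.le_def.2 (by simp; omega))
    have h3 : 0 ≤ det3 (n ⟨0, by omega⟩) (n ⟨a, by omega⟩) (n ⟨c - 1, by omega⟩) :=
      hn.det3_nonneg (Fin.le_def.2 (by simp)) (Fin.le_def.2 (by simp; omega))
    have h1' := Int.cast_nonneg (R := ℝ) h1
    have h2' := Int.cast_nonneg (R := ℝ) h2
    have h3' := Int.cast_nonneg (R := ℝ) h3
    rw [Int.cast_zero, mul_zero, add_zero]
    -- The term with coefficient γα is positive for a = 0, the one with δβ for a > 0.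
    rcases Nat.eq_zero_or_pos a with rfl | ha0
    · have h4 : 0 < det3 (n ⟨0, by omega⟩) (n ⟨c - 2, by omega⟩) (n ⟨c - 1, by omega⟩) :=
        hn.pos _ _ _ (Fin.lt_def.2 (by simp; omega)) (Fin.lt_def.2 (by simp; omega))
      have h4' := Int.cast_pos (R := ℝ).2 h4
      positivity
    · have h4 : 0 < det3 (n ⟨0, by omega⟩) (n ⟨a, by omega⟩) (n ⟨c - 1, by omega⟩) :=
        hn.pos _ _ _ (Fin.lt_def.2 ha0) (Fin.lt_def.2 (by simp; omega))
      have h4' := Int.cast_pos (R := ℝ).2 h4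
      positivity

/-- If β or γ is zero, the new point is the far end of its edge, and the number to be rounded is
already an integer, so the entries of induced vectors coincide as well. -/
theorem IsCorner.exists_mem_cornerSupport (h : IsCorner hk n v α β γ δ) (j : Fin (k + 1)) :
    ∃ i ∈ cornerSupport k β γ, v j = v i ∧
      ∀ s₀ s₁ b c, IsCornerVector hk α β γ δ s₀ s₁ b c → c j = c i := by
  by_cases hj : j ∈ cornerSupport k β γ
  · exact ⟨j, hj, rfl, fun _ _ _ _ _ => rfl⟩
  obtain ⟨j, hj'⟩ := j
  simp only [cornerSupport, Set.mem_ofPred_eq, not_and_or, Classical.not_imp, not_not] at hj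
  rcases hj with ⟨rfl, h0⟩ | ⟨rfl, h0⟩
  · have h1 : α = 1 := by have := h.alpha_add_beta; linarith
    refine ⟨⟨k - 2, by omega⟩, ⟨fun e => ?_, fun e => ?_⟩, ?_, fun s₀ s₁ b c hc => ?_⟩
    · simp only at e; omega
    · simp only at e; omega
    · funext c
      have := h.fst c
      rw [h0, h1, zero_mul, add_zero, one_mul] at this
      rw [h.of_lt (k - 2) (by omega)]
      exact_mod_cast this
    · rw [hc.fst, hc.of_lt (k - 2) (by omega), h0, h1, zero_mul, add_zero, one_mul,
        PM.round_intCast]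
  · have h1 : δ = 1 := by have := h.gamma_add_delta; linarith
    refine ⟨⟨0, by omega⟩, ⟨fun e => ?_, fun e => ?_⟩, ?_, fun s₀ s₁ b c hc => ?_⟩
    · simp only at e; omega
    · simp only at e; omega
    · funext c
      have := h.snd c
      rw [h0, h1, zero_mul, zero_add, one_mul] at this
      rw [h.of_lt 0 (by omega)]
      exact_mod_cast this
    · rw [hc.snd, hc.of_lt 0 (by omega), h0, h1, zero_mul, zero_add, one_mul, PM.round_intCast]

/-- The list after a corner cut is framed by its entries without repetitions. -/
theorem IsCorner.exists_isFrame (h : IsCorner hk n v α β γ δ) (hn : IsConvexList n)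
    (hspan : Submodule.span ℝ (Set.range fun (j : Fin (k + 1)) (c : Fin 3) => (v j c : ℝ)) = ⊤) :
    ∃ (K : ℕ) (g : Fin K → Fin (k + 1)), StrictMono g ∧ IsFrame v g ∧
      ∀ s₀ s₁ b c, IsCornerVector hk α β γ δ s₀ s₁ b c → IsCompatible v c := by
  classical
  let T : Finset (Fin (k + 1)) := {j | j ∈ cornerSupport k β γ}
  let g : Fin T.card → Fin (k + 1) := T.orderEmbOfFin rfl
  have hg : StrictMono g := (T.orderEmbOfFin rfl).strictMono
  have hgT : ∀ j, g j ∈ cornerSupport k β γ := fun j =>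
    (Finset.mem_filter.1 (T.orderEmbOfFin_mem rfl j)).2
  have hcov : ∀ i, ∃ j, v i = v (g j) ∧
      ∀ s₀ s₁ b c, IsCornerVector hk α β γ δ s₀ s₁ b c → c i = c (g j) := by
    intro i
    obtain ⟨i', hi', h1⟩ := h.exists_mem_cornerSupport i
    have h2 : i' ∈ Set.range (T.orderEmbOfFin rfl) := by
      rw [Finset.range_orderEmbOfFin]
      simpa [T] using hi'
    obtain ⟨j, rfl⟩ := h2
    exact ⟨j, h1⟩
  -- This is where two-dimensionality of P' enters: discarding repetitions leaves the span
  -- unchanged.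
  have hcard : 3 ≤ T.card := by
    have h1 : Submodule.span ℝ (Set.range fun (j : Fin T.card) (c : Fin 3) => (v (g j) c : ℝ)) =
        ⊤ := by
      rw [eq_top_iff, ← hspan]
      refine Submodule.span_mono ?_
      rintro _ ⟨i, rfl⟩
      obtain ⟨j, hj, -⟩ := hcov i
      exact ⟨j, by simp only [hj]⟩
    have h2 := finrank_range_le_card (R := ℝ) fun (j : Fin T.card) (c : Fin 3) => (v (g j) c : ℝ)
    rw [Set.finrank, h1, finrank_top] at h2
    simpa using h2
  have hframe : IsFrame v g :=
    ⟨⟨hcard, fun a b c hab hbc => h.det3_pos hn (hgT a) (hgT b) (hgT c) (hg hab) (hg hbc)⟩,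
      fun i => (hcov i).imp fun _ hj => hj.1⟩
  refine ⟨_, g, hg, hframe, fun s₀ s₁ b c hc i i' hii => ?_⟩
  obtain ⟨j, hj, hj'⟩ := hcov i
  obtain ⟨j', hj₁, hj₁'⟩ := hcov i'
  rw [hj, hj₁] at hii
  rw [hj' _ _ _ _ hc, hj₁' _ _ _ _ hc, hframe.convex.injective hii]

/-- After a corner cut, the sign pattern of a difference of induced vectors still has no
alternation. -/
theorem IsCorner.noAlternation (h : IsCorner hk n v α β γ δ) {s₀ s₁ : PM} {b b' : Fin k → ℤ}
    {c c' : Fin (k + 1) → ℤ} (hc : IsCornerVector hk α β γ δ s₀ s₁ b c)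
    (hc' : IsCornerVector hk α β γ δ s₀ s₁ b' c') {m : Module.Dual ℤ (Fin 3 → ℤ)}
    (hP : NoAlternation fun j => m (n j) < -(b' - b) j) :
    NoAlternation fun j => m (v j) < -(c' - c) j := by
  set P : Fin k → Prop := fun j => m (n j) < -(b' - b) j with hPdef
  set Q : Fin (k + 1) → Prop := fun j => m (v j) < -(c' - c) j with hQdef
  have hlt : ∀ j (hj : j < k - 1), Q ⟨j, by omega⟩ ↔ P ⟨j, by omega⟩ := by
    intro j hj
    simp only [P, Q, Pi.sub_apply, h.of_lt j hj, hc.of_lt j hj, hc'.of_lt j hj]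
  have hA : ∃ i : Fin k, k - 2 ≤ (i : ℕ) ∧ (Q ⟨k - 1, by omega⟩ ↔ P i) := by
    have := s₀.round_sub_round_sign h.alpha_pos.le h.beta_nonneg h.alpha_add_beta
      (cast_apply_of_combo h.fst m) (b ⟨k - 2, by omega⟩) (b ⟨k - 1, by omega⟩)
      (b' ⟨k - 2, by omega⟩) (b' ⟨k - 1, by omega⟩)
    rw [← hc.fst, ← hc'.fst] at this
    rcases this with h1 | h1
    · exact ⟨⟨k - 2, by omega⟩, le_rfl, h1⟩
    · exact ⟨⟨k - 1, by omega⟩, by simp; omega, h1⟩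
  have hB : (Q ⟨k, by omega⟩ ↔ P ⟨k - 1, by omega⟩) ∨ (Q ⟨k, by omega⟩ ↔ P ⟨0, by omega⟩) := by
    have := s₁.round_sub_round_sign h.gamma_nonneg h.delta_pos.le h.gamma_add_delta
      (cast_apply_of_combo h.snd m) (b ⟨k - 1, by omega⟩) (b ⟨0, by omega⟩)
      (b' ⟨k - 1, by omega⟩) (b' ⟨0, by omega⟩)
    rw [← hc.snd, ← hc'.snd] at this
    exact this
  obtain ⟨i, hi, hA⟩ := hA
  -- Each new position before the last goes to an old position with the same sign; since i is k - 2
  -- or k - 1, the order is weakly preserved.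
  let f (j : Fin (k + 1)) : Fin k := if hj : (j : ℕ) < k - 1 then ⟨j, by omega⟩ else
    if (j : ℕ) = k - 1 then i else ⟨k - 1, by omega⟩
  have hf : Monotone f := by
    intro x y hxy
    rw [Fin.le_def] at hxy ⊢
    simp only [f]
    have := i.2
    have := y.2
    split_ifs <;> simp <;> omega
  have hQf : ∀ j : Fin (k + 1), (j : ℕ) < k → (Q j ↔ P (f j)) := by
    intro j hj
    simp only [f]
    split_ifs with h1 h2
    · exact hlt j h1
    · rw [← hA, show j = ⟨k - 1, by omega⟩ from Fin.ext h2]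
    · omega
  intro x y z w hxy hyz hzw
  rw [Fin.lt_def] at hxy hyz hzw
  have hw := w.2
  have h1 := hQf x (by omega)
  have h2 := hQf y (by omega)
  have h3 := hQf z (by omega)
  have e1 : f x ≤ f y := hf (Fin.le_def.2 hxy.le)
  have e2 : f y ≤ f z := hf (Fin.le_def.2 hyz.le)
  rcases Nat.lt_or_ge w k with hwk | hwk
  · have h4 := hQf w hwk
    have e3 : f z ≤ f w := hf (Fin.le_def.2 hzw.le)
    rw [h1, h2, h3, h4]
    exact hP.of_le e1 e2 e3
  · have hw' : w = ⟨k, by omega⟩ := Fin.ext (by simp; omega)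
    rcases hB with h4 | h4
    · rw [← hw'] at h4
      rw [h1, h2, h3, h4]
      refine hP.of_le e1 e2 (Fin.le_def.2 ?_)
      have := (f z).2
      simp only
      omega
    -- The last new point now has the sign of the first old vertex. Moving it to the front rotates
    -- the pattern and exchanges the two kinds of alternation.
    · rw [← hw'] at h4
      rw [h1, h2, h3, h4]
      have h5 := hP.of_le (a := ⟨0, by omega⟩) (Fin.le_def.2 (Nat.zero_le _)) e1 e2
      exact ⟨fun ⟨p, q, r, u⟩ => h5.2 ⟨u, p, q, r⟩, fun ⟨p, q, r, u⟩ => h5.1 ⟨u, p, q, r⟩⟩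

end CornerFrame

/-! ### Cohen–Macaulayness after cutting a corner -/

section Frame

variable {𝕜 : Type*} [Field 𝕜] {k : ℕ} {n : Fin k → Fin 3 → ℤ}

theorem IsConvexList.noAlternation_of_retract (hn : IsConvexList n) {b : Fin k → ℤ} {X : Type*}
    [AddCommGroup X] [Module (ToricRing 𝕜 n) X] (h : IsCohenMacaulay (ToricRing 𝕜 n) X)
    (i : ToricModule 𝕜 n b →ₗ[ToricRing 𝕜 n] X) (p : X →ₗ[ToricRing 𝕜 n] ToricModule 𝕜 n b)
    (hip : ∀ a, p (i a) = a) (m : Module.Dual ℤ (Fin 3 → ℤ)) :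
    NoAlternation fun j => m (n j) < -b j :=
  letI : Module (toricSubalgebra 𝕜 n) X := inferInstanceAs (Module (ToricRing 𝕜 n) X)
  hn.noAlternation (𝕜 := 𝕜) (X := X) h i p hip m

theorem IsConvexList.noAlternation_of_module (hn : IsConvexList n) {b : Fin k → ℤ}
    (h : IsCohenMacaulay (ToricRing 𝕜 n) (ToricModule 𝕜 n b)) (m : Module.Dual ℤ (Fin 3 → ℤ)) :
    NoAlternation fun j => m (n j) < -b j :=
  hn.noAlternation_of_retract (𝕜 := 𝕜) h LinearMap.id LinearMap.id (fun _ => rfl) m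

/-- The matrix entry (j, j') exhibits the module of the difference as a retract of the endomorphism
module. -/
theorem IsConvexList.noAlternation_of_end (hn : IsConvexList n) (h1 : ∀ i, n i 2 = 1)
    {J : Type*} [Finite J] {b : J → Fin k → ℤ}
    (h : IsCohenMacaulay (ToricRing 𝕜 n)
      (Module.End (ToricRing 𝕜 n) (⨁ j, ToricModule 𝕜 n (b j)))) (j j' : J)
    (m : Module.Dual ℤ (Fin 3 → ℤ)) : NoAlternation fun i => m (n i) < -(b j' - b j) i := by
  classical
  have hframe : IsFrame n id := ⟨hn, fun i => ⟨i, rfl⟩⟩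
  let E := hframe.endEquiv (𝕜 := 𝕜) h1 b fun j i i' hii => by rw [hn.injective hii]
  refine hn.noAlternation_of_retract (𝕜 := 𝕜) h
    (E.symm.toLinearMap ∘ₗ LinearMap.single (ToricRing 𝕜 n)
      (fun p : J × J => ToricModule 𝕜 n (b p.2 - b p.1)) (j, j'))
    (LinearMap.proj (R := ToricRing 𝕜 n)
      (φ := fun p : J × J => ToricModule 𝕜 n (b p.2 - b p.1)) (j, j') ∘ₗ E.toLinearMap)
    (fun a => ?_) m
  change E (E.symm (Pi.single (M := fun p : J × J => ToricModule 𝕜 n (b p.2 - b p.1)) (j, j') a))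
    (j, j') = a
  rw [E.apply_symm_apply, Pi.single_eq_same]

variable [IsAlgClosed 𝕜] [CharZero 𝕜] {ι : Type*} [Finite ι] {v : ι → Fin 3 → ℤ} {K : ℕ}
  {g : Fin K → ι}

theorem IsFrame.isCohenMacaulay_of_equiv (hg : IsFrame v g) {I : Type*} [Finite I]
    {b : I → ι → ℤ} (hb : ∀ i, IsCompatible v (b i))
    (halt : ∀ i (m : Module.Dual ℤ (Fin 3 → ℤ)), NoAlternation fun j => m (v (g j)) < -b i (g j))
    {X : Type*} [AddCommGroup X] [Module (ToricRing 𝕜 v) X]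
    (e : X ≃ₗ[ToricRing 𝕜 v] ∀ i, ToricModule 𝕜 v (b i)) : IsCohenMacaulay (ToricRing 𝕜 v) X :=
  letI : Module (toricSubalgebra 𝕜 v) X := inferInstanceAs (Module (ToricRing 𝕜 v) X)
  hg.isCohenMacaulay (𝕜 := 𝕜) b hb halt e

theorem IsFrame.isCohenMacaulay_module (hg : IsFrame v g) {b : ι → ℤ} (hb : IsCompatible v b)
    (halt : ∀ m : Module.Dual ℤ (Fin 3 → ℤ), NoAlternation fun j => m (v (g j)) < -b (g j)) :
    IsCohenMacaulay (ToricRing 𝕜 v) (ToricModule 𝕜 v b) :=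
  hg.isCohenMacaulay_of_equiv (I := Unit) (b := fun _ => b) (fun _ => hb) (fun _ => halt)
    (LinearEquiv.funUnique Unit (ToricRing 𝕜 v) (ToricModule 𝕜 v b)).symm

theorem IsFrame.isCohenMacaulay_end (hg : IsFrame v g) (h1 : ∀ i, v i 2 = 1) {J : Type*} [Finite J]
    {b : J → ι → ℤ} (hb : ∀ j, IsCompatible v (b j))
    (halt : ∀ j j' (m : Module.Dual ℤ (Fin 3 → ℤ)),
      NoAlternation fun i => m (v (g i)) < -(b j' - b j) (g i)) :
    IsCohenMacaulay (ToricRing 𝕜 v)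
      (Module.End (ToricRing 𝕜 v) (⨁ j, ToricModule 𝕜 v (b j))) :=
  hg.isCohenMacaulay_of_equiv (I := J × J) (b := fun p => b p.2 - b p.1)
    (fun p i i' h => by rw [Pi.sub_apply, Pi.sub_apply, hb p.1 i i' h, hb p.2 i i' h])
    (fun p => halt p.1 p.2) (hg.endEquiv h1 b hb)

end Frame

/-- With this, a single vector b is treated as the difference b - 0, which reduces the first claim
to the statement on differences. -/
theorem isCornerVector_zero {k : ℕ} (hk : 3 ≤ k) (α β γ δ : ℝ) (s₀ s₁ : PM) :
    IsCornerVector hk α β γ δ s₀ s₁ 0 0 := by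
  refine ⟨fun _ _ => rfl, ?_, ?_⟩
  · simpa using (s₀.round_intCast 0).symm
  · simpa using (s₁.round_intCast 0).symm

theorem IsCorner.apply_two {k : ℕ} {hk : 3 ≤ k} {n : Fin k → Fin 3 → ℤ}
    {v : Fin (k + 1) → Fin 3 → ℤ} {α β γ δ : ℝ} (h : IsCorner hk n v α β γ δ)
    (h1 : ∀ i, n i 2 = 1) (j : Fin (k + 1)) : v j 2 = 1 := by
  obtain ⟨j, hj⟩ := j
  rcases Nat.lt_or_ge j (k - 1) with hjk | hjk
  · rw [h.of_lt j hjk, h1]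
  · rcases eq_or_ne j (k - 1) with rfl | hne
    · have := h.fst 2
      rw [h1, h1, Int.cast_one, mul_one, mul_one, h.alpha_add_beta] at this
      exact_mod_cast this
    · obtain rfl : j = k := by omega
      have := h.snd 2
      rw [h1, h1, Int.cast_one, mul_one, mul_one, h.gamma_add_delta] at this
      exact_mod_cast this

end ToricCM

theorem mainTheorem7 {𝕜 : Type*} [Field 𝕜] [IsAlgClosed 𝕜] [CharZero 𝕜] {k : ℕ}
    (n : Fin k → Fin 3 → ℤ) (hP : ToricCM.IsPolygon n)
    (t : ToricCM.Weights k 2) (n' : Fin (k + 2) → Fin 3 → ℤ) (hP' : ToricCM.IsCornerCut n t n')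
    (s : Fin 2 → ToricCM.PM) :
    (∀ b : Fin k → ℤ,
      ToricCM.IsCohenMacaulay (ToricCM.ToricRing 𝕜 n) (ToricCM.ToricModule 𝕜 n b) →
      ToricCM.IsCohenMacaulay (ToricCM.ToricRing 𝕜 (ToricCM.omitCorner n'))
        (ToricCM.ToricModule 𝕜 (ToricCM.omitCorner n')
          (ToricCM.omitCorner (ToricCM.convexInduce t s b)))) ∧
    (∀ S : Finset (Fin k → ℤ),
      ToricCM.IsCohenMacaulay (ToricCM.ToricRing 𝕜 n)
        (Module.End (ToricCM.ToricRing 𝕜 n) (⨁ b : S, ToricCM.ToricModule 𝕜 n b)) →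
      ToricCM.IsCohenMacaulay (ToricCM.ToricRing 𝕜 (ToricCM.omitCorner n'))
        (Module.End (ToricCM.ToricRing 𝕜 (ToricCM.omitCorner n'))
          (⨁ b : S, ToricCM.ToricModule 𝕜 (ToricCM.omitCorner n')
            (ToricCM.omitCorner (ToricCM.convexInduce t s b))))) := by
  have hn := hP.isConvexList
  have hk := hn.three_le
  obtain ⟨α, β, γ, δ, hcorner, hvec⟩ := hP'.exists_isCorner hk
  obtain ⟨K, g, hg, hframe, hcomp⟩ := hcorner.exists_isFrame hn hP'.nondegenerate
  refine ⟨fun b hb => ?_, fun S hS => ?_⟩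
  · refine hframe.isCohenMacaulay_module (hcomp _ _ _ _ (hvec s b)) fun m => ?_
    have h1 := hn.noAlternation_of_module hb m
    have h2 := hcorner.noAlternation (ToricCM.isCornerVector_zero hk α β γ δ (s 0) (s 1))
      (hvec s b) (m := m) (by simpa only [sub_zero] using h1)
    simp only [sub_zero] at h2
    exact h2.comp hg
  · refine hframe.isCohenMacaulay_end (hcorner.apply_two hP.2.1)
      (b := fun b : S => ToricCM.omitCorner (ToricCM.convexInduce t s b))
      (fun b => hcomp _ _ _ _ (hvec s b)) fun b b' m => ?_
    exact (hcorner.noAlternation (hvec s b) (hvec s b')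
      (hn.noAlternation_of_end hP.2.1 hS b b' m)).comp hg
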